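/- Let $\Bbbk$ be a field of characteristic $0$, let $Q$ be the quiver $1\xrightarrow{\alpha}2\xrightarrow{\beta}3$, and let $\mathbf d=(d_1,d_2,d_3)\in\mathbb N^3$. Let $\operatorname{Rep}(Q,\mathbf d)=\operatorname{Hom}(\Bbbk^{d_1},\Bbbk^{d_2})\oplus\operatorname{Hom}(\Bbbk^{d_2},\Bbbk^{d_3})$, regarded as an affine space, on which $\operatorname{GL}(\mathbf d)=\operatorname{GL}(d_1)\times\operatorname{GL}(d_2)\times\operatorname{GL}(d_3)$ acts by conjugation. Let $V\in\operatorname{Rep}(Q,\mathbf d)$ with $$V\cong S_1^{a_1}\oplus S_2^{a_2}\oplus S_3^{a_3}\oplus I_2^{b_1}\oplus P_2^{b_2}\oplus I_3^{c},$$ where $S_1,S_2,S_3,I_2,P_2,I_3$ are the indecomposable representations of $Q$ of dimension vectors $(1,0,0)$, $(0,1,0)$, $(0,0,1)$, $(1,1,0)$, $(0,1,1)$, $(1,1,1)$, respectively, and let $\overline O_V\subseteq\operatorname{Rep}(Q,\mathbf d)$ be the Zariski closure of the $\operatorname{GL}(\mathbf d)$-orbit of $V$, with its reduced structure. Let $\operatorname{Flag}(b_1+c,d_2-b_2,d_2)$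 be the variety of flags $R_1\subseteq R_2\subseteq\Bbbk^{d_2}$ with $\dim R_1=b_1+c$ and $\dim R_2=d_2-b_2$, let $\operatorname{Gr}(c,d_3)$ be the variety of $c$-dimensional subspaces $R\subseteq\Bbbk^{d_3}$, and let $$Z\subseteq\operatorname{Rep}(Q,\mathbf d)\times\operatorname{Flag}(b_1+c,d_2-b_2,d_2)\times\operatorname{Gr}(c,d_3)$$ be the incidence variety of all $(W,R_1\subseteq R_2,R)$ with $\operatorname{Im}W(\alpha)\subseteq R_1$ and $W(\beta)(R_2)\subseteq R$; that is, $Z$ is the $\Bbbk$-scheme whose points over a $\Bbbk$-algebra $A$ are, naturally in $A$, the tuples $(W,R_1\subseteq R_2,R)$ of this kind in which $W$ is a pair of matrices over $A$ and $R_1,R_2\subseteq A^{d_2}$, $R\subseteq A^{d_3}$ are locally direct summands of the given ranks (such a scheme exists, and it is unique up to a unique isomorphism). Then the projection $(W,R_1\subseteq R_2,R)\mapsto W$ defines a morphism $q:Z\to\overline O_V$ over $\Bbbk$, and $q$ is a resolution of singularities: $Z$ is integral and smooth over $\Bbbk$, and $q$ is proper and birational (an isomorphism over a dense open subset of $\overline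 O_V$ whose preimage is dense in $Z$). -/

import Mathlib

open CategoryTheory AlgebraicGeometry

universe u

noncomputable section

namespace EquiA3

/-! ### Representations of the equioriented quiver `1 --α--> 2 --β--> 3` -/

/-- A representation of the quiver `1 → 2 → 3` over `k`. -/
structure QRep (k : Type u) [Field k] where
  V₁ : ModuleCat.{u} k
  V₂ : ModuleCat.{u} k
  V₃ : ModuleCat.{u} k
  α : V₁ →ₗ[k] V₂
  β : V₂ →ₗ[k] V₃

namespace QRep

variable {k : Type u} [Field k]

/-- Two representations are isomorphic. -/
def Isomorphic (V W : QRep k) : Prop :=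
  ∃ (e₁ : V.V₁ ≃ₗ[k] W.V₁) (e₂ : V.V₂ ≃ₗ[k] W.V₂) (e₃ : V.V₃ ≃ₗ[k] W.V₃),
    (∀ x, e₂ (V.α x) = W.α (e₁ x)) ∧ (∀ y, e₃ (V.β y) = W.β (e₂ y))

/-- Direct sum of two representations. -/
def directSum (V W : QRep k) : QRep k where
  V₁ := ModuleCat.of k (V.V₁ × W.V₁)
  V₂ := ModuleCat.of k (V.V₂ × W.V₂)
  V₃ := ModuleCat.of k (V.V₃ × W.V₃)
  α := LinearMap.prodMap V.α W.α
  β := LinearMap.prodMap V.β W.β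

/-- Direct sum of `n` copies of a representation. -/
def power (V : QRep k) (n : ℕ) : QRep k where
  V₁ := ModuleCat.of k (Fin n → V.V₁)
  V₂ := ModuleCat.of k (Fin n → V.V₂)
  V₃ := ModuleCat.of k (Fin n → V.V₃)
  α := LinearMap.pi fun i => V.α ∘ₗ LinearMap.proj i
  β := LinearMap.pi fun i => V.β ∘ₗ LinearMap.proj i

variable (k)

/-- The simple representation of dimension vector `(1,0,0)`. -/
def S₁ : QRep k where
  V₁ := ModuleCat.of k k
  V₂ := ModuleCat.of k PUnit.{u + 1}
  V₃ := ModuleCat.of k PUnit.{u + 1}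
  α := 0
  β := 0

/-- The simple representation of dimension vector `(0,1,0)`. -/
def S₂ : QRep k where
  V₁ := ModuleCat.of k PUnit.{u + 1}
  V₂ := ModuleCat.of k k
  V₃ := ModuleCat.of k PUnit.{u + 1}
  α := 0
  β := 0

/-- The simple representation of dimension vector `(0,0,1)`. -/
def S₃ : QRep k where
  V₁ := ModuleCat.of k PUnit.{u + 1}
  V₂ := ModuleCat.of k PUnit.{u + 1}
  V₃ := ModuleCat.of k k
  α := 0
  β := 0

/-- The indecomposable representation `k = k → 0` of dimension vector `(1,1,0)`. -/
def I₂ : QRep k where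
  V₁ := ModuleCat.of k k
  V₂ := ModuleCat.of k k
  V₃ := ModuleCat.of k PUnit.{u + 1}
  α := LinearMap.id
  β := 0

/-- The indecomposable representation `0 → k = k` of dimension vector `(0,1,1)`. -/
def P₂ : QRep k where
  V₁ := ModuleCat.of k PUnit.{u + 1}
  V₂ := ModuleCat.of k k
  V₃ := ModuleCat.of k k
  α := 0
  β := LinearMap.id

/-- The indecomposable representation `k = k = k` of dimension vector `(1,1,1)`. -/
def I₃ : QRep k where
  V₁ := ModuleCat.of k k
  V₂ := ModuleCat.of k k
  V₃ := ModuleCat.of k k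
  α := LinearMap.id
  β := LinearMap.id

/-- `S₁^a₁ ⊕ S₂^a₂ ⊕ S₃^a₃ ⊕ I₂^b₁ ⊕ P₂^b₂ ⊕ I₃^c`. -/
def ofMultiplicities (a₁ a₂ a₃ b₁ b₂ c : ℕ) : QRep k :=
  ((S₁ k).power a₁).directSum <| ((S₂ k).power a₂).directSum <| ((S₃ k).power a₃).directSum <|
    ((I₂ k).power b₁).directSum <| ((P₂ k).power b₂).directSum ((I₃ k).power c)

end QRep

/-! ### The representation space, its group action and orbit closures -/

/-- The set `Rep(Q, (d₁, d₂, d₃))(A) = Hom(A^d₁, A^d₂) ⊕ Hom(A^d₂, A^d₃)`, in matrices. -/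
@[ext]
structure RepSpace (A : Type u) [CommRing A] (d₁ d₂ d₃ : ℕ) where
  α : Matrix (Fin d₂) (Fin d₁) A
  β : Matrix (Fin d₃) (Fin d₂) A

/-- Index set of the coordinates on the affine space `Rep(Q, (d₁, d₂, d₃))`. -/
abbrev Coord (d₁ d₂ d₃ : ℕ) : Type := (Fin d₂ × Fin d₁) ⊕ (Fin d₃ × Fin d₂)

namespace RepSpace

variable {d₁ d₂ d₃ : ℕ}

/-- The vector of coordinates (matrix entries). -/
def coords {A : Type u} [CommRing A] (V : RepSpace A d₁ d₂ d₃) : Coord d₁ d₂ d₃ → A :=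
  Sum.elim (fun p => V.α p.1 p.2) (fun p => V.β p.1 p.2)

/-- The action of `GL(d₁) × GL(d₂) × GL(d₃)` by conjugation. -/
def act {k : Type u} [Field k] (g₁ : GL (Fin d₁) k) (g₂ : GL (Fin d₂) k) (g₃ : GL (Fin d₃) k)
    (V : RepSpace k d₁ d₂ d₃) : RepSpace k d₁ d₂ d₃ where
  α := g₂.val * V.α * (g₁⁻¹).val
  β := g₃.val * V.β * (g₂⁻¹).val

/-- The orbit `O_V`. -/
def orbit {k : Type u} [Field k] (V : RepSpace k d₁ d₂ d₃) : Set (RepSpace k d₁ d₂ d₃) :=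
  {W | ∃ g₁ g₂ g₃, W = act g₁ g₂ g₃ V}

/-- An element of `Rep(Q, d)` as a representation of the quiver. -/
def toQRep {k : Type u} [Field k] (V : RepSpace k d₁ d₂ d₃) : QRep k where
  V₁ := ModuleCat.of k (Fin d₁ → k)
  V₂ := ModuleCat.of k (Fin d₂ → k)
  V₃ := ModuleCat.of k (Fin d₃ → k)
  α := Matrix.toLin' V.α
  β := Matrix.toLin' V.β

end RepSpace

/-- The affine space `Rep(Q, (d₁, d₂, d₃))` as a scheme. -/
def repScheme (k : Type u) [Field k] (d₁ d₂ d₃ : ℕ) : Scheme.{u} :=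
  Spec (CommRingCat.of (MvPolynomial (Coord d₁ d₂ d₃) k))

/-- The `A`-point of the scheme `Rep(Q, d)` given by a pair of matrices over `A`. -/
def repPoint (k : Type u) [Field k] {A : Type u} [CommRing A] [Algebra k A] {d₁ d₂ d₃ : ℕ}
    (W : RepSpace A d₁ d₂ d₃) : Spec (CommRingCat.of A) ⟶ repScheme k d₁ d₂ d₃ :=
  Spec.map (CommRingCat.ofHom
    (MvPolynomial.aeval W.coords : MvPolynomial (Coord d₁ d₂ d₃) k →ₐ[k] A).toRingHom)

section OrbitClosure

variable {k : Type u} [Field k] {d₁ d₂ d₃ : ℕ} (V : RepSpace k d₁ d₂ d₃)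

/-- The ideal of all polynomial functions on `Rep(Q, d)` that vanish on the orbit of `V`. -/
def orbitIdeal : Ideal (MvPolynomial (Coord d₁ d₂ d₃) k) :=
  MvPolynomial.vanishingIdeal k (RepSpace.coords '' V.orbit)

/-- The Zariski closure of the orbit of `V`, as a closed (reduced) subscheme of `Rep(Q, d)`. -/
def orbitClosure : Scheme.{u} :=
  Spec (CommRingCat.of (MvPolynomial (Coord d₁ d₂ d₃) k ⧸ orbitIdeal V))

/-- The inclusion of the orbit closure into `Rep(Q, d)`. -/
def orbitClosureι : orbitClosure V ⟶ repScheme k d₁ d₂ d₃ :=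
  Spec.map (CommRingCat.ofHom (Ideal.Quotient.mk (orbitIdeal V)))

/-- The structure morphism of the orbit closure. -/
def orbitClosureStr : orbitClosure V ⟶ Spec (CommRingCat.of k) :=
  Spec.map (CommRingCat.ofHom
    (algebraMap k (MvPolynomial (Coord d₁ d₂ d₃) k ⧸ orbitIdeal V)))

end OrbitClosure

/-! ### Grassmannians, flags and the incidence variety, through their points -/

/-- The `A`-points of `Gr(r, n)`: the submodules `N` of `A ^ n` that are locally direct summands
(i.e. `A ^ n ⧸ N` is projective) of rank `r`. Over a field: the `r`-dimensional subspaces. -/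
@[ext]
structure Gr (A : Type u) [CommRing A] (r n : ℕ) where
  sub : Submodule A (Fin n → A)
  projective_quotient : Module.Projective A ((Fin n → A) ⧸ sub)
  rank_eq : ∀ p : PrimeSpectrum A, Module.rankAtStalk sub p = r

/-- The `A`-points `R₁ ⊆ R₂ ⊆ A ^ n` of the two-step flag variety `Flag(r₁, r₂, n)`. -/
@[ext]
structure Flag (A : Type u) [CommRing A] (r₁ r₂ n : ℕ) where
  R₁ : Gr A r₁ n
  R₂ : Gr A r₂ n
  le : R₁.sub ≤ R₂.sub

/-- The `A`-points of the incidence variety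
`Z ⊆ Rep(Q, (d₁, d₂, d₃)) × Flag(r₁, r₂, d₂) × Gr(c, d₃)`:
those `(V, R₁ ⊆ R₂, R)` with `Im V(α) ⊆ R₁` and `V(β)(R₂) ⊆ R`. -/
@[ext]
structure IncidencePoint (A : Type u) [CommRing A] (d₁ d₂ d₃ r₁ r₂ c : ℕ) where
  V : RepSpace A d₁ d₂ d₃
  F : Flag A r₁ r₂ d₂
  R : Gr A c d₃
  range_le : LinearMap.range (Matrix.toLin' V.α) ≤ F.R₁.sub
  map_le : F.R₂.sub.map (Matrix.toLin' V.β) ≤ R.sub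

/-- Extension of scalars of a submodule of `A ^ n` along `f : A → B`: the submodule of `B ^ n`
generated by its image. -/
def extendSub {A B : Type u} [CommRing A] [CommRing B] (f : A →+* B) {n : ℕ}
    (N : Submodule A (Fin n → A)) : Submodule B (Fin n → B) :=
  Submodule.span B ((fun v i => f (v i)) '' (N : Set (Fin n → A)))

/-- `Q` is the image of the `A`-point `P` under the map on points induced by `f : A → B`. -/
structure IncidencePoint.IsBaseChange {A B : Type u} [CommRing A] [CommRing B] (f : A →+* B)
    {d₁ d₂ d₃ r₁ r₂ c : ℕ} (P : IncidencePoint A d₁ d₂ d₃ r₁ r₂ c)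
    (Q : IncidencePoint B d₁ d₂ d₃ r₁ r₂ c) : Prop where
  α : Q.V.α = P.V.α.map f
  β : Q.V.β = P.V.β.map f
  R₁ : Q.F.R₁.sub = extendSub f P.F.R₁.sub
  R₂ : Q.F.R₂.sub = extendSub f P.F.R₂.sub
  R : Q.R.sub = extendSub f P.R.sub

/-- The `A`-points, over `k`, of a `k`-scheme `Z` with structure morphism `s`. -/
def Points {k : Type u} [Field k] {Z : Scheme.{u}} (s : Z ⟶ Spec (CommRingCat.of k))
    (A : Type u) [CommRing A] [Algebra k A] : Type u :=
  {x : Spec (CommRingCat.of A) ⟶ Z // x ≫ s = Spec.map (CommRingCat.ofHom (algebraMap k A))}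

/-- An identification of the `k`-scheme `Z` with the incidence variety: bijections between the
`A`-points of `Z` and the incidence points over `A`, natural in the `k`-algebra `A`.
By the Yoneda lemma this determines `Z` up to a unique isomorphism over `k`. -/
structure IncidenceVarietyStr {k : Type u} [Field k] {Z : Scheme.{u}}
    (s : Z ⟶ Spec (CommRingCat.of k)) (d₁ d₂ d₃ r₁ r₂ c : ℕ) where
  equiv : ∀ (A : Type u) [CommRing A] [Algebra k A],
    Points s A ≃ IncidencePoint A d₁ d₂ d₃ r₁ r₂ c
  natural : ∀ (A B : Type u) [CommRing A] [Algebra k A] [CommRing B] [Algebra k B]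
    (f : A →ₐ[k] B) (x : Points s A) (y : Points s B),
    y.1 = Spec.map (CommRingCat.ofHom f.toRingHom) ≫ x.1 →
      (equiv A x).IsBaseChange f.toRingHom (equiv B y)

/-- `q : Z → closure of O_V` is the projection `(W, R₁ ⊆ R₂, R) ↦ W`, on points over all
`k`-algebras. -/
def IsFirstProjection {k : Type u} [Field k] {Z : Scheme.{u}} {s : Z ⟶ Spec (CommRingCat.of k)}
    {d₁ d₂ d₃ r₁ r₂ c : ℕ} (e : IncidenceVarietyStr s d₁ d₂ d₃ r₁ r₂ c)
    {V : RepSpace k d₁ d₂ d₃} (q : Z ⟶ orbitClosure V) : Prop :=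
  ∀ (A : Type u) [CommRing A] [Algebra k A] (x : Points s A),
    x.1 ≫ q ≫ orbitClosureι V = repPoint k (e.equiv A x).V

/-! ### Resolutions of singularities -/

/-- A morphism `q : Z → X` of schemes over a field `k` of characteristic zero (where smooth over
`k` is the same as nonsingular) is a resolution of singularities of `X`: the scheme `Z` is
integral and smooth over `k`, and `q` is proper and birational, i.e. an isomorphism over a dense
open subset of `X` with dense preimage in `Z`. -/
structure IsResolutionOfSingularities {k : Type u} [Field k] {Z X : Scheme.{u}}
    (s : Z ⟶ Spec (CommRingCat.of k)) (t : X ⟶ Spec (CommRingCat.of k)) (q : Z ⟶ X) : Prop where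
  comp_eq : q ≫ t = s
  integral : IsIntegral Z
  smooth : Smooth s
  proper : IsProper q
  birational : ∃ U : X.Opens, Dense (U : Set X) ∧ Dense ((q ⁻¹ᵁ U : Z.Opens) : Set Z) ∧
    IsIso (q ∣_ U)

end EquiA3

end

noncomputable section

namespace EquiA3

open Limits

/-! ### Gluing a scheme from its functor of points -/

/-! The incidence variety is built from its functor of points and then compared with the orbit
closure through a discriminant. Locally, choose coordinates on which $R_2$, $R_1$ inside $R_2$, and
$R$ project isomorphically. The three modules then become graphs of arbitrary matrices; $\alpha$ is
an arbitrary map into $R_1$; $\beta$ is an arbitrary map $R_2\to R$ together with arbitrary values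
on a complement of $R_2$. So each chart is an affine space without equations, and overlaps are
principal (`ChartIndex.exists_eq_incidencePoint_iff`). Since incidence points satisfy Zariski
descent, gluing the charts gives a scheme with exactly the required points (`incidenceCover`,
`ChartCover.point_injective`, `ChartCover.point_surjective`).

Affine-space charts make $Z$ smooth and reduced. It is irreducible because one point lies in all
charts: take spans of columns of Vandermonde matrices with nodes $0,\dots,n-1$, which are distinct
in characteristic $0$. Properness over the representation space is the valuative criterion: over a
valuation ring a subspace of $K^n$ extends uniquely, by its intersection with $R^n$.

By `NormalForm.mem_orbit_iff` the orbit of $V$ is the set of $W$ for which $\alpha$, $\beta$ and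
$\beta\alpha$ have the same ranks as for $V$. A suitable product of minors (`MinorChoice.discr`) is
nonzero at $V$, and at any incidence point over $k$ its nonvanishing forces these ranks. Hence, if
$f$ vanishes on the orbit, $f$ times the discriminant vanishes at all $k$-points of a chart meeting
the fibre over $V$. As $k$ is infinite and the discriminant is not identically zero on that chart,
$f$ pulls back to zero on the integral scheme $Z$ (`globalHom_incToRep_eq_zero`). This gives $q$.

Points of the orbit lift to $Z$, with $R_1=\operatorname{Im}\alpha$,
$R_2=\beta^{-1}(\operatorname{Im}\beta\alpha)$ and $R=\operatorname{Im}\beta\alpha$. As $q$ is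
proper, it is therefore surjective. Where the discriminant is invertible, over any ring, $W$
determines the flags (`MinorChoice.incidencePoint_ext`), so $q$ is a monomorphism there. A proper
monomorphism is a closed immersion, and a surjective closed immersion onto a reduced scheme is an
isomorphism. No inverse of $q$ has to be written down. -/

/-- The morphism of affine schemes given by a homomorphism of rings. -/
abbrev specMap {A B : Type u} [CommRing A] [CommRing B] (f : A →+* B) :
    Spec (CommRingCat.of B) ⟶ Spec (CommRingCat.of A) :=
  Spec.map (CommRingCat.ofHom f)

theorem specMap_comp {A B C : Type u} [CommRing A] [CommRing B] [CommRing C]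
    (f : A →+* B) (g : B →+* C) : specMap (g.comp f) = specMap g ≫ specMap f := by
  simp [specMap]

theorem exists_eq_specMap {A B : Type u} [CommRing A] [CommRing B]
    (x : Spec (CommRingCat.of B) ⟶ Spec (CommRingCat.of A)) : ∃ f : A →+* B, x = specMap f :=
  ⟨(Spec.preimage x).hom, by simp [specMap]⟩

theorem specMap_injective {A B : Type u} [CommRing A] [CommRing B] {f g : A →+* B}
    (h : specMap f = specMap g) : f = g := by
  have := Spec.map_injective h
  simpa using congrArg CommRingCat.Hom.hom this

/-- Two morphisms that agree on all affine points agree. -/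
theorem hom_ext_of_affine_points {X Y : Scheme.{u}} (f g : X ⟶ Y)
    (H : ∀ (A : Type u) [CommRing A] (x : Spec (CommRingCat.of A) ⟶ X), x ≫ f = x ≫ g) :
    f = g :=
  X.affineCover.hom_ext _ _ fun i => H _ (X.affineCover.f i)

/-- Morphisms on the members of an affine open cover that agree on all common affine points
can be glued. -/
theorem exists_glue_affine {X Y : Scheme.{u}} {ι : Type u} (A : ι → Type u)
    [∀ i, CommRing (A i)] (j : ∀ i, Spec (CommRingCat.of (A i)) ⟶ X)
    [∀ i, IsOpenImmersion (j i)] (hj : ∀ x : X, ∃ i y, j i y = x)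
    (f : ∀ i, Spec (CommRingCat.of (A i)) ⟶ Y)
    (hf : ∀ (i i' : ι) (B : Type u) [CommRing B] (a : A i →+* B) (b : A i' →+* B),
      specMap a ≫ j i = specMap b ≫ j i' → specMap a ≫ f i = specMap b ≫ f i') :
    ∃ q : X ⟶ Y, ∀ i, j i ≫ q = f i := by
  let 𝒰 : X.OpenCover :=
    { I₀ := ι
      X := fun i => Spec (CommRingCat.of (A i))
      f := j
      mem₀ := by
        rw [Scheme.presieve₀_mem_precoverage_iff]
        exact ⟨fun x => hj x, inferInstance⟩ }
  -- The overlap of two affine opens need not be affine, so agreement on it is tested on its affine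
  -- points.
  have key : ∀ p q : ι, pullback.fst (j p) (j q) ≫ f p = pullback.snd (j p) (j q) ≫ f q := by
    intro p q
    apply hom_ext_of_affine_points
    intro B _ y
    obtain ⟨a, ha⟩ := exists_eq_specMap (y ≫ pullback.fst (j p) (j q))
    obtain ⟨b, hb⟩ := exists_eq_specMap (y ≫ pullback.snd (j p) (j q))
    rw [← Category.assoc, ← Category.assoc, ha, hb]
    apply hf
    rw [← ha, ← hb, Category.assoc, Category.assoc, pullback.condition]
  exact ⟨𝒰.glueMorphisms f key, fun i => 𝒰.ι_glueMorphisms f key i⟩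

theorem exists_notMem_of_span_eq_top {A : Type u} [CommRing A] {ι : Type u} (f : ι → A)
    (hf : Ideal.span (Set.range f) = ⊤) (p : PrimeSpectrum A) : ∃ i, f i ∉ p.asIdeal := by
  by_contra! h
  refine p.2.ne_top (top_le_iff.1 (hf ▸ Ideal.span_le.2 ?_))
  rintro _ ⟨i, rfl⟩
  exact h i

/-- The basic opens of the `f i` cover `Spec A`, so this is the sheaf property of morphisms to `Y`.
Compatibility over every common target `B` replaces explicit localizations at products `f i * f j`.
-/
theorem exists_glue_of_span {A : Type u} [CommRing A] {ι : Type u} (f : ι → A)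
    (hf : Ideal.span (Set.range f) = ⊤) {Y : Scheme.{u}}
    (x : ∀ i, Spec (CommRingCat.of (Localization.Away (f i))) ⟶ Y)
    (hx : ∀ (i j : ι) (B : Type u) [CommRing B] (g : Localization.Away (f i) →+* B)
      (h : Localization.Away (f j) →+* B), g.comp (algebraMap A _) = h.comp (algebraMap A _) →
        specMap g ≫ x i = specMap h ≫ x j) :
    ∃ y : Spec (CommRingCat.of A) ⟶ Y,
      ∀ i, specMap (algebraMap A (Localization.Away (f i))) ≫ y = x i := by
  have (i : ι) : IsOpenImmersion (specMap (algebraMap A (Localization.Away (f i)))) :=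
    inferInstanceAs (IsOpenImmersion
      (Spec.map (CommRingCat.ofHom (algebraMap _ (Localization.Away _)))))
  refine exists_glue_affine (fun i => Localization.Away (f i))
    (fun i => specMap (algebraMap A (Localization.Away (f i)))) (fun p => ?_) x ?_
  · obtain ⟨i, hi⟩ := exists_notMem_of_span_eq_top f hf p
    have : p ∈ (PrimeSpectrum.basicOpen (f i) : Set (PrimeSpectrum A)) := hi
    rw [← PrimeSpectrum.localization_away_comap_range (Localization.Away (f i)) (f i)] at this
    obtain ⟨z, hz⟩ := this
    exact ⟨i, z, hz⟩
  · intro i j B _ a b hab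
    rw [← specMap_comp, ← specMap_comp] at hab
    exact hx i j B a b (specMap_injective hab)

/-! ### Representability of a Zariski sheaf covered by affine charts -/

/-- A functor from commutative rings to types. -/
structure PointFunctor where
  obj : (A : Type u) → [CommRing A] → Type u
  map : {A B : Type u} → [CommRing A] → [CommRing B] → (A →+* B) → obj A → obj B
  map_id : ∀ (A : Type u) [CommRing A] (P : obj A), map (RingHom.id A) P = P
  map_comp : ∀ {A B C : Type u} [CommRing A] [CommRing B] [CommRing C] (f : A →+* B) (g : B →+* C)
    (P : obj A), map (g.comp f) P = map g (map f P)

/-- A covering of a Zariski sheaf on commutative rings by affine open charts with principal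
overlaps. -/
structure ChartCover (F : PointFunctor.{u}) where
  J : Type u
  R : J → Type u
  [commRing : ∀ i, CommRing (R i)]
  pt : ∀ i, F.obj (R i)
  inj : ∀ (i : J) (A : Type u) [CommRing A] (g h : R i →+* A),
    F.map g (pt i) = F.map h (pt i) → g = h
  D : (i : J) → J → R i
  mem_iff : ∀ (i j : J) (A : Type u) [CommRing A] (h : R i →+* A),
    (∃ g : R j →+* A, F.map g (pt j) = F.map h (pt i)) ↔ IsUnit (h (D i j))
  cover : ∀ (A : Type u) [CommRing A] (P : F.obj A) (p : PrimeSpectrum A), ∃ f ∉ p.asIdeal,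
    ∃ (i : J) (h : R i →+* Localization.Away f),
      F.map (algebraMap A (Localization.Away f)) P = F.map h (pt i)
  separated : ∀ (A : Type u) [CommRing A] (ι : Type u) (f : ι → A),
    Ideal.span (Set.range f) = ⊤ → ∀ P Q : F.obj A,
    (∀ i, F.map (algebraMap A (Localization.Away (f i))) P =
      F.map (algebraMap A (Localization.Away (f i))) Q) → P = Q
  glue : ∀ (A : Type u) [CommRing A] (ι : Type u) (f : ι → A),
    Ideal.span (Set.range f) = ⊤ → ∀ P : (i : ι) → F.obj (Localization.Away (f i)),
    (∀ (i j : ι) (B : Type u) [CommRing B] (g : Localization.Away (f i) →+* B)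
      (h : Localization.Away (f j) →+* B),
      g.comp (algebraMap A _) = h.comp (algebraMap A _) → F.map g (P i) = F.map h (P j)) →
    ∃ Q : F.obj A, ∀ i, F.map (algebraMap A (Localization.Away (f i))) Q = P i

attribute [instance] ChartCover.commRing

namespace ChartCover

variable {F : PointFunctor.{u}} (𝒞 : ChartCover F)

/-- The ring homomorphism corresponding to a morphism to an affine scheme. -/
def globalHom {A : Type u} [CommRing A] {Y : Scheme.{u}} (a : Y ⟶ Spec (CommRingCat.of A)) :
    A →+* Γ(Y, ⊤) :=
  ((Scheme.ΓSpecIso (CommRingCat.of A)).inv ≫ a.appTop).hom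

theorem globalHom_comp {A : Type u} [CommRing A] {X Y : Scheme.{u}} (b : X ⟶ Y)
    (a : Y ⟶ Spec (CommRingCat.of A)) :
    globalHom (b ≫ a) = b.appTop.hom.comp (globalHom a) := by
  have : (Scheme.ΓSpecIso (CommRingCat.of A)).inv ≫ (b ≫ a).appTop =
      ((Scheme.ΓSpecIso (CommRingCat.of A)).inv ≫ a.appTop) ≫ b.appTop := by
    rw [Scheme.Hom.comp_appTop, Category.assoc]
  exact congrArg CommRingCat.Hom.hom this

theorem globalHom_comp_specMap {A B : Type u} [CommRing A] [CommRing B] {Y : Scheme.{u}}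
    (a : Y ⟶ Spec (CommRingCat.of B)) (f : A →+* B) :
    globalHom (a ≫ specMap f) = (globalHom a).comp f := by
  have := Scheme.ΓSpecIso_inv_naturality (CommRingCat.ofHom f)
  have h2 : (Scheme.ΓSpecIso (CommRingCat.of A)).inv ≫ (a ≫ specMap f).appTop =
      CommRingCat.ofHom f ≫ (Scheme.ΓSpecIso (CommRingCat.of B)).inv ≫ a.appTop := by
    rw [Scheme.Hom.comp_appTop, ← Category.assoc, ← this, Category.assoc]
  exact congrArg CommRingCat.Hom.hom h2

theorem globalHom_injective {A : Type u} [CommRing A] {Y : Scheme.{u}}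
    {a b : Y ⟶ Spec (CommRingCat.of A)} (h : globalHom a = globalHom b) : a = b := by
  apply ext_of_isAffine
  have h1 : (Scheme.ΓSpecIso (CommRingCat.of A)).inv ≫ a.appTop =
      (Scheme.ΓSpecIso (CommRingCat.of A)).inv ≫ b.appTop := CommRingCat.hom_ext h
  exact (cancel_epi _).1 h1

theorem exists_globalHom_eq {A : Type u} [CommRing A] {Y : Scheme.{u}} (f : A →+* Γ(Y, ⊤)) :
    ∃ a : Y ⟶ Spec (CommRingCat.of A), globalHom a = f := by
  refine ⟨Y.toSpecΓ ≫ Spec.map (CommRingCat.ofHom f), ?_⟩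
  have := Scheme.ΓSpecIso_inv_naturality (CommRingCat.ofHom f)
  have h2 : (Scheme.ΓSpecIso (CommRingCat.of A)).inv ≫
      (Y.toSpecΓ ≫ Spec.map (CommRingCat.ofHom f)).appTop = CommRingCat.ofHom f := by
    rw [Scheme.Hom.comp_appTop, ← Category.assoc, ← this, Category.assoc,
      Scheme.toSpecΓ_appTop]
    simp
  exact congrArg CommRingCat.Hom.hom h2

/-- The point of `F` over the global sections given by a morphism to a chart. -/
def chartPt (i : 𝒞.J) {Y : Scheme.{u}} (a : Y ⟶ Spec (CommRingCat.of (𝒞.R i))) :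
    F.obj Γ(Y, ⊤) :=
  F.map (globalHom a) (𝒞.pt i)

theorem chartPt_comp (i : 𝒞.J) {X Y : Scheme.{u}} (b : X ⟶ Y)
    (a : Y ⟶ Spec (CommRingCat.of (𝒞.R i))) :
    𝒞.chartPt i (b ≫ a) = F.map b.appTop.hom (𝒞.chartPt i a) := by
  simp only [chartPt, globalHom_comp, F.map_comp]

theorem chartPt_injective (i : 𝒞.J) {Y : Scheme.{u}} {a b : Y ⟶ Spec (CommRingCat.of (𝒞.R i))}
    (h : 𝒞.chartPt i a = 𝒞.chartPt i b) : a = b :=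
  globalHom_injective (𝒞.inj i _ _ _ h)

/-- The coordinate ring of the overlap of two charts. -/
abbrev overlapRing (i j : 𝒞.J) : Type u := Localization.Away (𝒞.D i j)

/-- The overlap of two charts, inside the first one. -/
abbrev overlapι (i j : 𝒞.J) :
    Spec (CommRingCat.of (𝒞.overlapRing i j)) ⟶ Spec (CommRingCat.of (𝒞.R i)) :=
  specMap (algebraMap (𝒞.R i) (𝒞.overlapRing i j))

instance (i j : 𝒞.J) : IsOpenImmersion (𝒞.overlapι i j) :=
  inferInstanceAs (IsOpenImmersion (Spec.map (CommRingCat.ofHom (algebraMap _ (Localization.Away _)))))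

/-- Equal points of `F` over the global sections of `Y` make `D i j` invertible there by `mem_iff`,
and then the homomorphism from `R i` factors through the localization. -/
theorem exists_overlap_lift (i j : 𝒞.J) {Y : Scheme.{u}} (a : Y ⟶ Spec (CommRingCat.of (𝒞.R i)))
    (b : Y ⟶ Spec (CommRingCat.of (𝒞.R j))) (h : 𝒞.chartPt i a = 𝒞.chartPt j b) :
    ∃ l : Y ⟶ Spec (CommRingCat.of (𝒞.overlapRing i j)), l ≫ 𝒞.overlapι i j = a := by
  have hu : IsUnit (globalHom a (𝒞.D i j)) := (𝒞.mem_iff i j _ _).1 ⟨globalHom b, h.symm⟩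
  obtain ⟨l, hl⟩ := exists_globalHom_eq (Y := Y)
    (IsLocalization.Away.lift (S := 𝒞.overlapRing i j) (𝒞.D i j) hu)
  refine ⟨l, globalHom_injective ?_⟩
  rw [globalHom_comp_specMap, hl]
  exact IsLocalization.Away.lift_comp _ _

theorem exists_other (i j : 𝒞.J) :
    ∃ b : Spec (CommRingCat.of (𝒞.overlapRing i j)) ⟶ Spec (CommRingCat.of (𝒞.R j)),
      𝒞.chartPt j b = 𝒞.chartPt i (𝒞.overlapι i j) := by
  obtain ⟨g, hg⟩ := (𝒞.mem_iff i j _ (algebraMap _ (𝒞.overlapRing i j))).2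
    (IsLocalization.Away.algebraMap_isUnit _)
  have key : ∀ (l : 𝒞.J) (f : 𝒞.R l →+* 𝒞.overlapRing i j), 𝒞.chartPt l (specMap f) =
      F.map (globalHom (𝟙 (Spec (CommRingCat.of (𝒞.overlapRing i j))))) (F.map f (𝒞.pt l)) := by
    intro l f
    rw [← F.map_comp, ← globalHom_comp_specMap, Category.id_comp]
    rfl
  exact ⟨specMap g, by rw [key, key, hg]⟩

theorem exists_transition (i j : 𝒞.J) :
    ∃ t : Spec (CommRingCat.of (𝒞.overlapRing i j)) ⟶ Spec (CommRingCat.of (𝒞.overlapRing j i)),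
      𝒞.chartPt j (t ≫ 𝒞.overlapι j i) = 𝒞.chartPt i (𝒞.overlapι i j) := by
  obtain ⟨b, hb⟩ := 𝒞.exists_other i j
  obtain ⟨t, ht⟩ := 𝒞.exists_overlap_lift j i b (𝒞.overlapι i j) hb
  exact ⟨t, by rw [ht, hb]⟩

/-- The transition maps between charts. -/
def transition (i j : 𝒞.J) :
    Spec (CommRingCat.of (𝒞.overlapRing i j)) ⟶ Spec (CommRingCat.of (𝒞.overlapRing j i)) :=
  (𝒞.exists_transition i j).choose

/-- The only property of the transition maps that matters: they do not change the underlying point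
of `F`. Together with `chartPt_injective` it yields every identity of the glueing data. -/
theorem chartPt_transition (i j : 𝒞.J) {Y : Scheme.{u}}
    (l : Y ⟶ Spec (CommRingCat.of (𝒞.overlapRing i j))) :
    𝒞.chartPt j (l ≫ 𝒞.transition i j ≫ 𝒞.overlapι j i) =
      𝒞.chartPt i (l ≫ 𝒞.overlapι i j) := by
  rw [𝒞.chartPt_comp j l, 𝒞.chartPt_comp i l]
  exact congrArg _ (𝒞.exists_transition i j).choose_spec

theorem exists_transition₃ (i j l : 𝒞.J) :
    ∃ t : pullback (𝒞.overlapι i j) (𝒞.overlapι i l) ⟶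
      pullback (𝒞.overlapι j l) (𝒞.overlapι j i),
      t ≫ pullback.snd _ _ = pullback.fst _ _ ≫ 𝒞.transition i j := by
  obtain ⟨m, hm⟩ := 𝒞.exists_overlap_lift j l
    (pullback.fst (𝒞.overlapι i j) (𝒞.overlapι i l) ≫ 𝒞.transition i j ≫ 𝒞.overlapι j i)
    (pullback.snd (𝒞.overlapι i j) (𝒞.overlapι i l) ≫ 𝒞.transition i l ≫ 𝒞.overlapι l i)
    (by rw [chartPt_transition, chartPt_transition, pullback.condition])
  exact ⟨pullback.lift m (pullback.fst _ _ ≫ 𝒞.transition i j) (by rw [hm, Category.assoc]), pullback.lift_snd _ _ _⟩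

/-- The transition maps on triple overlaps. -/
def transition₃ (i j l : 𝒞.J) :
    pullback (𝒞.overlapι i j) (𝒞.overlapι i l) ⟶ pullback (𝒞.overlapι j l) (𝒞.overlapι j i) :=
  (𝒞.exists_transition₃ i j l).choose

theorem transition₃_snd (i j l : 𝒞.J) :
    𝒞.transition₃ i j l ≫ pullback.snd _ _ = pullback.fst _ _ ≫ 𝒞.transition i j :=
  (𝒞.exists_transition₃ i j l).choose_spec

theorem chartPt_transition₃ (i j l : 𝒞.J) {Y : Scheme.{u}}
    (a : Y ⟶ pullback (𝒞.overlapι i j) (𝒞.overlapι i l)) :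
    𝒞.chartPt j ((a ≫ 𝒞.transition₃ i j l) ≫ pullback.fst _ _ ≫ 𝒞.overlapι j l) =
      𝒞.chartPt i (a ≫ pullback.fst _ _ ≫ 𝒞.overlapι i j) := by
  rw [pullback.condition, Category.assoc, reassoc_of% 𝒞.transition₃_snd i j l,
    ← Category.assoc, chartPt_transition, Category.assoc]

/-- The glueing data of the charts. -/
def glueData : Scheme.GlueData.{u} where
  J := 𝒞.J
  U i := Spec (CommRingCat.of (𝒞.R i))
  V p := Spec (CommRingCat.of (𝒞.overlapRing p.1 p.2))
  f i j := 𝒞.overlapι i j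
  f_id i := by
    obtain ⟨l, hl⟩ := 𝒞.exists_overlap_lift i i (𝟙 _) (𝟙 _) rfl
    refine ⟨l, ?_, hl⟩
    rw [← cancel_mono (𝒞.overlapι i i), Category.assoc, hl, Category.comp_id, Category.id_comp]
  t := 𝒞.transition
  t_id i := by
    rw [← cancel_mono (𝒞.overlapι i i)]
    apply 𝒞.chartPt_injective i
    have := 𝒞.chartPt_transition i i (𝟙 _)
    simpa using this
  t' := 𝒞.transition₃
  t_fac := 𝒞.transition₃_snd
  -- Going round the triple overlap preserves the point of `F`, and a morphism to a chart is
  -- determined by that point.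
  cocycle i j l := by
    rw [← cancel_mono (pullback.fst _ _), ← cancel_mono (𝒞.overlapι i j)]
    apply 𝒞.chartPt_injective i
    have h1 := 𝒞.chartPt_transition₃ l i j (𝒞.transition₃ i j l ≫ 𝒞.transition₃ j l i)
    have h2 := 𝒞.chartPt_transition₃ j l i (𝒞.transition₃ i j l)
    have h3 := 𝒞.chartPt_transition₃ i j l (𝟙 _)
    rw [h2] at h1
    simp only [Category.id_comp, Category.assoc] at h1 h3 ⊢
    rw [h1, h3]
  f_open i j := inferInstance

/-- The scheme glued from the charts. -/
def scheme : Scheme.{u} := 𝒞.glueData.glued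

/-- The inclusion of a chart. -/
def chartι (i : 𝒞.J) : Spec (CommRingCat.of (𝒞.R i)) ⟶ 𝒞.scheme := 𝒞.glueData.ι i

instance isOpenImmersion_chartι (i : 𝒞.J) : IsOpenImmersion (𝒞.chartι i) :=
  Scheme.GlueData.ι_isOpenImmersion 𝒞.glueData i

theorem exists_chartι_eq (z : 𝒞.scheme) : ∃ (i : 𝒞.J) (y : _), 𝒞.chartι i y = z :=
  𝒞.glueData.ι_jointly_surjective z

/-- In the glued scheme two charts meet exactly in their overlap. Equal composites therefore factor
through the overlap, where transition preserves points of `F`; conversely equal points of `F` give a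
factorization through it. -/
theorem comp_chartι_eq_iff {i j : 𝒞.J} {A : Type u} [CommRing A] (g : 𝒞.R i →+* A)
    (h : 𝒞.R j →+* A) : specMap g ≫ 𝒞.chartι i = specMap h ≫ 𝒞.chartι j ↔
      F.map g (𝒞.pt i) = F.map h (𝒞.pt j) := by
  let e : A →+* Γ(Spec (CommRingCat.of A), ⊤) := globalHom (𝟙 (Spec (CommRingCat.of A)))
  have key : ∀ (l : 𝒞.J) (f : 𝒞.R l →+* A), 𝒞.chartPt l (specMap f) =
      F.map e (F.map f (𝒞.pt l)) := by
    intro l f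
    rw [← F.map_comp, ← globalHom_comp_specMap, Category.id_comp]
    rfl
  constructor
  · intro H
    have hl := 𝒞.glueData.vPullbackConeIsLimit i j
    let l : Spec (CommRingCat.of A) ⟶ Spec (CommRingCat.of (𝒞.overlapRing i j)) :=
      PullbackCone.IsLimit.lift hl (specMap g) (specMap h) H
    have h1 : l ≫ 𝒞.overlapι i j = specMap g := PullbackCone.IsLimit.lift_fst hl _ _ H
    have h2 : l ≫ 𝒞.transition i j ≫ 𝒞.overlapι j i = specMap h :=
      PullbackCone.IsLimit.lift_snd hl _ _ H
    have h3 := 𝒞.chartPt_transition i j l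
    rw [h1, h2, key, key] at h3
    have h4 := congrArg (F.map (Scheme.ΓSpecIso (CommRingCat.of A)).hom.hom) h3
    have h5 : (Scheme.ΓSpecIso (CommRingCat.of A)).hom.hom.comp e = RingHom.id A := by
      have : (Scheme.ΓSpecIso (CommRingCat.of A)).inv ≫ Scheme.Hom.appTop (𝟙 _) ≫
        (Scheme.ΓSpecIso (CommRingCat.of A)).hom = 𝟙 _ := by simp
      exact congrArg CommRingCat.Hom.hom this
    have h6 : ∀ Q : F.obj A,
        F.map (Scheme.ΓSpecIso (CommRingCat.of A)).hom.hom (F.map e Q) = Q := fun Q => by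
      rw [← F.map_comp, h5, F.map_id]
    rw [h6, h6] at h4
    exact h4.symm
  · intro H
    have H' : 𝒞.chartPt i (specMap g) = 𝒞.chartPt j (specMap h) := by rw [key, key, H]
    obtain ⟨l, hl⟩ := 𝒞.exists_overlap_lift i j _ _ H'
    have h3 := 𝒞.chartPt_transition i j l
    rw [hl, H'] at h3
    have h4 := 𝒞.chartPt_injective j h3
    rw [← hl, ← h4]
    simp only [Category.assoc]
    congr 1
    exact (𝒞.glueData.glue_condition i j).symm

theorem exists_local_factor {A : Type u} [CommRing A] (x : Spec (CommRingCat.of A) ⟶ 𝒞.scheme)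
    (p : PrimeSpectrum A) : ∃ f ∉ p.asIdeal, ∃ (i : 𝒞.J) (h : 𝒞.R i →+* Localization.Away f),
      specMap (algebraMap A (Localization.Away f)) ≫ x = specMap h ≫ 𝒞.chartι i := by
  obtain ⟨i, y, hy⟩ := 𝒞.exists_chartι_eq (x p)
  have hp : p ∈ x ⁻¹ᵁ (𝒞.chartι i).opensRange := ⟨y, hy⟩
  obtain ⟨_, ⟨_, ⟨f, rfl⟩, rfl⟩, hpf, hfU⟩ :=
    (PrimeSpectrum.isBasis_basic_opens (R := A)).exists_subset_of_mem_open hp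
      (x ⁻¹ᵁ (𝒞.chartι i).opensRange).isOpen
  refine ⟨f, hpf, i, ?_⟩
  have hr : Set.range (specMap (algebraMap A (Localization.Away f)) ≫ x) ⊆
      Set.range (𝒞.chartι i) := by
    rintro _ ⟨z, rfl⟩
    have : (specMap (algebraMap A (Localization.Away f))) z ∈
        (PrimeSpectrum.basicOpen f : Set (PrimeSpectrum A)) := by
      rw [← PrimeSpectrum.localization_away_comap_range (Localization.Away f) f]
      exact ⟨z, rfl⟩
    exact hfU this
  obtain ⟨h, hh⟩ := exists_eq_specMap (IsOpenImmersion.lift (𝒞.chartι i) _ hr)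
  exact ⟨h, by rw [← hh, IsOpenImmersion.lift_fac]⟩

theorem span_range_eq_top_of_prime {A : Type u} [CommRing A] (f : PrimeSpectrum A → A)
    (hf : ∀ p, f p ∉ p.asIdeal) : Ideal.span (Set.range f) = ⊤ := by
  by_contra h
  obtain ⟨m, hm, hle⟩ := Ideal.exists_le_maximal _ h
  exact hf ⟨m, hm.isPrime⟩ (hle (Ideal.subset_span ⟨_, rfl⟩))

theorem hom_ext_of_span {A : Type u} [CommRing A] {ι : Type u} (f : ι → A)
    (hf : Ideal.span (Set.range f) = ⊤) {Y : Scheme.{u}} {x y : Spec (CommRingCat.of A) ⟶ Y}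
    (h : ∀ i, specMap (algebraMap A (Localization.Away (f i))) ≫ x =
      specMap (algebraMap A (Localization.Away (f i))) ≫ y) : x = y :=
  (Scheme.affineOpenCoverOfSpanRangeEqTop (R := CommRingCat.of A) f hf).openCover.hom_ext _ _
    fun i => h i

/-- The point is glued from the charts through which `x` factors locally. Demanding compatibility
with every factorization over every `B` makes it independent of the chosen cover and makes
naturality in `A` immediate. -/
theorem existsUnique_point {A : Type u} [CommRing A] (x : Spec (CommRingCat.of A) ⟶ 𝒞.scheme) :
    ∃! P : F.obj A, ∀ (B : Type u) [CommRing B] (g : A →+* B) (i : 𝒞.J) (h : 𝒞.R i →+* B),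
      specMap g ≫ x = specMap h ≫ 𝒞.chartι i → F.map g P = F.map h (𝒞.pt i) := by
  choose f hf i h hh using 𝒞.exists_local_factor x
  have hs := span_range_eq_top_of_prime f hf
  obtain ⟨P, hP⟩ := 𝒞.glue A (PrimeSpectrum A) f hs (fun p => F.map (h p) (𝒞.pt (i p))) (by
    intro p q B _ g g' hg
    rw [← F.map_comp, ← F.map_comp, ← comp_chartι_eq_iff, specMap_comp, specMap_comp,
      Category.assoc, Category.assoc, ← hh, ← hh, ← Category.assoc, ← Category.assoc,
      ← specMap_comp, ← specMap_comp, hg])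
  refine ⟨P, ?_, ?_⟩
  · intro B _ g j h' hj
    let φ (p : PrimeSpectrum A) : Localization.Away (f p) →+* Localization.Away (g (f p)) :=
      IsLocalization.Away.map _ _ g (f p)
    have hφ : ∀ p, (φ p).comp (algebraMap A _) = (algebraMap B _).comp g := fun p =>
      IsLocalization.map_comp _
    -- The images `g (f p)` still generate the unit ideal, so the equality over `B` may be tested
    -- after inverting them, where the chosen local factorizations of `x` apply.
    apply 𝒞.separated B (PrimeSpectrum A) (g ∘ f)
    · rw [Set.range_comp, ← Ideal.map_span, hs, Ideal.map_top]
    · intro p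
      change F.map (algebraMap B (Localization.Away (g (f p)))) _ =
        F.map (algebraMap B (Localization.Away (g (f p)))) _
      rw [← F.map_comp, ← hφ, F.map_comp, hP, ← F.map_comp, ← F.map_comp,
        ← comp_chartι_eq_iff, specMap_comp, specMap_comp, Category.assoc, Category.assoc,
        ← hj, ← hh, ← Category.assoc, ← Category.assoc, ← specMap_comp, ← specMap_comp, hφ]
  · intro Q hQ
    refine 𝒞.separated A _ f hs _ _ fun p => ?_
    rw [hP, hQ _ _ _ _ (hh p)]

/-- The point of `F` given by an affine point of the glued scheme. -/
def point {A : Type u} [CommRing A] (x : Spec (CommRingCat.of A) ⟶ 𝒞.scheme) : F.obj A :=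
  (𝒞.existsUnique_point x).choose

theorem map_point_eq {A B : Type u} [CommRing A] [CommRing B]
    (x : Spec (CommRingCat.of A) ⟶ 𝒞.scheme) (g : A →+* B) (i : 𝒞.J) (h : 𝒞.R i →+* B)
    (H : specMap g ≫ x = specMap h ≫ 𝒞.chartι i) :
    F.map g (𝒞.point x) = F.map h (𝒞.pt i) :=
  (𝒞.existsUnique_point x).choose_spec.1 B g i h H

theorem point_comp_chartι {A : Type u} [CommRing A] {i : 𝒞.J} (h : 𝒞.R i →+* A) :
    𝒞.point (specMap h ≫ 𝒞.chartι i) = F.map h (𝒞.pt i) := by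
  have := 𝒞.map_point_eq (specMap h ≫ 𝒞.chartι i) (RingHom.id A) i h (by simp [specMap])
  rwa [F.map_id] at this

theorem point_comp {A B : Type u} [CommRing A] [CommRing B]
    (x : Spec (CommRingCat.of A) ⟶ 𝒞.scheme) (g : A →+* B) :
    𝒞.point (specMap g ≫ x) = F.map g (𝒞.point x) := by
  refine ((𝒞.existsUnique_point (specMap g ≫ x)).choose_spec.2 _ ?_).symm
  intro C _ g' i h H
  rw [← F.map_comp]
  exact 𝒞.map_point_eq x _ i h (by rw [specMap_comp, Category.assoc, H])

theorem point_injective {A : Type u} [CommRing A] {x y : Spec (CommRingCat.of A) ⟶ 𝒞.scheme}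
    (H : 𝒞.point x = 𝒞.point y) : x = y := by
  choose f hf i h hh using 𝒞.exists_local_factor x
  refine hom_ext_of_span f (span_range_eq_top_of_prime f hf) fun p => ?_
  have H' : 𝒞.point (specMap (algebraMap A (Localization.Away (f p))) ≫ x) =
      𝒞.point (specMap (algebraMap A (Localization.Away (f p))) ≫ y) := by
    rw [point_comp, point_comp, H]
  set y' := specMap (algebraMap A (Localization.Away (f p))) ≫ y
  rw [hh, point_comp_chartι] at H'
  rw [hh]
  -- The cover was adapted to `x` only; the restriction of `y` needs a second refinement before it
  -- factors through charts.
  choose f' hf' j h' hh' using 𝒞.exists_local_factor y'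
  refine hom_ext_of_span f' (span_range_eq_top_of_prime f' hf') fun q => ?_
  rw [hh', ← Category.assoc, ← specMap_comp, comp_chartι_eq_iff, F.map_comp, H', ← point_comp,
    hh', point_comp_chartι]

theorem point_surjective {A : Type u} [CommRing A] (P : F.obj A) :
    ∃ x : Spec (CommRingCat.of A) ⟶ 𝒞.scheme, 𝒞.point x = P := by
  choose f hf i h hh using 𝒞.cover A P
  have hs := span_range_eq_top_of_prime f hf
  obtain ⟨x, hx⟩ := exists_glue_of_span f hs (fun p => specMap (h p) ≫ 𝒞.chartι (i p)) (by
      intro p q B _ a b hab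
      rw [← Category.assoc, ← Category.assoc, ← specMap_comp, ← specMap_comp, comp_chartι_eq_iff,
        F.map_comp, F.map_comp, ← hh, ← hh, ← F.map_comp, ← F.map_comp, hab])
  refine ⟨x, 𝒞.separated A _ f hs _ _ fun p => ?_⟩
  rw [hh, ← point_comp, hx, point_comp_chartι]

/-- A natural transformation from `F` to the points of a scheme is given by a morphism. -/
theorem exists_hom {Y : Scheme.{u}}
    (η : ∀ (A : Type u) [CommRing A], F.obj A → (Spec (CommRingCat.of A) ⟶ Y))
    (hη : ∀ (A B : Type u) [CommRing A] [CommRing B] (f : A →+* B) (P : F.obj A),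
      η B (F.map f P) = specMap f ≫ η A P) :
    ∃ q : 𝒞.scheme ⟶ Y, ∀ (A : Type u) [CommRing A] (x : Spec (CommRingCat.of A) ⟶ 𝒞.scheme),
      x ≫ q = η A (𝒞.point x) := by
  obtain ⟨q, hq⟩ := exists_glue_affine 𝒞.R 𝒞.chartι 𝒞.exists_chartι_eq
    (fun i => η (𝒞.R i) (𝒞.pt i)) (by
      intro i j B _ a b hab
      rw [comp_chartι_eq_iff] at hab
      rw [← hη, ← hη, hab])
  refine ⟨q, fun A _ x => ?_⟩
  choose f hf i h hh using 𝒞.exists_local_factor x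
  refine hom_ext_of_span f (span_range_eq_top_of_prime f hf) fun p => ?_
  rw [← Category.assoc, hh, Category.assoc, hq, ← hη, ← hη, ← point_comp, hh, point_comp_chartι]

end ChartCover

end EquiA3

end

noncomputable section

namespace EquiA3

open TensorProduct

/-! ### Extension of scalars of submodules -/

section ExtendSub

variable {A B C : Type u} [CommRing A] [CommRing B] [CommRing C] {n : ℕ}

theorem extendSub_le_iff (f : A →+* B) (N : Submodule A (Fin n → A))
    (M : Submodule B (Fin n → B)) :
    extendSub f N ≤ M ↔ ∀ v ∈ N, (fun i => f (v i)) ∈ M := by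
  simp only [extendSub, Submodule.span_le, Set.image_subset_iff]
  rfl

theorem mem_extendSub (f : A →+* B) {N : Submodule A (Fin n → A)} {v : Fin n → A} (hv : v ∈ N) :
    (fun i => f (v i)) ∈ extendSub f N :=
  Submodule.subset_span ⟨v, hv, rfl⟩

theorem extendSub_mono (f : A →+* B) {N M : Submodule A (Fin n → A)} (h : N ≤ M) :
    extendSub f N ≤ extendSub f M :=
  (extendSub_le_iff _ _ _).2 fun _ hv => mem_extendSub f (h hv)

theorem extendSub_id (N : Submodule A (Fin n → A)) : extendSub (RingHom.id A) N = N :=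
  le_antisymm ((extendSub_le_iff _ _ _).2 fun _ hv => hv) fun _ hv =>
    mem_extendSub (RingHom.id A) hv

theorem smul_comp_mem {f : A →+* B} {M : Submodule B (Fin n → B)} (a : A) {v : Fin n → A}
    (hv : (fun i => f (v i)) ∈ M) : (fun i => f ((a • v) i)) ∈ M := by
  have : (fun i => f ((a • v) i)) = f a • fun i => f (v i) := by ext i; simp
  rw [this]; exact M.smul_mem _ hv

theorem extendSub_span (f : A →+* B) (s : Set (Fin n → A)) :
    extendSub f (Submodule.span A s) = Submodule.span B ((fun v i => f (v i)) '' s) := by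
  apply le_antisymm
  · rw [extendSub_le_iff]
    intro v hv
    induction hv using Submodule.span_induction with
    | mem x h => exact Submodule.subset_span ⟨x, h, rfl⟩
    | zero =>
      have : (fun i => f ((0 : Fin n → A) i)) = 0 := by ext i; simp
      rw [this]; exact Submodule.zero_mem _
    | add x y _ _ hx hy =>
      have : (fun i => f ((x + y) i)) = (fun i => f (x i)) + fun i => f (y i) := by ext i; simp
      rw [this]; exact Submodule.add_mem _ hx hy
    | smul a x _ hx => exact smul_comp_mem a hx
  · exact Submodule.span_mono (Set.image_mono Submodule.subset_span)

theorem extendSub_comp (f : A →+* B) (g : B →+* C) (N : Submodule A (Fin n → A)) :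
    extendSub (g.comp f) N = extendSub g (extendSub f N) := by
  rw [extendSub, extendSub.eq_1 f N, extendSub_span, Set.image_image]
  rfl

theorem range_toLin' {m : ℕ} (M : Matrix (Fin n) (Fin m) A) :
    LinearMap.range (Matrix.toLin' M) = Submodule.span A (Set.range fun j i => M i j) := by
  rw [Matrix.range_toLin']
  rfl

theorem extendSub_range (f : A →+* B) {m : ℕ} (M : Matrix (Fin n) (Fin m) A) :
    extendSub f (LinearMap.range (Matrix.toLin' M)) =
      LinearMap.range (Matrix.toLin' (M.map f)) := by
  rw [range_toLin', range_toLin', extendSub_span, ← Set.range_comp]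
  rfl

theorem exists_pow_smul_mem {s : A} [Algebra A B] [IsLocalization.Away s B]
    {N : Submodule A (Fin n → A)} {w : Fin n → B} (hw : w ∈ extendSub (algebraMap A B) N) :
    ∃ (m : ℕ), ∃ v ∈ N, algebraMap A B s ^ m • w = fun i => algebraMap A B (v i) := by
  induction hw using Submodule.span_induction with
  | mem x h => obtain ⟨v, hv, rfl⟩ := h; exact ⟨0, v, hv, by simp⟩
  | zero => exact ⟨0, 0, N.zero_mem, by ext; simp⟩
  | add x y _ _ hx hy =>
    obtain ⟨a, v, hv, e⟩ := hx
    obtain ⟨b, v', hv', e'⟩ := hy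
    refine ⟨a + b, s ^ b • v + s ^ a • v', N.add_mem (N.smul_mem _ hv) (N.smul_mem _ hv'), ?_⟩
    rw [smul_add, pow_add, mul_smul _ _ y, e', mul_comm, mul_smul, e]
    ext i; simp
  | smul b x _ hx =>
    obtain ⟨a, v, hv, e⟩ := hx
    obtain ⟨c, b', hb⟩ := IsLocalization.Away.surj s b
    refine ⟨c + a, b' • v, N.smul_mem _ hv, ?_⟩
    rw [pow_add, mul_smul, smul_comm _ b, e, smul_smul, mul_comm, hb]
    ext i; simp

/-- Clearing denominators gives an element of `N` that agrees with a multiple of `v` after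
localization; a further power of `s` turns this into an equality over `A`. -/
theorem exists_pow_smul_mem_of_mem {s : A} [Algebra A B] [IsLocalization.Away s B]
    {N : Submodule A (Fin n → A)} {v : Fin n → A}
    (hv : (fun i => algebraMap A B (v i)) ∈ extendSub (algebraMap A B) N) :
    ∃ m : ℕ, s ^ m • v ∈ N := by
  obtain ⟨m, v', hv', e⟩ := exists_pow_smul_mem (s := s) hv
  have h (i : Fin n) : ∃ c : ℕ, s ^ c * (s ^ m * v i) = s ^ c * v' i := by
    have := congrFun e i
    simp only [Pi.smul_apply, smul_eq_mul, ← map_pow, ← map_mul] at this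
    obtain ⟨⟨_, c, rfl⟩, hc⟩ := (IsLocalization.eq_iff_exists (Submonoid.powers s) B).1 this
    exact ⟨c, hc⟩
  choose c hc using h
  -- Each coordinate needs its own exponent `c i`; their sum serves for all coordinates at once.
  refine ⟨(∑ i, c i) + m, ?_⟩
  have : s ^ ((∑ i, c i) + m) • v = s ^ (∑ i, c i) • v' := by
    ext i
    have hi : c i ≤ ∑ i, c i := Finset.single_le_sum (fun _ _ => Nat.zero_le _) (Finset.mem_univ i)
    obtain ⟨d, hd⟩ := Nat.exists_eq_add_of_le hi
    simp only [Pi.smul_apply, smul_eq_mul]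
    rw [pow_add, mul_assoc, hd, add_comm, pow_add, mul_assoc, mul_assoc, hc]
  rw [this]
  exact N.smul_mem _ hv'

theorem le_of_extendSub_le {ι : Type*} (f : ι → A) (hf : Ideal.span (Set.range f) = ⊤)
    {N M : Submodule A (Fin n → A)}
    (h : ∀ i, extendSub (algebraMap A (Localization.Away (f i))) N ≤
      extendSub (algebraMap A (Localization.Away (f i))) M) : N ≤ M := by
  intro v hv
  refine Submodule.mem_of_span_eq_top_of_smul_pow_mem M _ hf v ?_
  rintro ⟨_, i, rfl⟩
  exact exists_pow_smul_mem_of_mem (B := Localization.Away (f i)) (h i (mem_extendSub _ hv))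

/-! ### Base change of locally split submodules -/

section Tensor

variable [Algebra A B] (N : Submodule A (Fin n → A))

/-- The map `B ⊗ N → B ^ n` for a submodule `N` of `A ^ n`. -/
def tensorToPi : B ⊗[A] N →ₗ[B] (Fin n → B) :=
  (TensorProduct.piScalarRight A B B (Fin n)).toLinearMap ∘ₗ N.subtype.baseChange B

theorem tensorToPi_tmul (b : B) (v : N) :
    tensorToPi N (b ⊗ₜ v) = b • fun i => algebraMap A B (v.1 i) := by
  ext i
  simp [tensorToPi, Algebra.smul_def, mul_comm]

theorem range_tensorToPi :
    LinearMap.range (tensorToPi (B := B) N) = extendSub (algebraMap A B) N := by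
  apply le_antisymm
  · rintro _ ⟨x, rfl⟩
    induction x with
    | zero => simp
    | tmul b v => rw [tensorToPi_tmul]; exact Submodule.smul_mem _ _ (mem_extendSub _ v.2)
    | add x y hx hy => rw [map_add]; exact Submodule.add_mem _ hx hy
  · rw [extendSub_le_iff]
    intro v hv
    exact ⟨1 ⊗ₜ ⟨v, hv⟩, by rw [tensorToPi_tmul, one_smul]⟩

/-- Base change of the quotient `A ^ n ⧸ N`. -/
def quotientBaseChange :
    ((Fin n → B) ⧸ extendSub (algebraMap A B) N) ≃ₗ[B] B ⊗[A] ((Fin n → A) ⧸ N) := by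
  let G : (Fin n → B) →ₗ[B] B ⊗[A] ((Fin n → A) ⧸ N) :=
    N.mkQ.baseChange B ∘ₗ (TensorProduct.piScalarRight A B B (Fin n)).symm.toLinearMap
  have hG : Function.Surjective G :=
    (LinearMap.baseChange_surjective B (Submodule.mkQ_surjective _)).comp
      (TensorProduct.piScalarRight A B B (Fin n)).symm.surjective
  -- Right exactness of the tensor product suffices to find the kernel of `G`; no flatness of `B` is
  -- required.
  have hex : Function.Exact (N.subtype.lTensor B) (N.mkQ.lTensor B) :=
    lTensor_exact B (LinearMap.exact_subtype_mkQ N) (Submodule.mkQ_surjective _)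
  have hker : LinearMap.ker G = extendSub (algebraMap A B) N := by
    rw [← range_tensorToPi]
    ext v
    have h1 : v ∈ LinearMap.ker G ↔
        N.mkQ.lTensor B ((TensorProduct.piScalarRight A B B (Fin n)).symm v) = 0 := Iff.rfl
    rw [h1, hex]
    constructor
    · rintro ⟨x, hx⟩
      refine ⟨x, ?_⟩
      have : tensorToPi N x = TensorProduct.piScalarRight A B B (Fin n) (N.subtype.lTensor B x) :=
        rfl
      rw [this, hx, LinearEquiv.apply_symm_apply]
    · rintro ⟨x, rfl⟩
      refine ⟨x, ?_⟩
      have : tensorToPi N x = TensorProduct.piScalarRight A B B (Fin n) (N.subtype.lTensor B x) :=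
        rfl
      rw [this, LinearEquiv.symm_apply_apply]
  exact (Submodule.quotEquivOfEq _ _ hker.symm).trans (G.quotKerEquivOfSurjective hG)

end Tensor

/-- A submodule of `A ^ n` with projective quotient is the image of a projection. -/
theorem exists_projection (N : Submodule A (Fin n → A))
    [Module.Projective A ((Fin n → A) ⧸ N)] :
    ∃ π : (Fin n → A) →ₗ[A] N, π ∘ₗ N.subtype = LinearMap.id := by
  obtain ⟨s, hs⟩ := Module.projective_lifting_property N.mkQ LinearMap.id
    (Submodule.mkQ_surjective N)
  -- For a section `s` of the quotient map, `v - s (v mod N)` is the projection to `N` along the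
  -- image of `s`.
  have h (v : Fin n → A) : v - s (N.mkQ v) ∈ N := by
    refine (Submodule.Quotient.mk_eq_zero N).1 ?_
    have := LinearMap.congr_fun hs (N.mkQ v)
    change N.mkQ (v - s (N.mkQ v)) = 0
    rw [map_sub, sub_eq_zero]
    exact this.symm
  refine ⟨(LinearMap.id - s ∘ₗ N.mkQ).codRestrict N h, ?_⟩
  ext v
  simp [(Submodule.Quotient.mk_eq_zero N).2 v.2]

theorem projective_of_projective_quotient (N : Submodule A (Fin n → A))
    [Module.Projective A ((Fin n → A) ⧸ N)] : Module.Projective A N := by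
  obtain ⟨π, hπ⟩ := exists_projection N
  exact Module.Projective.of_split _ _ hπ

theorem finite_of_projective_quotient (N : Submodule A (Fin n → A))
    [Module.Projective A ((Fin n → A) ⧸ N)] : Module.Finite A N := by
  obtain ⟨π, hπ⟩ := exists_projection N
  exact Module.Finite.of_surjective π fun v => ⟨v, LinearMap.congr_fun hπ v⟩

theorem projective_quotient_extendSub (f : A →+* B) (N : Submodule A (Fin n → A))
    [Module.Projective A ((Fin n → A) ⧸ N)] :
    Module.Projective B ((Fin n → B) ⧸ extendSub f N) := by
  algebraize [f]
  exact Module.Projective.of_equiv (quotientBaseChange (B := B) N).symm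

/-- A split inclusion stays injective after tensoring, so the submodule generated in `B ^ n` is
isomorphic to `B ⊗ N`, whose ranks are known. -/
theorem rankAtStalk_extendSub (f : A →+* B) (N : Submodule A (Fin n → A))
    [Module.Projective A ((Fin n → A) ⧸ N)] (p : PrimeSpectrum B) :
    Module.rankAtStalk (extendSub f N) p = Module.rankAtStalk N (PrimeSpectrum.comap f p) := by
  algebraize [f]
  have := projective_of_projective_quotient N
  have := finite_of_projective_quotient N
  obtain ⟨π, hπ⟩ := exists_projection N
  have hinj : Function.Injective (tensorToPi (B := B) N) := by
    refine (TensorProduct.piScalarRight A B B (Fin n)).injective.comp ?_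
    refine Function.LeftInverse.injective (g := π.baseChange B) fun x => ?_
    rw [← LinearMap.comp_apply, ← LinearMap.baseChange_comp, hπ, LinearMap.baseChange_id]
    rfl
  have e : B ⊗[A] N ≃ₗ[B] extendSub f N :=
    (LinearEquiv.ofInjective _ hinj).trans (LinearEquiv.ofEq _ _ (range_tensorToPi (B := B) N))
  rw [← Module.rankAtStalk_eq_of_equiv e, Module.rankAtStalk_baseChange]
  rfl

end ExtendSub

/-! ### Points of the Grassmannian and rank arguments -/

namespace Gr

variable {A B : Type u} [CommRing A] [CommRing B] {r n : ℕ}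

/-- Base change of a point of the Grassmannian. -/
def map (f : A →+* B) (N : Gr A r n) : Gr B r n where
  sub := extendSub f N.sub
  projective_quotient :=
    have := N.projective_quotient
    projective_quotient_extendSub f N.sub
  rank_eq p := by
    have := N.projective_quotient
    rw [rankAtStalk_extendSub, N.rank_eq]

instance (N : Gr A r n) : Module.Projective A ((Fin n → A) ⧸ N.sub) := N.projective_quotient

instance (N : Gr A r n) : Module.Projective A N.sub := projective_of_projective_quotient N.sub

instance (N : Gr A r n) : Module.Finite A N.sub := finite_of_projective_quotient N.sub

end Gr

/-- A surjection of finitely generated projective modules of the same rank is injective. -/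
theorem injective_of_surjective_of_rankAtStalk_eq {A M N : Type*} [CommRing A] [AddCommGroup M]
    [Module A M] [AddCommGroup N] [Module A N] [Module.Projective A M] [Module.Finite A M]
    [Module.Projective A N] [Module.Finite A N]
    (h : Module.rankAtStalk (R := A) M = Module.rankAtStalk N) (g : M →ₗ[A] N)
    (hg : Function.Surjective g) : Function.Injective g := by
  -- The surjection splits, so `M` is the product of `N` and the kernel; the kernel is then
  -- projective of rank zero, hence zero.
  obtain ⟨s, hs⟩ := Module.projective_lifting_property g LinearMap.id hg
  have hmem (v : M) : v - s (g v) ∈ LinearMap.ker g := by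
    rw [LinearMap.mem_ker, map_sub, sub_eq_zero]
    exact (LinearMap.congr_fun hs (g v)).symm
  let π : M →ₗ[A] LinearMap.ker g := (LinearMap.id - s ∘ₗ g).codRestrict _ hmem
  have hπ : π ∘ₗ (LinearMap.ker g).subtype = LinearMap.id := by
    ext v
    simp [π]
  have : Module.Projective A (LinearMap.ker g) := Module.Projective.of_split _ _ hπ
  have : Module.Finite A (LinearMap.ker g) :=
    Module.Finite.of_surjective π fun v => ⟨v, LinearMap.congr_fun hπ v⟩
  have e : M ≃ₗ[A] LinearMap.ker g × N :=
    LinearEquiv.ofBijective (π.prod g) ⟨by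
      rw [injective_iff_map_eq_zero]
      intro v hv
      have h1 : (π v).1 = 0 := congrArg (fun z => z.1.1) hv
      have h2 : g v = 0 := congrArg (fun z => z.2) hv
      simpa [π, h2] using h1, by
      rintro ⟨x, y⟩
      have hsy : g (s y) = y := LinearMap.congr_fun hs y
      refine ⟨x.1 + s y, Prod.ext (Subtype.ext ?_) ?_⟩
      · simp [π, hsy]
      · simp [hsy]⟩
  have hr := Module.rankAtStalk_eq_of_equiv e
  rw [Module.rankAtStalk_prod, h] at hr
  have h0 : Module.rankAtStalk (R := A) (LinearMap.ker g) = 0 := by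
    simpa using hr
  rw [Module.rankAtStalk_eq_zero_iff_subsingleton] at h0
  rw [← LinearMap.ker_eq_bot]
  exact (Submodule.subsingleton_iff_eq_bot).1 h0

theorem Gr.injOn_of_map_eq_top {A : Type u} [CommRing A] {r n : ℕ} (N : Gr A r n)
    (g : (Fin n → A) →ₗ[A] (Fin r → A)) (hg : N.sub.map g = ⊤) :
    Function.Bijective (g.domRestrict N.sub) := by
  have hsurj : Function.Surjective (g.domRestrict N.sub) := by
    intro y
    obtain ⟨x, hx, rfl⟩ := (hg ▸ Submodule.mem_top : y ∈ N.sub.map g)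
    exact ⟨⟨x, hx⟩, rfl⟩
  refine ⟨injective_of_surjective_of_rankAtStalk_eq ?_ _ hsurj, hsurj⟩
  ext p
  have := p.nontrivial
  rw [N.rank_eq, Module.rankAtStalk_eq_finrank_of_free]
  simp

/-- A summand of rank `r` that maps onto `A ^ r` maps isomorphically, so a submodule of it which
already maps onto `A ^ r` is everything. This identifies the members of a flag over arbitrary rings,
without a dimension count. -/
theorem Gr.eq_of_le_of_map_eq_top {A : Type u} [CommRing A] {r n : ℕ} (N : Gr A r n)
    (g : (Fin n → A) →ₗ[A] (Fin r → A)) {M : Submodule A (Fin n → A)} (hM : M ≤ N.sub)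
    (hg : M.map g = ⊤) : N.sub = M := by
  refine le_antisymm (fun v hv => ?_) hM
  have h1 : N.sub.map g = ⊤ := top_le_iff.1 (hg ▸ Submodule.map_mono hM)
  obtain ⟨w, hw, hwv⟩ := (hg ▸ Submodule.mem_top : g v ∈ M.map g)
  have := (N.injOn_of_map_eq_top g h1).1 (a₁ := ⟨v, hv⟩) (a₂ := ⟨w, hM hw⟩) hwv.symm
  rw [show v = w from congrArg Subtype.val this]
  exact hw

/-! ### Gluing of submodules -/

section Glue

variable {A : Type u} [CommRing A] {n : ℕ} {ι : Type u} (f : ι → A)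
  (hf : Ideal.span (Set.range f) = ⊤)
include hf

/-- The glued submodule consists of the vectors over `A` whose images lie in each local submodule.
Compatibility on overlaps lets denominators be cleared, which shows that it is large enough. -/
theorem exists_glue_sub (N : (i : ι) → Submodule (Localization.Away (f i))
      (Fin n → Localization.Away (f i)))
    (hfin : ∀ i, (N i).FG)
    (hN : ∀ (i j : ι) (B : Type u) [CommRing B] (g : Localization.Away (f i) →+* B)
      (h : Localization.Away (f j) →+* B),
      g.comp (algebraMap A _) = h.comp (algebraMap A _) →
        extendSub g (N i) = extendSub h (N j)) :
    ∃ M : Submodule A (Fin n → A), M.FG ∧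
      ∀ i, extendSub (algebraMap A (Localization.Away (f i))) M = N i := by
  classical
  -- Finiteness matters twice: a single exponent must serve for all members of the cover, and
  -- finitely many local generating sets must be united.
  obtain ⟨t, ht⟩ : ∃ t : Finset ι, Ideal.span (f '' t) = ⊤ := by
    obtain ⟨s, hs, hs'⟩ := (Ideal.span_eq_top_iff_finite _).1 hf
    obtain ⟨t, -, ht⟩ := Finset.subset_set_image_iff.1
      (show (s : Set A) ⊆ f '' Set.univ by simpa using hs)
    exact ⟨t, by rw [← hs', ← ht]; simp⟩
  -- The two local submodules agree after inverting both `f i` and `f j`; undoing the localization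
  -- at `f i` costs a power of `f i`.
  have transfer (i j : ι) (v : Fin n → A)
      (hv : (fun l => algebraMap A (Localization.Away (f i)) (v l)) ∈ N i) :
      ∃ m : ℕ, (fun l => algebraMap A (Localization.Away (f j)) ((f i ^ m • v) l)) ∈ N j := by
    let s := algebraMap A (Localization.Away (f j)) (f i)
    let h : Localization.Away (f j) →+* Localization.Away s := algebraMap _ _
    have hu : IsUnit ((h.comp (algebraMap A _)) (f i)) := IsLocalization.Away.algebraMap_isUnit s
    let g : Localization.Away (f i) →+* Localization.Away s := IsLocalization.Away.lift (f i) hu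
    have hg : g.comp (algebraMap A _) = h.comp (algebraMap A _) :=
      IsLocalization.Away.lift_comp (f i) hu
    have h1 := mem_extendSub g hv
    rw [hN i j _ g h hg] at h1
    have h2 : (fun l => g (algebraMap A _ (v l))) =
        fun l => h (algebraMap A (Localization.Away (f j)) (v l)) :=
      funext fun l => RingHom.congr_fun hg (v l)
    rw [h2] at h1
    obtain ⟨m, hm⟩ := exists_pow_smul_mem_of_mem (s := s) h1
    refine ⟨m, ?_⟩
    convert hm using 1
    ext l
    simp [s]
  let M : Submodule A (Fin n → A) :=
    { carrier := {v | ∀ j ∈ t, (fun l => algebraMap A (Localization.Away (f j)) (v l)) ∈ N j}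
      add_mem' := fun {v w} hv hw j hj => by
        have := (N j).add_mem (hv j hj) (hw j hj)
        convert this using 1
        ext l; simp
      zero_mem' := fun j hj => by
        convert (N j).zero_mem using 1
        ext l; simp
      smul_mem' := fun a v hv j hj => smul_comp_mem a (hv j hj) }
  have hM (i : ι) : extendSub (algebraMap A (Localization.Away (f i))) M = N i := by
    apply le_antisymm
    · rw [extendSub_le_iff]
      intro v hv
      have hsp : Ideal.span (algebraMap A (Localization.Away (f i)) '' (f '' t)) = ⊤ := by
        rw [← Ideal.map_span, ht, Ideal.map_top]
      refine Submodule.mem_of_span_eq_top_of_smul_pow_mem _ _ hsp _ ?_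
      rintro ⟨_, _, ⟨j, hj, rfl⟩, rfl⟩
      obtain ⟨m, hm⟩ := transfer j i v (hv j hj)
      refine ⟨m, ?_⟩
      convert hm using 1
      ext l
      simp
    · intro w hw
      obtain ⟨⟨_, a, rfl⟩, ha⟩ :=
        IsLocalization.exist_integer_multiples_of_finite (Submonoid.powers (f i)) w
      choose v hv using ha
      have hvN : (fun l => algebraMap A (Localization.Away (f i)) (v l)) ∈ N i := by
        have : (fun l => algebraMap A (Localization.Away (f i)) (v l)) =
            algebraMap A (Localization.Away (f i)) (f i ^ a) • w := by
          ext l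
          rw [hv]
          simp [Algebra.smul_def]
        rw [this]
        exact (N i).smul_mem _ hw
      choose m hm using fun j => transfer i j v hvN
      have hmem : f i ^ (∑ j ∈ t, m j) • v ∈ M := by
        intro j hj
        obtain ⟨d, hd⟩ := Nat.exists_eq_add_of_le
          (Finset.single_le_sum (f := m) (fun _ _ => Nat.zero_le _) hj)
        rw [hd, add_comm, pow_add, mul_smul]
        exact smul_comp_mem _ (hm j)
      have hw' : w = (IsLocalization.Away.invSelf (S := Localization.Away (f i)) (f i)) ^
          ((∑ j ∈ t, m j) + a) • fun l => algebraMap A (Localization.Away (f i))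
            ((f i ^ (∑ j ∈ t, m j) • v) l) := by
        ext l
        have h1 := hv l
        have h2 : algebraMap A (Localization.Away (f i)) (f i) *
          IsLocalization.Away.invSelf (S := Localization.Away (f i)) (f i) = 1 :=
          IsLocalization.Away.mul_invSelf (f i)
        simp only [Pi.smul_apply, smul_eq_mul, map_mul, h1, Algebra.smul_def, map_pow]
        rw [← mul_assoc, ← mul_assoc, mul_assoc (_ ^ _) (_ ^ _) (_ ^ _), ← pow_add, ← mul_pow,
          mul_comm (IsLocalization.Away.invSelf _), h2, one_pow, one_mul]
      rw [hw']
      exact Submodule.smul_mem _ _ (mem_extendSub _ hmem)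
  refine ⟨M, ?_, hM⟩
  -- Finitely many local generators can be chosen among the images of elements of `M`; their union
  -- over `t` spans `M` after each localization, hence globally.
  have hfg (i : ι) : ∃ S : Finset (Fin n → A), (S : Set (Fin n → A)) ⊆ M ∧
      extendSub (algebraMap A (Localization.Away (f i))) (Submodule.span A S) = N i := by
    have h1 := hfin i
    rw [← hM i] at h1
    obtain ⟨s', hs', e⟩ := (Submodule.fg_span_iff_fg_span_finset_subset _).1 h1
    obtain ⟨S, hS, rfl⟩ := Finset.subset_set_image_iff.1 hs'
    refine ⟨S, hS, ?_⟩
    rw [extendSub_span, ← hM i, extendSub, e]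
    simp
  choose S hS hS' using hfg
  refine ⟨t.biUnion S, le_antisymm ?_ ?_⟩
  · rw [Submodule.span_le]
    intro v hv
    obtain ⟨i, -, hi⟩ := Finset.mem_biUnion.1 hv
    exact hS i hi
  · refine le_of_extendSub_le (fun i : t => f i) (by rw [← ht]; congr 1; ext; simp) fun i => ?_
    rw [hM, ← hS' i]
    exact extendSub_mono _ (Submodule.span_mono fun v hv =>
      Finset.mem_coe.2 (Finset.mem_biUnion.2 ⟨i, i.2, hv⟩))

/-- Since the glued submodule is finitely generated, its quotient is finitely presented.
Projectivity can then be checked through the free locus on the cover, and the rank at a prime is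
read off in a localization containing it. -/
theorem Gr.exists_glue {r : ℕ} (N : (i : ι) → Gr (Localization.Away (f i)) r n)
    (hN : ∀ (i j : ι) (B : Type u) [CommRing B] (g : Localization.Away (f i) →+* B)
      (h : Localization.Away (f j) →+* B),
      g.comp (algebraMap A _) = h.comp (algebraMap A _) →
        extendSub g (N i).sub = extendSub h (N j).sub) :
    ∃ M : Gr A r n, ∀ i, extendSub (algebraMap A (Localization.Away (f i))) M.sub = (N i).sub := by
  obtain ⟨M, hfg, hM⟩ := exists_glue_sub f hf (fun i => (N i).sub)
    (fun i => Module.Finite.iff_fg.1 inferInstance) hN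
  have hcov (p : PrimeSpectrum A) : ∃ i, p ∈ PrimeSpectrum.basicOpen (f i) :=
    exists_notMem_of_span_eq_top f hf p
  have hfp : Module.FinitePresentation A ((Fin n → A) ⧸ M) :=
    Module.finitePresentation_of_free_of_surjective M.mkQ (Submodule.mkQ_surjective M)
      (by rwa [Submodule.ker_mkQ])
  have hproj : Module.Projective A ((Fin n → A) ⧸ M) := by
    rw [← Module.freeLocus_eq_univ_iff, Set.eq_univ_iff_forall]
    intro p
    obtain ⟨i, hi⟩ := hcov p
    refine (Module.basicOpen_subset_freeLocus_iff (f := f i)).2 ?_ hi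
    have h1 : Module.Projective (Localization.Away (f i)) ((Fin n → Localization.Away (f i)) ⧸
        extendSub (algebraMap A (Localization.Away (f i))) M) := by
      rw [hM]; infer_instance
    exact Module.Projective.of_equiv ((quotientBaseChange M).trans
      (LocalizedModule.equivTensorProduct (Submonoid.powers (f i)) ((Fin n → A) ⧸ M)).symm)
  refine ⟨⟨M, hproj, fun p => ?_⟩, hM⟩
  obtain ⟨i, hi⟩ := hcov p
  have : p ∈ Set.range (PrimeSpectrum.comap (algebraMap A (Localization.Away (f i)))) := by
    rw [PrimeSpectrum.localization_away_comap_range (Localization.Away (f i)) (f i)]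
    exact hi
  obtain ⟨q, rfl⟩ := this
  rw [← rankAtStalk_extendSub, hM, (N i).rank_eq]

end Glue

end EquiA3

end

noncomputable section

namespace EquiA3

/-! ### Submodules mapping onto a free module -/

/-- The matrix `G` maps the submodule `N` onto the whole module. -/
def Onto {A : Type u} [CommRing A] {r n : ℕ} (G : Matrix (Fin r) (Fin n) A)
    (N : Submodule A (Fin n → A)) : Prop :=
  N.map (Matrix.toLin' G) = ⊤

section Onto

variable {A B : Type u} [CommRing A] [CommRing B] {r n : ℕ}

theorem toLin'_map_comp (f : A →+* B) (G : Matrix (Fin r) (Fin n) A) (v : Fin n → A) :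
    Matrix.toLin' (G.map f) (fun i => f (v i)) = fun i => f (Matrix.toLin' G v i) := by
  ext i
  simp [Matrix.mulVec, dotProduct]

theorem map_extendSub (f : A →+* B) (G : Matrix (Fin r) (Fin n) A)
    (N : Submodule A (Fin n → A)) :
    (extendSub f N).map (Matrix.toLin' (G.map f)) = extendSub f (N.map (Matrix.toLin' G)) := by
  rw [extendSub, extendSub, Submodule.map_span, Set.image_image, Submodule.map_coe,
    Set.image_image]
  congr 1
  apply Set.image_congr
  intro v _
  exact toLin'_map_comp f G v

theorem Onto.mono {G : Matrix (Fin r) (Fin n) A} {N M : Submodule A (Fin n → A)} (h : Onto G N)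
    (hNM : N ≤ M) : Onto G M :=
  top_le_iff.1 (h ▸ Submodule.map_mono hNM)

theorem det_map_ringHom (f : A →+* B) (M : Matrix (Fin r) (Fin r) A) :
    (M.map f).det = f M.det :=
  (RingHom.map_det f M).symm

theorem range_eq_top_iff_isUnit_det (M : Matrix (Fin r) (Fin r) A) :
    LinearMap.range (Matrix.toLin' M) = ⊤ ↔ IsUnit M.det := by
  rw [← Matrix.isUnit_iff_isUnit_det, LinearMap.range_eq_top]
  exact Matrix.mulVec_surjective_iff_isUnit

theorem onto_range_iff (G : Matrix (Fin r) (Fin n) A) (S : Matrix (Fin n) (Fin r) A) :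
    Onto G (LinearMap.range (Matrix.toLin' S)) ↔ IsUnit (G * S).det := by
  rw [Onto, ← LinearMap.range_comp, ← Matrix.toLin'_mul, range_eq_top_iff_isUnit_det]

/-- Surjectivity at a prime ideal spreads out to a neighbourhood. -/
theorem exists_forall_onto (G : Matrix (Fin r) (Fin n) A) (N : Submodule A (Fin n → A))
    (p : PrimeSpectrum A)
    (h : Onto (G.map (algebraMap A p.asIdeal.ResidueField))
      (extendSub (algebraMap A p.asIdeal.ResidueField) N)) :
    ∃ f ∉ p.asIdeal, ∀ (B : Type u) [CommRing B] (g : A →+* B), IsUnit (g f) →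
      Onto (G.map g) (extendSub g N) := by
  set K := p.asIdeal.ResidueField
  let w : N → (Fin r → K) := fun v i => algebraMap A K (Matrix.toLin' G v.1 i)
  have hw : Submodule.span K (Set.range w) = ⊤ := by
    rw [Onto, map_extendSub] at h
    rw [← h, extendSub]
    congr 1
    ext y
    constructor
    · rintro ⟨v, rfl⟩; exact ⟨_, ⟨v.1, v.2, rfl⟩, rfl⟩
    · rintro ⟨_, ⟨v, hv, rfl⟩, rfl⟩; exact ⟨⟨v, hv⟩, rfl⟩
  -- The images of elements of `N` span `K ^ r`, so `r` of them form a basis. Their lifts are the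
  -- columns of `S`, and the determinant of `G * S` is the function that must be inverted.
  obtain ⟨κ, a, -, hspan, hli⟩ := exists_linearIndependent' K w
  have hb : ⊤ ≤ Submodule.span K (Set.range (w ∘ a)) := by rw [hspan, hw]
  let b := Module.Basis.mk hli hb
  have : Fintype κ := FiniteDimensional.fintypeBasisIndex b
  have hcard : Fintype.card κ = Fintype.card (Fin r) := by
    rw [← Module.finrank_eq_card_basis b]; simp
  let ε : Fin r ≃ κ := (Fintype.equivOfCardEq hcard).symm
  let S : Matrix (Fin n) (Fin r) A := Matrix.of fun i j => (a (ε j)).1 i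
  have hS (j : Fin r) : (fun i => S i j) ∈ N := (a (ε j)).2
  have hSN : LinearMap.range (Matrix.toLin' S) ≤ N := by
    rw [range_toLin', Submodule.span_le]
    rintro _ ⟨j, rfl⟩
    exact hS j
  have hdet : IsUnit ((G * S).map (algebraMap A K)).det := by
    rw [← range_eq_top_iff_isUnit_det, range_toLin', ← hw, ← hspan]
    congr 1
    rw [← ε.surjective.range_comp (w ∘ a)]
    rfl
  refine ⟨(G * S).det, ?_, ?_⟩
  · intro hmem
    have h0 : algebraMap A K (G * S).det = 0 := by
      rwa [Ideal.algebraMap_residueField_eq_zero]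
    rw [det_map_ringHom] at hdet
    exact hdet.ne_zero h0
  · intro B _ g hg
    refine Onto.mono ?_ (extendSub_mono g hSN)
    rw [extendSub_range, onto_range_iff, ← Matrix.map_mul, det_map_ringHom]
    exact hg

end Onto

/-! ### Coordinate projections and graphs -/

section Graph

variable (A : Type u) [CommRing A] {r b n : ℕ} (σ : Fin r ⊕ Fin b ≃ Fin n)

/-- The projection to the first block of coordinates. -/
def projM : Matrix (Fin r) (Fin n) A := (1 : Matrix (Fin n) (Fin n) A).submatrix (σ ∘ Sum.inl) id

/-- The projection to the second block of coordinates. -/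
def coprojM : Matrix (Fin b) (Fin n) A := (1 : Matrix (Fin n) (Fin n) A).submatrix (σ ∘ Sum.inr) id

/-- The inclusion of the first block of coordinates. -/
def inclM : Matrix (Fin n) (Fin r) A := (1 : Matrix (Fin n) (Fin n) A).submatrix id (σ ∘ Sum.inl)

/-- The inclusion of the second block of coordinates. -/
def coinclM : Matrix (Fin n) (Fin b) A := (1 : Matrix (Fin n) (Fin n) A).submatrix id (σ ∘ Sum.inr)

theorem projM_mul_inclM : projM A σ * inclM A σ = 1 := by
  ext i j
  simp [projM, inclM, Matrix.mul_apply, Matrix.one_apply]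

theorem projM_mul_coinclM : projM A σ * coinclM A σ = 0 := by
  ext i j
  simp [projM, coinclM, Matrix.mul_apply, Matrix.one_apply]

theorem coprojM_mul_inclM : coprojM A σ * inclM A σ = 0 := by
  ext i j
  simp [coprojM, inclM, Matrix.mul_apply, Matrix.one_apply]

theorem coprojM_mul_coinclM : coprojM A σ * coinclM A σ = 1 := by
  ext i j
  simp [coprojM, coinclM, Matrix.mul_apply, Matrix.one_apply]

theorem incl_mul_proj_add : inclM A σ * projM A σ + coinclM A σ * coprojM A σ = 1 := by
  ext i j
  obtain ⟨x, rfl⟩ := σ.surjective i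
  rcases x with x | x
  all_goals
    simp only [projM, inclM, coprojM, coinclM, Matrix.add_apply, Matrix.mul_apply,
      Matrix.submatrix_apply, Matrix.one_apply, Function.comp_apply, id_eq,
      EmbeddingLike.apply_eq_iff_eq, reduceCtorEq, Sum.inl.injEq, Sum.inr.injEq, if_false, zero_mul,
      Finset.sum_const_zero, add_zero, zero_add]
    rw [Finset.sum_eq_single x (fun y _ hy => by simp [Ne.symm hy]) (by simp)]
    simp

variable {A}

theorem projM_map {B : Type u} [CommRing B] (f : A →+* B) : (projM A σ).map f = projM B σ := by
  rw [projM, ← Matrix.submatrix_map, Matrix.map_one _ f.map_zero f.map_one]; rfl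

theorem coprojM_map {B : Type u} [CommRing B] (f : A →+* B) :
    (coprojM A σ).map f = coprojM B σ := by
  rw [coprojM, ← Matrix.submatrix_map, Matrix.map_one _ f.map_zero f.map_one]; rfl

theorem inclM_map {B : Type u} [CommRing B] (f : A →+* B) : (inclM A σ).map f = inclM B σ := by
  rw [inclM, ← Matrix.submatrix_map, Matrix.map_one _ f.map_zero f.map_one]; rfl

theorem coinclM_map {B : Type u} [CommRing B] (f : A →+* B) :
    (coinclM A σ).map f = coinclM B σ := by
  rw [coinclM, ← Matrix.submatrix_map, Matrix.map_one _ f.map_zero f.map_one]; rfl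

/-- The matrix with columns spanning the graph of `X`. -/
def graphM (X : Matrix (Fin b) (Fin r) A) : Matrix (Fin n) (Fin r) A :=
  inclM A σ + coinclM A σ * X

theorem projM_mul_graphM (X : Matrix (Fin b) (Fin r) A) : projM A σ * graphM σ X = 1 := by
  rw [graphM, Matrix.mul_add, ← Matrix.mul_assoc, projM_mul_inclM, projM_mul_coinclM,
    Matrix.zero_mul, add_zero]

theorem coprojM_mul_graphM (X : Matrix (Fin b) (Fin r) A) : coprojM A σ * graphM σ X = X := by
  rw [graphM, Matrix.mul_add, ← Matrix.mul_assoc, coprojM_mul_inclM, coprojM_mul_coinclM,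
    Matrix.one_mul, zero_add]

theorem graphM_map {B : Type u} [CommRing B] (f : A →+* B) (X : Matrix (Fin b) (Fin r) A) :
    (graphM σ X).map f = graphM σ (X.map f) := by
  rw [graphM, graphM, Matrix.map_add _ (map_add f), Matrix.map_mul, inclM_map, coinclM_map]

theorem eq_graphM_of_projM_mul_eq_one {S : Matrix (Fin n) (Fin r) A} (h : projM A σ * S = 1) :
    S = graphM σ (coprojM A σ * S) := by
  rw [graphM, ← Matrix.mul_assoc]
  conv_lhs => rw [← Matrix.one_mul S, ← incl_mul_proj_add A σ, Matrix.add_mul, Matrix.mul_assoc, h,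
    Matrix.mul_one]

end Graph

/-! ### Matrices with a left inverse as points of the Grassmannian -/

section Sections

variable {A : Type u} [CommRing A] {r n m : ℕ}

theorem exists_eq_mul_of_range_le {S : Matrix (Fin n) (Fin r) A} {M : Matrix (Fin n) (Fin m) A}
    (h : LinearMap.range (Matrix.toLin' M) ≤ LinearMap.range (Matrix.toLin' S)) :
    ∃ Y : Matrix (Fin r) (Fin m) A, M = S * Y := by
  have h1 (j : Fin m) : ∃ y : Fin r → A, Matrix.toLin' S y = fun i => M i j := by
    have : (fun i => M i j) ∈ LinearMap.range (Matrix.toLin' M) := by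
      rw [range_toLin']; exact Submodule.subset_span ⟨j, rfl⟩
    exact h this
  choose y hy using h1
  refine ⟨Matrix.of fun i j => y j i, ?_⟩
  ext i j
  rw [Matrix.mul_apply]
  exact (congrFun (hy j) i).symm

/-- A matrix with a left inverse has the same range as another one exactly if they are equal,
once the left inverse is shared. -/
theorem eq_of_range_le {S S' : Matrix (Fin n) (Fin r) A} {L : Matrix (Fin r) (Fin n) A}
    (h : L * S = 1) (h' : L * S' = 1)
    (hr : LinearMap.range (Matrix.toLin' S) ≤ LinearMap.range (Matrix.toLin' S')) : S = S' := by
  obtain ⟨Y, rfl⟩ := exists_eq_mul_of_range_le hr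
  rw [← Matrix.mul_assoc, h', Matrix.one_mul] at h
  rw [h, Matrix.mul_one]

theorem range_mul_le (S : Matrix (Fin n) (Fin r) A) (Y : Matrix (Fin r) (Fin m) A) :
    LinearMap.range (Matrix.toLin' (S * Y)) ≤ LinearMap.range (Matrix.toLin' S) := by
  rw [Matrix.toLin'_mul]
  exact LinearMap.range_comp_le_range _ _

/-- The range of a matrix with a left inverse is a point of the Grassmannian. -/
def Gr.ofLeftInverse (S : Matrix (Fin n) (Fin r) A) (L : Matrix (Fin r) (Fin n) A)
    (h : L * S = 1) : Gr A r n where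
  sub := LinearMap.range (Matrix.toLin' S)
  projective_quotient := by
    -- The idempotent `1 - S * L` kills the range of `S` and so descends to a section of the
    -- quotient map.
    let E : (Fin n → A) →ₗ[A] (Fin n → A) := LinearMap.id - Matrix.toLin' (S * L)
    have hE : LinearMap.range (Matrix.toLin' S) ≤ LinearMap.ker E := by
      rintro _ ⟨v, rfl⟩
      simp only [E, LinearMap.mem_ker, LinearMap.sub_apply, LinearMap.id_apply, sub_eq_zero]
      rw [← LinearMap.comp_apply, ← Matrix.toLin'_mul, Matrix.mul_assoc, h, Matrix.mul_one]
    refine Module.Projective.of_split (Submodule.liftQ _ E hE) (Submodule.mkQ _) ?_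
    ext1
    refine LinearMap.ext fun v => ?_
    refine (Submodule.Quotient.eq _).2 ?_
    refine ⟨-(Matrix.toLin' L v), ?_⟩
    simp [E, Matrix.mulVec_neg]
  rank_eq p := by
    have hinj : Function.Injective (Matrix.toLin' S) :=
      Function.LeftInverse.injective (g := Matrix.toLin' L) fun v => by
        rw [← LinearMap.comp_apply, ← Matrix.toLin'_mul, h, Matrix.toLin'_one, LinearMap.id_apply]
    have := p.nontrivial
    rw [← Module.rankAtStalk_eq_of_equiv (LinearEquiv.ofInjective _ hinj),
      Module.rankAtStalk_eq_finrank_of_free]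
    simp

/-- A point of the Grassmannian that is mapped onto `A ^ r` is the range of a section. -/
theorem Gr.exists_section (N : Gr A r n) {L : Matrix (Fin r) (Fin n) A} (h : Onto L N.sub) :
    ∃ S : Matrix (Fin n) (Fin r) A, L * S = 1 ∧ N.sub = LinearMap.range (Matrix.toLin' S) := by
  have hb (j : Fin r) : ∃ v ∈ N.sub, Matrix.toLin' L v = Pi.single j 1 := by
    exact (h ▸ Submodule.mem_top : Pi.single j 1 ∈ N.sub.map (Matrix.toLin' L))
  choose v hv hvj using hb
  have hLS : L * (Matrix.of fun i j => v j i) = 1 := by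
    ext i j
    rw [Matrix.mul_apply, Matrix.one_apply]
    have := congrFun (hvj j) i
    rw [Pi.single_apply] at this
    exact this
  refine ⟨Matrix.of fun i j => v j i, hLS, ?_⟩
  refine N.eq_of_le_of_map_eq_top (Matrix.toLin' L) ?_ ?_
  · rw [range_toLin', Submodule.span_le]
    rintro _ ⟨j, rfl⟩
    exact hv j
  · rw [← LinearMap.range_comp, ← Matrix.toLin'_mul, hLS, Matrix.toLin'_one, LinearMap.range_id]

end Sections

/-! ### Coordinate charts over a field -/

section Field

variable {K : Type u} [Field K]

theorem Gr.finrank_sub {r n : ℕ} (N : Gr K r n) : Module.finrank K N.sub = r := by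
  have := N.rank_eq ⊥
  rwa [Module.rankAtStalk_eq_finrank_of_free] at this

/-- The coordinate functionals separate the vectors of `W`; a maximal independent subfamily of their
restrictions is a basis of the dual of `W` and gives `r` coordinates on `W`. The remaining indices
form the second block. -/
theorem exists_onto_projM {r m l : ℕ} (hl : l = r + m) (W : Submodule K (Fin l → K))
    (hW : Module.finrank K W = r) : ∃ ρ : Fin r ⊕ Fin m ≃ Fin l, Onto (projM K ρ) W := by
  let w : Fin l → Module.Dual K W := fun i => LinearMap.proj i ∘ₗ W.subtype
  obtain ⟨κ, a, ha, hspan, hli⟩ := exists_linearIndependent' K w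
  have hsep (x : W) (hx : ∀ j, w (a j) x = 0) : x = 0 := by
    have h1 : Submodule.span K (Set.range w) ≤ LinearMap.ker (Module.Dual.eval K W x) := by
      rw [← hspan, Submodule.span_le]
      rintro _ ⟨j, rfl⟩
      exact hx j
    ext i
    exact h1 (Submodule.subset_span ⟨i, rfl⟩)
  have : Finite κ := Finite.of_injective a ha
  have := Fintype.ofFinite κ
  have hcard : Fintype.card κ = r := by
    apply le_antisymm
    · have := hli.fintype_card_le_finrank
      rwa [Subspace.dual_finrank_eq, hW] at this
    · let g : W →ₗ[K] (κ → K) := LinearMap.pi fun j => w (a j)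
      have hg : Function.Injective g := by
        rw [injective_iff_map_eq_zero]
        exact fun x hx => hsep x fun j => congrFun hx j
      have := LinearMap.finrank_le_finrank_of_injective hg
      simpa [hW] using this
  let ε : Fin r ≃ κ := Fintype.equivOfCardEq (by simp [hcard]) |>.symm.symm
  have hinj : Function.Injective (a ∘ ε) := ha.comp ε.injective
  classical
  have hcompl : Fintype.card (Fin m) = Fintype.card ((Set.range (a ∘ ε))ᶜ : Set (Fin l)) := by
    rw [Fintype.card_compl_set, Set.card_range_of_injective hinj]
    simp [hl]
  let ρ : Fin r ⊕ Fin m ≃ Fin l :=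
    (Equiv.sumCongr (Equiv.ofInjective _ hinj) (Fintype.equivOfCardEq hcompl)).trans
      (Equiv.Set.sumCompl _)
  have hρ (i : Fin r) : ρ (Sum.inl i) = a (ε i) := by
    simp [ρ]
  refine ⟨ρ, ?_⟩
  have hproj (x : Fin l → K) (i : Fin r) : Matrix.toLin' (projM K ρ) x i = x (a (ε i)) := by
    simp [projM, Matrix.mulVec, dotProduct, Matrix.one_apply, hρ]
  have hgi : Function.Injective ((Matrix.toLin' (projM K ρ)).domRestrict W) := by
    rw [injective_iff_map_eq_zero]
    intro x hx
    refine hsep x fun j => ?_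
    have := congrFun hx (ε.symm j)
    rw [LinearMap.domRestrict_apply, hproj] at this
    rw [Equiv.apply_symm_apply] at this
    exact this
  have hgs := (LinearMap.injective_iff_surjective_of_finrank_eq_finrank
    (by rw [hW]; simp)).1 hgi
  rw [Onto, eq_top_iff]
  intro y _
  obtain ⟨x, hx⟩ := hgs y
  exact ⟨x.1, x.2, hx⟩

/-- Coordinates on the larger member of a flag embed the smaller one, so the choice of coordinates
can be repeated on the image of the smaller member. -/
theorem Onto.finrank_map {r n : ℕ} {W W' : Submodule K (Fin n → K)} {G : Matrix (Fin r) (Fin n) K}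
    (h : Onto G W) (hW : Module.finrank K W = r) (hle : W' ≤ W) :
    Module.finrank K (W'.map (Matrix.toLin' G)) = Module.finrank K W' := by
  have hs : Function.Surjective ((Matrix.toLin' G).domRestrict W) := by
    intro y
    obtain ⟨x, hx, rfl⟩ := (h ▸ Submodule.mem_top : y ∈ W.map (Matrix.toLin' G))
    exact ⟨⟨x, hx⟩, rfl⟩
  have hi := (LinearMap.injective_iff_surjective_of_finrank_eq_finrank (by rw [hW]; simp)).2 hs
  have hi' : Function.Injective ((Matrix.toLin' G).domRestrict W') := by
    intro x y hxy
    have := @hi ⟨x.1, hle x.2⟩ ⟨y.1, hle y.2⟩ hxy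
    exact Subtype.ext (congrArg (fun z => z.1) this)
  have := LinearMap.finrank_range_of_inj hi'
  rwa [LinearMap.range_domRestrict] at this

end Field

end EquiA3

end

noncomputable section

namespace EquiA3

/-! ### The functor of incidence points -/

section Functor

variable {d₁ d₂ d₃ r₁ r₂ c : ℕ}

namespace IncidencePoint

theorem ext_of_eq {A : Type u} [CommRing A] {P Q : IncidencePoint A d₁ d₂ d₃ r₁ r₂ c}
    (hα : P.V.α = Q.V.α) (hβ : P.V.β = Q.V.β) (h₁ : P.F.R₁.sub = Q.F.R₁.sub)
    (h₂ : P.F.R₂.sub = Q.F.R₂.sub) (h : P.R.sub = Q.R.sub) : P = Q :=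
  IncidencePoint.ext (RepSpace.ext hα hβ) (Flag.ext (Gr.ext h₁) (Gr.ext h₂)) (Gr.ext h)

/-- Base change of an incidence point. -/
def map {A B : Type u} [CommRing A] [CommRing B] (f : A →+* B)
    (P : IncidencePoint A d₁ d₂ d₃ r₁ r₂ c) : IncidencePoint B d₁ d₂ d₃ r₁ r₂ c where
  V := ⟨P.V.α.map f, P.V.β.map f⟩
  F := ⟨P.F.R₁.map f, P.F.R₂.map f, extendSub_mono f P.F.le⟩
  R := P.R.map f
  range_le := by
    rw [← extendSub_range]
    exact extendSub_mono f P.range_le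
  map_le := by
    have := extendSub_mono f P.map_le
    rw [← map_extendSub] at this
    exact this

theorem map_id {A : Type u} [CommRing A] (P : IncidencePoint A d₁ d₂ d₃ r₁ r₂ c) :
    P.map (RingHom.id A) = P :=
  ext_of_eq (by ext; rfl) (by ext; rfl) (extendSub_id _) (extendSub_id _) (extendSub_id _)

theorem map_comp {A B C : Type u} [CommRing A] [CommRing B] [CommRing C] (f : A →+* B)
    (g : B →+* C) (P : IncidencePoint A d₁ d₂ d₃ r₁ r₂ c) :
    P.map (g.comp f) = (P.map f).map g :=
  ext_of_eq (by ext; rfl) (by ext; rfl) (extendSub_comp _ _ _) (extendSub_comp _ _ _)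
    (extendSub_comp _ _ _)

end IncidencePoint

/-- The functor of incidence points over `k`. -/
def incidenceFunctor (k : Type u) [Field k] (d₁ d₂ d₃ r₁ r₂ c : ℕ) : PointFunctor.{u} where
  obj A := (k →+* A) × IncidencePoint A d₁ d₂ d₃ r₁ r₂ c
  map f P := (f.comp P.1, P.2.map f)
  map_id _ _ P := Prod.ext (RingHom.id_comp _) P.2.map_id
  map_comp f g P := Prod.ext (RingHom.comp_assoc _ _ _).symm (P.2.map_comp f g)

end Functor

/-! ### Charts of the incidence variety -/

/-- Index set of the coordinates on a chart. -/
abbrev ChartCoord (d₁ d₃ r₁ m r₂ b c e : ℕ) : Type :=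
  (Fin b × Fin r₂) ⊕ (Fin m × Fin r₁) ⊕ (Fin e × Fin c) ⊕ (Fin r₁ × Fin d₁) ⊕
    (Fin c × Fin r₂) ⊕ (Fin d₃ × Fin b)

/-- Index set of the charts: the choices of coordinate complements. -/
structure ChartIndex (d₂ d₃ r₁ m r₂ b c e : ℕ) where
  σ : Fin r₂ ⊕ Fin b ≃ Fin d₂
  ρ : Fin r₁ ⊕ Fin m ≃ Fin r₂
  τ : Fin c ⊕ Fin e ≃ Fin d₃

instance (d₂ d₃ r₁ m r₂ b c e : ℕ) : Finite (ChartIndex d₂ d₃ r₁ m r₂ b c e) :=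
  Finite.of_injective (β := (Fin r₂ ⊕ Fin b ≃ Fin d₂) × (Fin r₁ ⊕ Fin m ≃ Fin r₂) ×
    (Fin c ⊕ Fin e ≃ Fin d₃)) (fun w => (w.σ, w.ρ, w.τ)) (by
      rintro ⟨_, _, _⟩ ⟨_, _, _⟩ h
      simpa using h)

namespace ChartIndex

variable {d₁ d₂ d₃ r₁ m r₂ b c e : ℕ} (w : ChartIndex d₂ d₃ r₁ m r₂ b c e)
variable {A B : Type u} [CommRing A] [CommRing B]

/-- The columns spanning `R₂`. -/
def frame₂ (x : ChartCoord d₁ d₃ r₁ m r₂ b c e → A) : Matrix (Fin d₂) (Fin r₂) A :=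
  graphM w.σ (Matrix.of fun i j => x (.inl (i, j)))

/-- The columns spanning `R₁`. -/
def frame₁ (x : ChartCoord d₁ d₃ r₁ m r₂ b c e → A) : Matrix (Fin d₂) (Fin r₁) A :=
  w.frame₂ x * graphM w.ρ (Matrix.of fun i j => x (.inr (.inl (i, j))))

/-- The columns spanning `R`. -/
def frame₃ (x : ChartCoord d₁ d₃ r₁ m r₂ b c e → A) : Matrix (Fin d₃) (Fin c) A :=
  graphM w.τ (Matrix.of fun i j => x (.inr (.inr (.inl (i, j)))))

variable (A) in
/-- The coordinate projection on `R₁`. -/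
def proj₁ : Matrix (Fin r₁) (Fin d₂) A := projM A w.ρ * projM A w.σ

theorem proj₁_map (f : A →+* B) : (w.proj₁ A).map f = w.proj₁ B := by
  rw [proj₁, Matrix.map_mul, projM_map, projM_map, proj₁]

theorem projM_mul_frame₂ (x : ChartCoord d₁ d₃ r₁ m r₂ b c e → A) :
    projM A w.σ * w.frame₂ x = 1 := projM_mul_graphM _ _

theorem proj₁_mul_frame₁ (x : ChartCoord d₁ d₃ r₁ m r₂ b c e → A) :
    w.proj₁ A * w.frame₁ x = 1 := by
  rw [proj₁, frame₁, Matrix.mul_assoc, ← Matrix.mul_assoc (projM A w.σ), projM_mul_frame₂,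
    Matrix.one_mul, projM_mul_graphM]

theorem projM_mul_frame₃ (x : ChartCoord d₁ d₃ r₁ m r₂ b c e → A) :
    projM A w.τ * w.frame₃ x = 1 := projM_mul_graphM _ _

/-- The matrix of `α` on a chart. -/
def matα (x : ChartCoord d₁ d₃ r₁ m r₂ b c e → A) : Matrix (Fin d₂) (Fin d₁) A :=
  w.frame₁ x * Matrix.of fun i j => x (.inr (.inr (.inr (.inl (i, j)))))

/-- The matrix of `β` on a chart. -/
def matβ (x : ChartCoord d₁ d₃ r₁ m r₂ b c e → A) : Matrix (Fin d₃) (Fin d₂) A :=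
  w.frame₃ x * (Matrix.of fun i j => x (.inr (.inr (.inr (.inr (.inl (i, j))))))) * projM A w.σ +
    (Matrix.of fun i j => x (.inr (.inr (.inr (.inr (.inr (i, j))))))) * coprojM A w.σ *
      (1 - w.frame₂ x * projM A w.σ)

theorem one_sub_mul_frame₂ (x : ChartCoord d₁ d₃ r₁ m r₂ b c e → A) :
    (1 - w.frame₂ x * projM A w.σ) * w.frame₂ x = 0 := by
  rw [Matrix.sub_mul, Matrix.mul_assoc, projM_mul_frame₂, Matrix.one_mul, Matrix.mul_one, sub_self]

/-- The matrix `1 - frame₂ * projM` is a projection with kernel $R_2$, so the last term of `matβ` is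
invisible on $R_2$. There $\beta$ is the `Fin c × Fin r₂` block, written in the frame of $R$. -/
theorem matβ_mul_frame₂ (x : ChartCoord d₁ d₃ r₁ m r₂ b c e → A) :
    w.matβ x * w.frame₂ x = w.frame₃ x *
      (Matrix.of fun i j => x (.inr (.inr (.inr (.inr (.inl (i, j))))))) := by
  rw [matβ, Matrix.add_mul, Matrix.mul_assoc _ (projM A w.σ), projM_mul_frame₂, Matrix.mul_one,
    Matrix.mul_assoc _ (1 - _), one_sub_mul_frame₂, Matrix.mul_zero, add_zero]

/-- The incidence point with given coordinates on a chart. -/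
def incidencePoint (x : ChartCoord d₁ d₃ r₁ m r₂ b c e → A) :
    IncidencePoint A d₁ d₂ d₃ r₁ r₂ c where
  V := ⟨w.matα x, w.matβ x⟩
  F := ⟨Gr.ofLeftInverse _ _ (w.proj₁_mul_frame₁ x), Gr.ofLeftInverse _ _ (w.projM_mul_frame₂ x),
    range_mul_le _ _⟩
  R := Gr.ofLeftInverse _ _ (w.projM_mul_frame₃ x)
  range_le := range_mul_le _ _
  map_le := by
    change Submodule.map _ (LinearMap.range _) ≤ LinearMap.range _
    rw [← LinearMap.range_comp, ← Matrix.toLin'_mul]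
    change LinearMap.range (Matrix.toLin' (w.matβ x * w.frame₂ x)) ≤ _
    rw [matβ_mul_frame₂]
    exact range_mul_le _ _

theorem frame₂_map (f : A →+* B) (x : ChartCoord d₁ d₃ r₁ m r₂ b c e → A) :
    (w.frame₂ x).map f = w.frame₂ (f ∘ x) := graphM_map _ _ _

theorem frame₁_map (f : A →+* B) (x : ChartCoord d₁ d₃ r₁ m r₂ b c e → A) :
    (w.frame₁ x).map f = w.frame₁ (f ∘ x) := by
  rw [frame₁, Matrix.map_mul, frame₂_map, graphM_map]; rfl

theorem frame₃_map (f : A →+* B) (x : ChartCoord d₁ d₃ r₁ m r₂ b c e → A) :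
    (w.frame₃ x).map f = w.frame₃ (f ∘ x) := graphM_map _ _ _

theorem incidencePoint_map (f : A →+* B) (x : ChartCoord d₁ d₃ r₁ m r₂ b c e → A) :
    (w.incidencePoint x).map f = w.incidencePoint (f ∘ x) := by
  apply IncidencePoint.ext_of_eq
  · change (w.matα x).map f = w.matα (f ∘ x)
    rw [matα, Matrix.map_mul, frame₁_map]; rfl
  · change (w.matβ x).map f = w.matβ (f ∘ x)
    rw [matβ, Matrix.map_add _ (map_add f), Matrix.map_mul, Matrix.map_mul, Matrix.map_mul,
      Matrix.map_mul, Matrix.map_sub _ (map_sub f), Matrix.map_mul, frame₂_map, frame₃_map,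
      projM_map, coprojM_map, Matrix.map_one _ f.map_zero f.map_one]; rfl
  · exact (extendSub_range f _).trans (by rw [frame₁_map]; rfl)
  · exact (extendSub_range f _).trans (by rw [frame₂_map]; rfl)
  · exact (extendSub_range f _).trans (by rw [frame₃_map]; rfl)

/-- Each frame has a left inverse depending only on the chart, so it is determined by its range. The
six blocks are then recovered by multiplying with left inverses of the frames, coordinate
projections and the inclusion of the complement. -/
theorem incidencePoint_injective {x y : ChartCoord d₁ d₃ r₁ m r₂ b c e → A}
    (h : w.incidencePoint x = w.incidencePoint y) : x = y := by
  have h₁ : LinearMap.range (Matrix.toLin' (w.frame₁ x)) =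
      LinearMap.range (Matrix.toLin' (w.frame₁ y)) := congrArg (fun P => P.F.R₁.sub) h
  have h₂ : LinearMap.range (Matrix.toLin' (w.frame₂ x)) =
      LinearMap.range (Matrix.toLin' (w.frame₂ y)) := congrArg (fun P => P.F.R₂.sub) h
  have h₃ : LinearMap.range (Matrix.toLin' (w.frame₃ x)) =
      LinearMap.range (Matrix.toLin' (w.frame₃ y)) := congrArg (fun P => P.R.sub) h
  have hα : w.matα x = w.matα y := congrArg (fun P => P.V.α) h
  have hβ : w.matβ x = w.matβ y := congrArg (fun P => P.V.β) h
  have e₁ := eq_of_range_le (w.proj₁_mul_frame₁ x) (w.proj₁_mul_frame₁ y) h₁.le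
  have e₂ := eq_of_range_le (w.projM_mul_frame₂ x) (w.projM_mul_frame₂ y) h₂.le
  have e₃ := eq_of_range_le (w.projM_mul_frame₃ x) (w.projM_mul_frame₃ y) h₃.le
  have c₂ := congrArg (coprojM A w.σ * ·) e₂
  have c₁ := congrArg (fun M => coprojM A w.ρ * (projM A w.σ * M)) e₁
  have c₃ := congrArg (coprojM A w.τ * ·) e₃
  have cα := congrArg (w.proj₁ A * ·) hα
  have cγ := congrArg (fun M => projM A w.τ * (M * w.frame₂ x)) hβ
  have cδ := congrArg (· * coinclM A w.σ) hβ
  simp only [frame₂, frame₃, coprojM_mul_graphM] at c₂ c₃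
  simp only [frame₁] at c₁
  rw [← Matrix.mul_assoc (projM A w.σ), projM_mul_frame₂, Matrix.one_mul,
    ← Matrix.mul_assoc (projM A w.σ), projM_mul_frame₂, Matrix.one_mul, coprojM_mul_graphM,
    coprojM_mul_graphM] at c₁
  simp only [matα] at cα
  rw [← Matrix.mul_assoc, proj₁_mul_frame₁, Matrix.one_mul, ← Matrix.mul_assoc, proj₁_mul_frame₁,
    Matrix.one_mul] at cα
  beta_reduce at cγ
  rw [matβ_mul_frame₂, ← Matrix.mul_assoc, projM_mul_frame₃, Matrix.one_mul, e₂, matβ_mul_frame₂,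
    ← Matrix.mul_assoc, projM_mul_frame₃, Matrix.one_mul] at cγ
  have hδ (z : ChartCoord d₁ d₃ r₁ m r₂ b c e → A) : w.matβ z * coinclM A w.σ =
      Matrix.of fun i j => z (.inr (.inr (.inr (.inr (.inr (i, j)))))) := by
    rw [matβ, Matrix.add_mul, Matrix.mul_assoc _ (projM A w.σ), projM_mul_coinclM, Matrix.mul_zero,
      zero_add, Matrix.mul_assoc _ (1 - _), Matrix.sub_mul, Matrix.mul_assoc _ (projM A w.σ),
      projM_mul_coinclM, Matrix.mul_zero, sub_zero, Matrix.one_mul, Matrix.mul_assoc,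
      coprojM_mul_coinclM, Matrix.mul_one]
  simp only [hδ] at cδ
  funext t
  rcases t with ⟨i, j⟩ | ⟨i, j⟩ | ⟨i, j⟩ | ⟨i, j⟩ | ⟨i, j⟩ | ⟨i, j⟩
  · exact congrFun (congrFun c₂ i) j
  · exact congrFun (congrFun c₁ i) j
  · exact congrFun (congrFun c₃ i) j
  · exact congrFun (congrFun cα i) j
  · exact congrFun (congrFun cγ i) j
  · exact congrFun (congrFun cδ i) j

/-- An incidence point lies on a chart if the chosen coordinates restrict to coordinates on
its three members. -/
theorem exists_incidencePoint_eq (P : IncidencePoint A d₁ d₂ d₃ r₁ r₂ c)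
    (h₁ : Onto (w.proj₁ A) P.F.R₁.sub) (h₂ : Onto (projM A w.σ) P.F.R₂.sub)
    (h₃ : Onto (projM A w.τ) P.R.sub) :
    ∃ x : ChartCoord d₁ d₃ r₁ m r₂ b c e → A, w.incidencePoint x = P := by
  obtain ⟨S₁, e₁, g₁⟩ := P.F.R₁.exists_section h₁
  obtain ⟨S₂, e₂, g₂⟩ := P.F.R₂.exists_section h₂
  obtain ⟨S₃, e₃, g₃⟩ := P.R.exists_section h₃
  have hle := P.F.le
  rw [g₁, g₂] at hle
  -- `Y` describes $R_1$ in the frame of $R_2$; `Z` and `T` below describe $\alpha$ in the frame of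
  -- $R_1$, and $\beta$ from the frame of $R_2$ to that of $R$.
  obtain ⟨Y, hY⟩ := exists_eq_mul_of_range_le hle
  have hY1 : projM A w.ρ * Y = 1 := by
    rw [hY, proj₁, Matrix.mul_assoc, ← Matrix.mul_assoc (projM A w.σ), e₂, Matrix.one_mul] at e₁
    exact e₁
  have hα := P.range_le
  rw [g₁] at hα
  obtain ⟨Z, hZ⟩ := exists_eq_mul_of_range_le hα
  have hβ := P.map_le
  rw [g₂, g₃, ← LinearMap.range_comp, ← Matrix.toLin'_mul] at hβ
  obtain ⟨T, hT⟩ := exists_eq_mul_of_range_le hβ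
  -- The blocks in order: the graph of $R_2$, the graph of $R_1$ inside $R_2$, the graph of $R$, the
  -- map $\alpha$ into $R_1$, the map $\beta$ from $R_2$ to $R$, and $\beta$ on the coordinate
  -- complement of $R_2$.
  let x : ChartCoord d₁ d₃ r₁ m r₂ b c e → A :=
    Sum.elim (fun p => (coprojM A w.σ * S₂) p.1 p.2) <|
    Sum.elim (fun p => (coprojM A w.ρ * Y) p.1 p.2) <|
    Sum.elim (fun p => (coprojM A w.τ * S₃) p.1 p.2) <|
    Sum.elim (fun p => Z p.1 p.2) <| Sum.elim (fun p => T p.1 p.2)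
      (fun p => (P.V.β * coinclM A w.σ) p.1 p.2)
  have f₂ : w.frame₂ x = S₂ := (eq_graphM_of_projM_mul_eq_one w.σ e₂).symm
  have f₁ : w.frame₁ x = S₁ := by
    rw [hY, frame₁, f₂]
    congr 1
    exact (eq_graphM_of_projM_mul_eq_one w.ρ hY1).symm
  have f₃ : w.frame₃ x = S₃ := (eq_graphM_of_projM_mul_eq_one w.τ e₃).symm
  refine ⟨x, IncidencePoint.ext_of_eq ?_ ?_ ?_ ?_ ?_⟩
  · change w.frame₁ x * Z = P.V.α
    rw [f₁, hZ]
  · change w.frame₃ x * T * projM A w.σ + P.V.β * coinclM A w.σ * coprojM A w.σ *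
      (1 - w.frame₂ x * projM A w.σ) = P.V.β
    -- The range of `1 - S₂ * projM` has zero coordinates in the first block, so projecting to the
    -- second block changes nothing.
    have h1 : coinclM A w.σ * coprojM A w.σ * (1 - S₂ * projM A w.σ) =
        1 - S₂ * projM A w.σ := by
      have h2 : coinclM A w.σ * coprojM A w.σ = 1 - inclM A w.σ * projM A w.σ :=
        eq_sub_of_add_eq' (incl_mul_proj_add A w.σ)
      rw [h2, Matrix.sub_mul, Matrix.one_mul, Matrix.mul_sub, Matrix.mul_one,
        Matrix.mul_assoc _ (projM A w.σ), ← Matrix.mul_assoc (projM A w.σ), e₂, Matrix.one_mul,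
        sub_self, sub_zero]
    rw [f₂, f₃, ← hT, Matrix.mul_assoc P.V.β S₂, Matrix.mul_assoc P.V.β,
      Matrix.mul_assoc P.V.β, h1, Matrix.mul_sub,
      Matrix.mul_one, add_sub_cancel]
  · change LinearMap.range (Matrix.toLin' (w.frame₁ x)) = _
    rw [f₁, g₁]
  · change LinearMap.range (Matrix.toLin' (w.frame₂ x)) = _
    rw [f₂, g₂]
  · change LinearMap.range (Matrix.toLin' (w.frame₃ x)) = _
    rw [f₃, g₃]

/-- The function on the chart `w` whose nonvanishing locus is the overlap with the chart `w'`. -/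
def overlapDet (w' : ChartIndex d₂ d₃ r₁ m r₂ b c e)
    (x : ChartCoord d₁ d₃ r₁ m r₂ b c e → A) : A :=
  (w'.proj₁ A * w.frame₁ x).det * ((projM A w'.σ * w.frame₂ x).det *
    (projM A w'.τ * w.frame₃ x).det)

theorem overlapDet_map (w' : ChartIndex d₂ d₃ r₁ m r₂ b c e) (f : A →+* B)
    (x : ChartCoord d₁ d₃ r₁ m r₂ b c e → A) :
    f (w.overlapDet w' x) = w.overlapDet w' (f ∘ x) := by
  rw [overlapDet, map_mul, map_mul, ← det_map_ringHom, ← det_map_ringHom, ← det_map_ringHom,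
    Matrix.map_mul, Matrix.map_mul, Matrix.map_mul, frame₁_map, frame₂_map, frame₃_map,
    proj₁_map, projM_map, projM_map, overlapDet]

/-- The three determinants are those of the coordinate projections of `w'` on the members described
by `w`. Their product is a unit exactly when all three projections are onto, which is the criterion
for lying on the chart `w'`. -/
theorem exists_eq_incidencePoint_iff (w' : ChartIndex d₂ d₃ r₁ m r₂ b c e)
    (x : ChartCoord d₁ d₃ r₁ m r₂ b c e → A) :
    (∃ y : ChartCoord d₁ d₃ r₁ m r₂ b c e → A, w'.incidencePoint y = w.incidencePoint x) ↔
      IsUnit (w.overlapDet w' x) := by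
  rw [overlapDet, IsUnit.mul_iff, IsUnit.mul_iff, ← onto_range_iff, ← onto_range_iff,
    ← onto_range_iff]
  constructor
  · rintro ⟨y, hy⟩
    have h₁ : LinearMap.range (Matrix.toLin' (w'.frame₁ y)) =
      LinearMap.range (Matrix.toLin' (w.frame₁ x)) := congrArg (fun P => P.F.R₁.sub) hy
    have h₂ : LinearMap.range (Matrix.toLin' (w'.frame₂ y)) =
      LinearMap.range (Matrix.toLin' (w.frame₂ x)) := congrArg (fun P => P.F.R₂.sub) hy
    have h₃ : LinearMap.range (Matrix.toLin' (w'.frame₃ y)) =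
      LinearMap.range (Matrix.toLin' (w.frame₃ x)) := congrArg (fun P => P.R.sub) hy
    rw [← h₁, ← h₂, ← h₃, onto_range_iff, onto_range_iff, onto_range_iff, proj₁_mul_frame₁,
      projM_mul_frame₂, projM_mul_frame₃]
    simp
  · rintro ⟨h₁, h₂, h₃⟩
    exact w'.exists_incidencePoint_eq _ h₁ h₂ h₃

end ChartIndex

/-- Every incidence point lies locally on a chart. -/
theorem exists_chartIndex {d₁ d₂ d₃ r₁ m r₂ b c e : ℕ} (hd₂ : d₂ = r₂ + b) (hr₂ : r₂ = r₁ + m)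
    (hd₃ : d₃ = c + e) {A : Type u} [CommRing A] (P : IncidencePoint A d₁ d₂ d₃ r₁ r₂ c)
    (p : PrimeSpectrum A) :
    ∃ f ∉ p.asIdeal, ∃ w : ChartIndex d₂ d₃ r₁ m r₂ b c e, ∀ (B : Type u) [CommRing B]
      (g : A →+* B), IsUnit (g f) →
        ∃ x : ChartCoord d₁ d₃ r₁ m r₂ b c e → B, w.incidencePoint x = P.map g := by
  let K := p.asIdeal.ResidueField
  let φ : A →+* K := algebraMap A K
  let PK := P.map φ
  obtain ⟨σ, hσ⟩ := exists_onto_projM hd₂ _ PK.F.R₂.finrank_sub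
  obtain ⟨τ, hτ⟩ := exists_onto_projM hd₃ _ PK.R.finrank_sub
  -- The coordinates `σ` embed $R_2$, so the image of $R_1$ still has dimension `r₁`, and `ρ` is
  -- chosen for this image.
  have h1 := hσ.finrank_map PK.F.R₂.finrank_sub PK.F.le
  rw [PK.F.R₁.finrank_sub] at h1
  obtain ⟨ρ, hρ⟩ := exists_onto_projM hr₂ _ h1
  let w : ChartIndex d₂ d₃ r₁ m r₂ b c e := ⟨σ, ρ, τ⟩
  have hρ' : Onto (w.proj₁ K) PK.F.R₁.sub := by
    rw [Onto, ← Submodule.map_comp, ← Matrix.toLin'_mul] at hρ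
    exact hρ
  obtain ⟨f₁, hf₁, H₁⟩ := exists_forall_onto (w.proj₁ A) P.F.R₁.sub p
    (by rw [w.proj₁_map]; exact hρ')
  obtain ⟨f₂, hf₂, H₂⟩ := exists_forall_onto (projM A σ) P.F.R₂.sub p
    (by rw [projM_map]; exact hσ)
  obtain ⟨f₃, hf₃, H₃⟩ := exists_forall_onto (projM A τ) P.R.sub p
    (by rw [projM_map]; exact hτ)
  refine ⟨f₁ * (f₂ * f₃), ?_, w, ?_⟩
  · intro hmem
    rcases p.2.mem_or_mem hmem with h | h
    · exact hf₁ h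
    · exact (p.2.mem_or_mem h).elim hf₂ hf₃
  · intro B _ g hg
    rw [map_mul, map_mul, IsUnit.mul_iff, IsUnit.mul_iff] at hg
    refine w.exists_incidencePoint_eq _ ?_ ?_ ?_
    · have := H₁ B g hg.1
      rwa [w.proj₁_map] at this
    · have := H₂ B g hg.2.1
      rwa [projM_map] at this
    · have := H₃ B g hg.2.2
      rwa [projM_map] at this

theorem ringHom_ext_of_span {A B : Type u} [CommRing A] [CommRing B] {ι : Type u} (f : ι → A)
    (hf : Ideal.span (Set.range f) = ⊤) {g h : B →+* A}
    (H : ∀ i, (algebraMap A (Localization.Away (f i))).comp g =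
      (algebraMap A (Localization.Away (f i))).comp h) : g = h := by
  apply specMap_injective
  refine ChartCover.hom_ext_of_span f hf fun i => ?_
  rw [← specMap_comp, ← specMap_comp, H]

/-- The ring homomorphism from the coordinate ring of `Rep(Q, d)` given by a pair of matrices. -/
def RepSpace.evalHom {k A : Type u} [Field k] [CommRing A] {d₁ d₂ d₃ : ℕ} (κ : k →+* A)
    (W : RepSpace A d₁ d₂ d₃) : MvPolynomial (Coord d₁ d₂ d₃) k →+* A :=
  MvPolynomial.eval₂Hom κ W.coords

theorem RepSpace.comp_evalHom {k A B : Type u} [Field k] [CommRing A] [CommRing B]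
    {d₁ d₂ d₃ : ℕ} (κ : k →+* A) (W : RepSpace A d₁ d₂ d₃) (f : A →+* B) :
    f.comp (W.evalHom κ) =
      RepSpace.evalHom (f.comp κ) ⟨W.α.map f, W.β.map f⟩ := by
  apply MvPolynomial.ringHom_ext
  · intro a
    simp [RepSpace.evalHom]
  · rintro (t | t) <;> simp [RepSpace.evalHom, RepSpace.coords]

theorem RepSpace.evalHom_injective {k A : Type u} [Field k] [CommRing A] {d₁ d₂ d₃ : ℕ}
    {κ κ' : k →+* A} {W W' : RepSpace A d₁ d₂ d₃} (h : W.evalHom κ = W'.evalHom κ') :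
    κ = κ' ∧ W = W' := by
  refine ⟨?_, RepSpace.ext ?_ ?_⟩
  · ext a
    simpa [RepSpace.evalHom] using RingHom.congr_fun h (MvPolynomial.C a)
  · ext i j
    simpa [RepSpace.evalHom, RepSpace.coords] using
      RingHom.congr_fun h (MvPolynomial.X (Sum.inl (i, j)))
  · ext i j
    simpa [RepSpace.evalHom, RepSpace.coords] using
      RingHom.congr_fun h (MvPolynomial.X (Sum.inr (i, j)))

theorem RepSpace.exists_evalHom_eq {k A : Type u} [Field k] [CommRing A] {d₁ d₂ d₃ : ℕ}
    (θ : MvPolynomial (Coord d₁ d₂ d₃) k →+* A) :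
    ∃ (κ : k →+* A) (W : RepSpace A d₁ d₂ d₃), W.evalHom κ = θ := by
  refine ⟨θ.comp MvPolynomial.C, ⟨Matrix.of fun i j => θ (MvPolynomial.X (Sum.inl (i, j))),
    Matrix.of fun i j => θ (MvPolynomial.X (Sum.inr (i, j)))⟩, ?_⟩
  apply MvPolynomial.ringHom_ext
  · intro a
    simp [RepSpace.evalHom]
  · rintro (t | t) <;> simp [RepSpace.evalHom, RepSpace.coords]

/-! ### Zariski descent for incidence points -/

section Sheaf

variable {k : Type u} [Field k] {d₁ d₂ d₃ r₁ r₂ c : ℕ}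

/-- The structure homomorphism and the two matrices amount to one homomorphism from a polynomial
ring, so equality of all of them is checked locally in one go; submodules are compared by clearing
denominators. -/
theorem incidenceFunctor_separated {A : Type u} [CommRing A] {ι : Type u} (f : ι → A)
    (hf : Ideal.span (Set.range f) = ⊤) (P Q : (incidenceFunctor k d₁ d₂ d₃ r₁ r₂ c).obj A)
    (H : ∀ i, (incidenceFunctor k d₁ d₂ d₃ r₁ r₂ c).map
        (algebraMap A (Localization.Away (f i))) P =
      (incidenceFunctor k d₁ d₂ d₃ r₁ r₂ c).map (algebraMap A (Localization.Away (f i))) Q) :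
    P = Q := by
  have h0 : P.2.V.evalHom P.1 = Q.2.V.evalHom Q.1 := by
    refine ringHom_ext_of_span f hf fun i => ?_
    rw [RepSpace.comp_evalHom, RepSpace.comp_evalHom]
    have h1 := congrArg (fun z => z.1) (H i)
    have h2 := congrArg (fun z => z.2.V) (H i)
    change _ = _ at h1
    change (⟨_, _⟩ : RepSpace _ _ _ _) = ⟨_, _⟩ at h2
    change (algebraMap A (Localization.Away (f i))).comp P.1 =
      (algebraMap A (Localization.Away (f i))).comp Q.1 at h1
    rw [h1, h2]
  have hs {n : ℕ} {N M : Submodule A (Fin n → A)}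
      (h : ∀ i, extendSub (algebraMap A (Localization.Away (f i))) N =
        extendSub (algebraMap A (Localization.Away (f i))) M) : N = M :=
    le_antisymm (le_of_extendSub_le f hf fun i => (h i).le)
      (le_of_extendSub_le f hf fun i => (h i).ge)
  obtain ⟨h1, h2⟩ := RepSpace.evalHom_injective h0
  refine Prod.ext h1 (IncidencePoint.ext_of_eq (congrArg (fun z => z.α) h2)
    (congrArg (fun z => z.β) h2) (hs fun i => ?_) (hs fun i => ?_) (hs fun i => ?_))
  · exact congrArg (fun z => z.2.F.R₁.sub) (H i)
  · exact congrArg (fun z => z.2.F.R₂.sub) (H i)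
  · exact congrArg (fun z => z.2.R.sub) (H i)

/-- The matrices and the structure homomorphism are glued as one morphism to an affine scheme, the
three submodules separately. The incidence conditions are inclusions of submodules, hence local. -/
theorem incidenceFunctor_glue {A : Type u} [CommRing A] {ι : Type u} (f : ι → A)
    (hf : Ideal.span (Set.range f) = ⊤)
    (P : (i : ι) → (incidenceFunctor k d₁ d₂ d₃ r₁ r₂ c).obj (Localization.Away (f i)))
    (H : ∀ (i j : ι) (B : Type u) [CommRing B] (g : Localization.Away (f i) →+* B)
      (h : Localization.Away (f j) →+* B),
      g.comp (algebraMap A _) = h.comp (algebraMap A _) →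
        (incidenceFunctor k d₁ d₂ d₃ r₁ r₂ c).map g (P i) =
          (incidenceFunctor k d₁ d₂ d₃ r₁ r₂ c).map h (P j)) :
    ∃ Q : (incidenceFunctor k d₁ d₂ d₃ r₁ r₂ c).obj A, ∀ i,
      (incidenceFunctor k d₁ d₂ d₃ r₁ r₂ c).map (algebraMap A (Localization.Away (f i))) Q =
        P i := by
  obtain ⟨R₁, h₁⟩ := Gr.exists_glue f hf (fun i => (P i).2.F.R₁)
    fun i j B _ g h e => congrArg (fun z => z.2.F.R₁.sub) (H i j B g h e)
  obtain ⟨R₂, h₂⟩ := Gr.exists_glue f hf (fun i => (P i).2.F.R₂)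
    fun i j B _ g h e => congrArg (fun z => z.2.F.R₂.sub) (H i j B g h e)
  obtain ⟨R, h₃⟩ := Gr.exists_glue f hf (fun i => (P i).2.R)
    fun i j B _ g h e => congrArg (fun z => z.2.R.sub) (H i j B g h e)
  obtain ⟨y, hy⟩ := exists_glue_of_span f hf
    (fun i => specMap ((P i).2.V.evalHom (P i).1)) (by
      intro i j B _ g h e
      rw [← specMap_comp, ← specMap_comp, RepSpace.comp_evalHom, RepSpace.comp_evalHom]
      have h1 := congrArg (fun z => z.1) (H i j B g h e)
      have h2 := congrArg (fun z => z.2.V) (H i j B g h e)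
      change g.comp (P i).1 = h.comp (P j).1 at h1
      change (⟨_, _⟩ : RepSpace _ _ _ _) = ⟨_, _⟩ at h2
      rw [h1, h2])
  obtain ⟨θ, rfl⟩ := exists_eq_specMap y
  obtain ⟨κ, W, rfl⟩ := RepSpace.exists_evalHom_eq θ
  have hW (i : ι) := by
    have := hy i
    rw [← specMap_comp, RepSpace.comp_evalHom] at this
    exact RepSpace.evalHom_injective (specMap_injective this)
  have hle : R₁.sub ≤ R₂.sub := le_of_extendSub_le f hf fun i => by
    rw [h₁, h₂]; exact (P i).2.F.le
  have hα : LinearMap.range (Matrix.toLin' W.α) ≤ R₁.sub := le_of_extendSub_le f hf fun i => by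
    rw [h₁, extendSub_range, show W.α.map _ = (P i).2.V.α from congrArg (fun z => z.α) (hW i).2]
    exact (P i).2.range_le
  have hβ : R₂.sub.map (Matrix.toLin' W.β) ≤ R.sub := le_of_extendSub_le f hf fun i => by
    rw [h₃, ← map_extendSub, h₂,
      show W.β.map _ = (P i).2.V.β from congrArg (fun z => z.β) (hW i).2]
    exact (P i).2.map_le
  refine ⟨(κ, ⟨W, ⟨R₁, R₂, hle⟩, R, hα, hβ⟩), fun i => Prod.ext (hW i).1 ?_⟩
  exact IncidencePoint.ext_of_eq (congrArg (fun z => z.α) (hW i).2)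
    (congrArg (fun z => z.β) (hW i).2) (h₁ i) (h₂ i) (h₃ i)

end Sheaf

theorem eval₂Hom_comp_X {k A I : Type*} [CommRing k] [CommRing A] (κ : k →+* A) (x : I → A) :
    MvPolynomial.eval₂Hom κ x ∘ MvPolynomial.X = x := by
  ext i
  simp

theorem eval₂Hom_comp_C' {k A I : Type*} [CommRing k] [CommRing A] (κ : k →+* A) (x : I → A) :
    (MvPolynomial.eval₂Hom κ x).comp MvPolynomial.C = κ := by
  ext i
  simp

/-- The covering of the functor of incidence points by charts. -/
def incidenceCover (k : Type u) [Field k] (d₁ : ℕ) {d₂ d₃ r₁ m r₂ b c e : ℕ} (hd₂ : d₂ = r₂ + b)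
    (hr₂ : r₂ = r₁ + m) (hd₃ : d₃ = c + e) :
    ChartCover (incidenceFunctor k d₁ d₂ d₃ r₁ r₂ c) where
  J := ULift.{u} (ChartIndex d₂ d₃ r₁ m r₂ b c e)
  R _ := MvPolynomial (ChartCoord d₁ d₃ r₁ m r₂ b c e) k
  pt w := (MvPolynomial.C, w.down.incidencePoint MvPolynomial.X)
  inj w A _ g h H := by
    obtain ⟨h1, h2⟩ := Prod.ext_iff.1 H
    change (w.down.incidencePoint _).map _ = (w.down.incidencePoint _).map _ at h2
    rw [ChartIndex.incidencePoint_map, ChartIndex.incidencePoint_map] at h2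
    exact MvPolynomial.ringHom_ext (RingHom.congr_fun h1)
      (congrFun (w.down.incidencePoint_injective h2))
  D w w' := w.down.overlapDet w'.down MvPolynomial.X
  mem_iff w w' A _ h := by
    rw [ChartIndex.overlapDet_map, ← ChartIndex.exists_eq_incidencePoint_iff]
    constructor
    · rintro ⟨g, hg⟩
      have h2 := (Prod.ext_iff.1 hg).2
      change (w'.down.incidencePoint _).map _ = (w.down.incidencePoint _).map _ at h2
      rw [ChartIndex.incidencePoint_map, ChartIndex.incidencePoint_map] at h2
      exact ⟨_, h2⟩
    · rintro ⟨y, hy⟩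
      refine ⟨MvPolynomial.eval₂Hom (h.comp MvPolynomial.C) y, Prod.ext
        (eval₂Hom_comp_C' _ _) ?_⟩
      change (w'.down.incidencePoint _).map _ = (w.down.incidencePoint _).map _
      rw [ChartIndex.incidencePoint_map, ChartIndex.incidencePoint_map, eval₂Hom_comp_X, hy]
  cover A _ P p := by
    obtain ⟨f, hf, w, hw⟩ := exists_chartIndex hd₂ hr₂ hd₃ P.2 p
    obtain ⟨x, hx⟩ := hw (Localization.Away f) (algebraMap A _)
      (IsLocalization.Away.algebraMap_isUnit f)
    refine ⟨f, hf, ⟨w⟩, MvPolynomial.eval₂Hom ((algebraMap A _).comp P.1) x, Prod.ext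
      (eval₂Hom_comp_C' _ _).symm ?_⟩
    change _ = (w.incidencePoint _).map _
    rw [ChartIndex.incidencePoint_map, eval₂Hom_comp_X, hx]
    rfl
  separated A _ ι f hf P Q H := incidenceFunctor_separated f hf P Q H
  glue A _ ι f hf P H := incidenceFunctor_glue f hf P H

end EquiA3

end

noncomputable section

namespace EquiA3

/-! ### The incidence variety as a scheme -/

/-- The open cover of a glued scheme by its charts. -/
def ChartCover.openCover {F : PointFunctor.{u}} (𝒞 : ChartCover F) : 𝒞.scheme.OpenCover :=
  𝒞.glueData.openCover

section Scheme

variable (k : Type u) [Field k] (d₁ : ℕ) {d₂ d₃ r₁ m r₂ b c e : ℕ} (hd₂ : d₂ = r₂ + b)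
  (hr₂ : r₂ = r₁ + m) (hd₃ : d₃ = c + e)

/-- The incidence variety. -/
def incScheme : Scheme.{u} := (incidenceCover k d₁ hd₂ hr₂ hd₃).scheme

theorem exists_incToRep : ∃ q : incScheme k d₁ hd₂ hr₂ hd₃ ⟶ repScheme k d₁ d₂ d₃,
    ∀ (A : Type u) [CommRing A] (x : Spec (CommRingCat.of A) ⟶ incScheme k d₁ hd₂ hr₂ hd₃),
      x ≫ q = specMap (((incidenceCover k d₁ hd₂ hr₂ hd₃).point x).2.V.evalHom
        ((incidenceCover k d₁ hd₂ hr₂ hd₃).point x).1) :=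
  (incidenceCover k d₁ hd₂ hr₂ hd₃).exists_hom (fun _ _ P => specMap (P.2.V.evalHom P.1))
    fun A B _ _ f P => by
      rw [← specMap_comp, RepSpace.comp_evalHom]
      rfl

/-- The projection from the incidence variety to the representation space. -/
def incToRep : incScheme k d₁ hd₂ hr₂ hd₃ ⟶ repScheme k d₁ d₂ d₃ :=
  (exists_incToRep k d₁ hd₂ hr₂ hd₃).choose

/-- The structure morphism of the incidence variety. -/
def incStr : incScheme k d₁ hd₂ hr₂ hd₃ ⟶ Spec (CommRingCat.of k) :=
  incToRep k d₁ hd₂ hr₂ hd₃ ≫ specMap MvPolynomial.C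

variable {k d₁}

/-- The incidence point given by an affine point of the incidence variety. -/
def incPoint {A : Type u} [CommRing A]
    (x : Spec (CommRingCat.of A) ⟶ incScheme k d₁ hd₂ hr₂ hd₃) :
    (k →+* A) × IncidencePoint A d₁ d₂ d₃ r₁ r₂ c :=
  (incidenceCover k d₁ hd₂ hr₂ hd₃).point x

theorem incPoint_injective {A : Type u} [CommRing A]
    {x y : Spec (CommRingCat.of A) ⟶ incScheme k d₁ hd₂ hr₂ hd₃}
    (h : incPoint hd₂ hr₂ hd₃ x = incPoint hd₂ hr₂ hd₃ y) : x = y :=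
  (incidenceCover k d₁ hd₂ hr₂ hd₃).point_injective h

theorem exists_incPoint_eq {A : Type u} [CommRing A] (κ : k →+* A)
    (P : IncidencePoint A d₁ d₂ d₃ r₁ r₂ c) :
    ∃ x, incPoint hd₂ hr₂ hd₃ x = (κ, P) :=
  (incidenceCover k d₁ hd₂ hr₂ hd₃).point_surjective (κ, P)

theorem incPoint_comp {A B : Type u} [CommRing A] [CommRing B]
    (x : Spec (CommRingCat.of A) ⟶ incScheme k d₁ hd₂ hr₂ hd₃) (g : A →+* B) :
    incPoint hd₂ hr₂ hd₃ (specMap g ≫ x) =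
      (g.comp (incPoint hd₂ hr₂ hd₃ x).1, (incPoint hd₂ hr₂ hd₃ x).2.map g) :=
  (incidenceCover k d₁ hd₂ hr₂ hd₃).point_comp x g

theorem comp_incToRep {A : Type u} [CommRing A]
    (x : Spec (CommRingCat.of A) ⟶ incScheme k d₁ hd₂ hr₂ hd₃) :
    x ≫ incToRep k d₁ hd₂ hr₂ hd₃ =
      specMap ((incPoint hd₂ hr₂ hd₃ x).2.V.evalHom (incPoint hd₂ hr₂ hd₃ x).1) :=
  (exists_incToRep k d₁ hd₂ hr₂ hd₃).choose_spec A x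

theorem comp_incStr {A : Type u} [CommRing A]
    (x : Spec (CommRingCat.of A) ⟶ incScheme k d₁ hd₂ hr₂ hd₃) :
    x ≫ incStr k d₁ hd₂ hr₂ hd₃ = specMap (incPoint hd₂ hr₂ hd₃ x).1 := by
  have h : (x ≫ incToRep k d₁ hd₂ hr₂ hd₃) ≫ specMap MvPolynomial.C =
      specMap (incPoint hd₂ hr₂ hd₃ x).1 := by
    rw [comp_incToRep]
    refine (specMap_comp _ _).symm.trans ?_
    congr 1
    exact eval₂Hom_comp_C' _ _
  exact (Category.assoc _ _ _).symm.trans h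

/-- The chart of the incidence variety with a given index. -/
def incChart (w : ChartIndex d₂ d₃ r₁ m r₂ b c e) :
    Spec (CommRingCat.of (MvPolynomial (ChartCoord d₁ d₃ r₁ m r₂ b c e) k)) ⟶
      incScheme k d₁ hd₂ hr₂ hd₃ :=
  (incidenceCover k d₁ hd₂ hr₂ hd₃).chartι ⟨w⟩

instance (w : ChartIndex d₂ d₃ r₁ m r₂ b c e) :
    IsOpenImmersion (incChart (k := k) (d₁ := d₁) hd₂ hr₂ hd₃ w) :=
  (incidenceCover k d₁ hd₂ hr₂ hd₃).isOpenImmersion_chartι ⟨w⟩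

theorem incPoint_comp_incChart {A : Type u} [CommRing A] (w : ChartIndex d₂ d₃ r₁ m r₂ b c e)
    (g : MvPolynomial (ChartCoord d₁ d₃ r₁ m r₂ b c e) k →+* A) :
    incPoint hd₂ hr₂ hd₃ (specMap g ≫ incChart hd₂ hr₂ hd₃ w) =
      (g.comp MvPolynomial.C, w.incidencePoint (g ∘ MvPolynomial.X)) := by
  rw [← ChartIndex.incidencePoint_map]
  exact (incidenceCover k d₁ hd₂ hr₂ hd₃).point_comp_chartι (i := ⟨w⟩) g

theorem incPoint_incChart (w : ChartIndex d₂ d₃ r₁ m r₂ b c e) :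
    incPoint (k := k) (d₁ := d₁) hd₂ hr₂ hd₃ (incChart hd₂ hr₂ hd₃ w) =
      (MvPolynomial.C, w.incidencePoint MvPolynomial.X) := by
  have := incPoint_comp_incChart (k := k) (d₁ := d₁) hd₂ hr₂ hd₃ w (RingHom.id _)
  rw [specMap, CommRingCat.ofHom_id, Spec.map_id, Category.id_comp] at this
  exact this

theorem exists_incChart_eq (z : incScheme k d₁ hd₂ hr₂ hd₃) :
    ∃ (w : ChartIndex d₂ d₃ r₁ m r₂ b c e) (y : _), incChart hd₂ hr₂ hd₃ w y = z := by
  obtain ⟨⟨w⟩, y, hy⟩ := (incidenceCover k d₁ hd₂ hr₂ hd₃).exists_chartι_eq z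
  exact ⟨w, y, hy⟩

variable (k d₁)

theorem incPoint_fst {A : Type u} [CommRing A] [Algebra k A]
    (x : Points (incStr k d₁ hd₂ hr₂ hd₃) A) :
    (incPoint hd₂ hr₂ hd₃ x.1).1 = algebraMap k A := by
  have := x.2
  rw [comp_incStr] at this
  exact specMap_injective this

/-- The identification of the points of the incidence variety. -/
def incidenceVarietyStr : IncidenceVarietyStr (incStr k d₁ hd₂ hr₂ hd₃) d₁ d₂ d₃ r₁ r₂ c where
  equiv A _ _ := Equiv.ofBijective (fun x => (incPoint hd₂ hr₂ hd₃ x.1).2) (by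
    constructor
    · intro x y h
      exact Subtype.ext (incPoint_injective hd₂ hr₂ hd₃ (Prod.ext
        ((incPoint_fst k d₁ hd₂ hr₂ hd₃ x).trans (incPoint_fst k d₁ hd₂ hr₂ hd₃ y).symm) h))
    · intro P
      obtain ⟨x, hx⟩ := exists_incPoint_eq hd₂ hr₂ hd₃ (algebraMap k A) P
      exact ⟨⟨x, by rw [comp_incStr, hx]⟩, congrArg (fun z => z.2) hx⟩)
  natural A B _ _ _ _ f x y h := by
    have h1 : (incPoint hd₂ hr₂ hd₃ y.1).2 = (incPoint hd₂ hr₂ hd₃ x.1).2.map f.toRingHom := by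
      rw [h]
      exact congrArg (fun z => z.2) (incPoint_comp hd₂ hr₂ hd₃ x.1 f.toRingHom)
    change IncidencePoint.IsBaseChange _ _ (incPoint hd₂ hr₂ hd₃ y.1).2
    rw [h1]
    exact ⟨rfl, rfl, rfl, rfl, rfl⟩

/-! ### Smoothness and integrality -/

theorem incChart_comp_incStr (w : ChartIndex d₂ d₃ r₁ m r₂ b c e) :
    incChart hd₂ hr₂ hd₃ w ≫ incStr k d₁ hd₂ hr₂ hd₃ = specMap MvPolynomial.C := by
  rw [comp_incStr, incPoint_incChart]

/-- Smoothness is local on the source, and every chart is an affine space over `k`. -/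
instance smooth_incStr : Smooth (incStr k d₁ hd₂ hr₂ hd₃) := by
  have h : IsZariskiLocalAtSource @Smooth.{u} :=
    HasRingHomProperty.instIsZariskiLocalAtSource (P := @Smooth)
  refine (@IsZariskiLocalAtSource.iff_of_openCover @Smooth.{u} h _ _ _
    (incidenceCover k d₁ hd₂ hr₂ hd₃).openCover).2 fun w => ?_
  change Smooth (incChart hd₂ hr₂ hd₃ w.down ≫ incStr k d₁ hd₂ hr₂ hd₃)
  rw [incChart_comp_incStr, HasRingHomProperty.Spec_iff (P := @Smooth)]
  have : Algebra.Smooth k (MvPolynomial (ChartCoord d₁ d₃ r₁ m r₂ b c e) k) :=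
    ⟨inferInstance, inferInstance⟩
  exact RingHom.smooth_algebraMap.2 this

instance compactSpace_incScheme : CompactSpace (incScheme k d₁ hd₂ hr₂ hd₃) := by
  have h1 : Finite (incidenceCover k d₁ hd₂ hr₂ hd₃).openCover.I₀ :=
    inferInstanceAs (Finite (ULift.{u} (ChartIndex d₂ d₃ r₁ m r₂ b c e)))
  have h2 (i : (incidenceCover k d₁ hd₂ hr₂ hd₃).openCover.I₀) :
      CompactSpace ((incidenceCover k d₁ hd₂ hr₂ hd₃).openCover.X i) :=
    inferInstanceAs (CompactSpace (Spec (CommRingCat.of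
      (MvPolynomial (ChartCoord d₁ d₃ r₁ m r₂ b c e) k))))
  exact (incidenceCover k d₁ hd₂ hr₂ hd₃).openCover.compactSpace

instance isReduced_incScheme : IsReduced (incScheme k d₁ hd₂ hr₂ hd₃) := by
  have h2 (i : (incidenceCover k d₁ hd₂ hr₂ hd₃).openCover.I₀) :
      IsReduced ((incidenceCover k d₁ hd₂ hr₂ hd₃).openCover.X i) :=
    inferInstanceAs (IsReduced (Spec (CommRingCat.of
      (MvPolynomial (ChartCoord d₁ d₃ r₁ m r₂ b c e) k))))
  exact IsReduced.of_openCover _ (incidenceCover k d₁ hd₂ hr₂ hd₃).openCover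

end Scheme

/-- A space covered by irreducible open subsets with a common point is irreducible. -/
theorem irreducibleSpace_of_cover {X ι : Type*} [TopologicalSpace X] (U : ι → Set X)
    (hU : ∀ i, IsOpen (U i)) (hirr : ∀ i, IsPreirreducible (U i)) (hcov : ∀ x, ∃ i, x ∈ U i)
    (x₀ : X) (hx₀ : ∀ i, x₀ ∈ U i) : IrreducibleSpace X where
  toNonempty := ⟨x₀⟩
  isPreirreducible_univ := by
    rintro S T hS hT ⟨x, -, hx⟩ ⟨y, -, hy⟩
    obtain ⟨i, hi⟩ := hcov x
    obtain ⟨j, hj⟩ := hcov y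
    -- First move from `S` into `U j`, which meets `U i` in the common point; then `S` and `T` both
    -- meet the irreducible set `U j`.
    obtain ⟨z, hzi, hzS, hzj⟩ := hirr i S (U j) hS (hU j) ⟨x, hi, hx⟩ ⟨x₀, hx₀ i, hx₀ j⟩
    obtain ⟨t, -, htS, htT⟩ := hirr j S T hS hT ⟨z, hzj, hzS⟩ ⟨y, hj, hy⟩
    exact ⟨t, Set.mem_univ _, htS, htT⟩

/-! ### A point common to all charts, and irreducibility -/

section Vandermonde

variable (k : Type u) [Field k]

/-- The rectangular Vandermonde matrix with nodes `0, …, n - 1`. -/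
def vander (n r : ℕ) : Matrix (Fin n) (Fin r) k := Matrix.of fun i j => (i : k) ^ (j : ℕ)

theorem projM_mul_vander {n r s b : ℕ} (σ : Fin r ⊕ Fin b ≃ Fin n) :
    projM k σ * vander k n s =
      Matrix.of fun (i : Fin r) (j : Fin s) => ((σ (Sum.inl i) : ℕ) : k) ^ (j : ℕ) := by
  ext i j
  simp [projM, vander, Matrix.mul_apply, Matrix.one_apply]

theorem range_vander_le {n r s : ℕ} (h : r ≤ s) :
    LinearMap.range (Matrix.toLin' (vander k n r)) ≤
      LinearMap.range (Matrix.toLin' (vander k n s)) := by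
  rw [range_toLin', range_toLin']
  apply Submodule.span_mono
  rintro _ ⟨j, rfl⟩
  exact ⟨Fin.castLE h j, rfl⟩

variable [CharZero k]

theorem isUnit_det_vandermonde {n r : ℕ} {v : Fin r → Fin n} (hv : Function.Injective v) :
    IsUnit (Matrix.vandermonde fun i => ((v i : ℕ) : k)).det := by
  rw [isUnit_iff_ne_zero, Matrix.det_vandermonde_ne_zero_iff]
  intro i j h
  exact hv (Fin.ext (Nat.cast_injective h))

/-- Any `r` rows of the matrix form a square Vandermonde matrix whose nodes are distinct integers,
hence distinct in `k` by characteristic zero. So its column span is in general position with respect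
to all coordinate projections. -/
theorem onto_projM_vander {n r b : ℕ} (σ : Fin r ⊕ Fin b ≃ Fin n) :
    Onto (projM k σ) (LinearMap.range (Matrix.toLin' (vander k n r))) := by
  rw [onto_range_iff, projM_mul_vander]
  exact isUnit_det_vandermonde k (v := fun i => σ (Sum.inl i))
    (σ.injective.comp Sum.inl_injective)

theorem exists_leftInverse_vander {n r b : ℕ} (hn : n = r + b) :
    ∃ L : Matrix (Fin r) (Fin n) k, L * vander k n r = 1 := by
  let σ : Fin r ⊕ Fin b ≃ Fin n := finSumFinEquiv.trans (finCongr hn.symm)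
  have := onto_projM_vander k σ
  rw [onto_range_iff] at this
  exact ⟨(projM k σ * vander k n r)⁻¹ * projM k σ, by
    rw [Matrix.mul_assoc, Matrix.nonsing_inv_mul _ this]⟩

variable {d₁ d₂ d₃ r₁ m r₂ b c e : ℕ} (hd₂ : d₂ = r₂ + b) (hr₂ : r₂ = r₁ + m) (hd₃ : d₃ = c + e)
include hd₂ hr₂ hd₃

/-- There is an incidence point lying on all charts. -/
theorem exists_mem_all_charts : ∃ P : IncidencePoint k d₁ d₂ d₃ r₁ r₂ c,
    ∀ w : ChartIndex d₂ d₃ r₁ m r₂ b c e, ∃ x, w.incidencePoint x = P := by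
  obtain ⟨L₁, h₁⟩ := exists_leftInverse_vander k (n := d₂) (r := r₁) (b := m + b) (by omega)
  obtain ⟨L₂, h₂⟩ := exists_leftInverse_vander k hd₂
  obtain ⟨L₃, h₃⟩ := exists_leftInverse_vander k hd₃
  -- Zero maps satisfy the incidence conditions for any flag, and the first `r₁` Vandermonde columns
  -- are among the first `r₂`, so the spans are nested.
  refine ⟨⟨⟨0, 0⟩, ⟨Gr.ofLeftInverse _ _ h₁, Gr.ofLeftInverse _ _ h₂,
    range_vander_le k (by omega)⟩, Gr.ofLeftInverse _ _ h₃, ?_, ?_⟩, fun w => ?_⟩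
  · rw [map_zero, LinearMap.range_zero]; exact bot_le
  · rw [map_zero, Submodule.map_zero]; exact bot_le
  · refine w.exists_incidencePoint_eq _ ?_ (onto_projM_vander k w.σ) (onto_projM_vander k w.τ)
    change Onto _ (LinearMap.range (Matrix.toLin' (vander k d₂ r₁)))
    rw [onto_range_iff, ChartIndex.proj₁, Matrix.mul_assoc, projM_mul_vander]
    have : projM k w.ρ * (Matrix.of fun (i : Fin r₂) (j : Fin r₁) =>
        ((w.σ (Sum.inl i) : ℕ) : k) ^ (j : ℕ)) =
        Matrix.vandermonde fun i => ((w.σ (Sum.inl (w.ρ (Sum.inl i))) : ℕ) : k) := by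
      ext i j
      simp [projM, Matrix.vandermonde, Matrix.mul_apply, Matrix.one_apply]
    rw [this]
    exact isUnit_det_vandermonde k (v := fun i => w.σ (Sum.inl (w.ρ (Sum.inl i))))
      (w.σ.injective.comp (Sum.inl_injective.comp (w.ρ.injective.comp Sum.inl_injective)))

omit hd₂ hr₂ hd₃

instance irreducibleSpace_incScheme : IrreducibleSpace (incScheme k d₁ hd₂ hr₂ hd₃) := by
  obtain ⟨P, hP⟩ := exists_mem_all_charts k (d₁ := d₁) hd₂ hr₂ hd₃
  obtain ⟨x, hx⟩ := exists_incPoint_eq hd₂ hr₂ hd₃ (RingHom.id k) P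
  let pt : Spec (CommRingCat.of k) := (⊥ : PrimeSpectrum k)
  refine irreducibleSpace_of_cover (fun w : ChartIndex d₂ d₃ r₁ m r₂ b c e =>
    Set.range (incChart (k := k) (d₁ := d₁) hd₂ hr₂ hd₃ w))
    (fun w => (incChart hd₂ hr₂ hd₃ w).isOpenEmbedding.isOpen_range) (fun w => ?_)
    (fun z => ?_) (x pt) (fun w => ?_)
  · rw [← Set.image_univ]
    refine IsPreirreducible.image ?_ _ (incChart hd₂ hr₂ hd₃ w).continuous.continuousOn
    have : IrreducibleSpace (PrimeSpectrum (MvPolynomial (ChartCoord d₁ d₃ r₁ m r₂ b c e) k)) :=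
      inferInstance
    exact this.isPreirreducible_univ
  · obtain ⟨w, y, hy⟩ := exists_incChart_eq hd₂ hr₂ hd₃ z
    exact ⟨w, y, hy⟩
  · obtain ⟨y, hy⟩ := hP w
    have : x = specMap (MvPolynomial.eval₂Hom (RingHom.id k) y) ≫ incChart hd₂ hr₂ hd₃ w := by
      apply incPoint_injective
      rw [hx, incPoint_comp_incChart, eval₂Hom_comp_C', eval₂Hom_comp_X, hy]
    rw [this]
    exact ⟨specMap (MvPolynomial.eval₂Hom (RingHom.id k) y) pt, by simp⟩

instance isIntegral_incScheme : IsIntegral (incScheme k d₁ hd₂ hr₂ hd₃) :=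
  isIntegral_of_irreducibleSpace_of_isReduced _

end Vandermonde

/-! ### Properness -/

section Valuative

/-- The vectors over `R` lying in a submodule over `K`. -/
def contractSub (R : Type u) [CommRing R] {K : Type u} [CommRing K] [Algebra R K] {n : ℕ}
    (N : Submodule K (Fin n → K)) : Submodule R (Fin n → R) where
  carrier := {v | (fun i => algebraMap R K (v i)) ∈ N}
  add_mem' {v w} hv hw := by
    change (fun i => algebraMap R K ((v + w) i)) ∈ N
    have h : (fun i => algebraMap R K ((v + w) i)) =
        (fun i => algebraMap R K (v i)) + fun i => algebraMap R K (w i) := by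
      ext l; simp
    rw [h]
    exact N.add_mem hv hw
  zero_mem' := by
    change (fun i => algebraMap R K ((0 : Fin n → R) i)) ∈ N
    have h : (fun i => algebraMap R K ((0 : Fin n → R) i)) = 0 := by
      ext l; simp
    rw [h]
    exact N.zero_mem
  smul_mem' a v hv := smul_comp_mem a hv

theorem mem_contractSub {R K : Type u} [CommRing R] [CommRing K] [Algebra R K] {n : ℕ}
    {N : Submodule K (Fin n → K)} {v : Fin n → R} :
    v ∈ contractSub R N ↔ (fun i => algebraMap R K (v i)) ∈ N :=
  Iff.rfl

variable {R K : Type u} [CommRing R] [IsDomain R] [Field K] [Algebra R K]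
  [IsFractionRing R K] {n : ℕ}

theorem extendSub_contractSub (N : Submodule K (Fin n → K)) :
    extendSub (algebraMap R K) (contractSub R N) = N := by
  apply le_antisymm
  · rw [extendSub_le_iff]
    exact fun v hv => hv
  · intro w hw
    obtain ⟨s, hs⟩ := IsLocalization.exist_integer_multiples_of_finite (nonZeroDivisors R) w
    choose v hv using hs
    have hs0 : algebraMap R K s ≠ 0 := IsFractionRing.to_map_ne_zero_of_mem_nonZeroDivisors s.2
    have hvw : (fun i => algebraMap R K (v i)) = algebraMap R K s • w := by
      ext i
      rw [hv, Pi.smul_apply, Algebra.smul_def]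
      rfl
    have hvN : v ∈ contractSub R N := by
      rw [mem_contractSub, hvw]
      exact N.smul_mem _ hw
    have : w = (algebraMap R K s)⁻¹ • fun i => algebraMap R K (v i) := by
      rw [hvw, smul_smul, inv_mul_cancel₀ hs0, one_smul]
    rw [this]
    exact Submodule.smul_mem _ _ (mem_extendSub _ hvN)

/-- The contraction is saturated: a nonzero scalar of `R` is invertible in `K`, so it can be
cancelled from membership in `N`. -/
theorem isTorsionFree_quotient_contractSub (N : Submodule K (Fin n → K)) :
    Module.IsTorsionFree R ((Fin n → R) ⧸ contractSub R N) := by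
  rw [Submodule.isTorsionFree_iff_torsion_eq_bot, eq_bot_iff]
  intro x hx
  obtain ⟨v, rfl⟩ := Submodule.mkQ_surjective _ x
  obtain ⟨a, ha⟩ := (Submodule.mem_torsion_iff _).1 hx
  have ha' : a.1 • v ∈ contractSub R N := by
    rw [← Submodule.Quotient.mk_eq_zero]
    exact ha
  have ha0 : algebraMap R K a ≠ 0 := IsFractionRing.to_map_ne_zero_of_mem_nonZeroDivisors a.2
  refine (Submodule.mem_bot R).2 ((Submodule.Quotient.mk_eq_zero _).2 ?_)
  rw [mem_contractSub] at ha' ⊢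
  have : (fun i => algebraMap R K (v i)) =
      (algebraMap R K a)⁻¹ • fun i => algebraMap R K ((a.1 • v) i) := by
    ext i
    simp [ha0]
  rw [this]
  exact N.smul_mem _ ha'

variable [ValuationRing R]

/-- The extension of a point of the Grassmannian from the field of fractions of a valuation
ring. -/
def Gr.contract {r : ℕ} (N : Gr K r n) : Gr R r n where
  sub := contractSub R N.sub
  projective_quotient := by
    -- A valuation ring is Bézout, so torsion-free modules are flat; and it is local, so finitely
    -- generated flat modules are free.
    have := isTorsionFree_quotient_contractSub (R := R) N.sub
    rw [Submodule.isTorsionFree_iff_torsion_eq_bot,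
      ← Module.Flat.flat_iff_torsion_eq_bot_of_isBezout] at this
    have : Module.Free R ((Fin n → R) ⧸ contractSub R N.sub) :=
      Module.free_of_flat_of_isLocalRing
    infer_instance
  rank_eq p := by
    have := isTorsionFree_quotient_contractSub (R := R) N.sub
    rw [Submodule.isTorsionFree_iff_torsion_eq_bot,
      ← Module.Flat.flat_iff_torsion_eq_bot_of_isBezout] at this
    have : Module.Free R ((Fin n → R) ⧸ contractSub R N.sub) :=
      Module.free_of_flat_of_isLocalRing
    have := projective_of_projective_quotient (contractSub R N.sub)
    have := finite_of_projective_quotient (contractSub R N.sub)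
    -- The rank at `p` equals the rank at the generic point, where it is that of the original
    -- subspace.
    have h1 := rankAtStalk_extendSub (algebraMap R K) (contractSub R N.sub) ⊥
    rw [extendSub_contractSub, N.rank_eq] at h1
    refine Eq.trans ?_ h1.symm
    refine (Module.rankAtStalk_eq_of_le_of_finite_of_flat _ ?_).symm
    intro x hx
    have : algebraMap R K x = 0 := hx
    rw [(FaithfulSMul.algebraMap_eq_zero_iff R K).1 this]
    exact p.asIdeal.zero_mem

/-- A direct summand is the kernel of the matrix of a complementary projection, and the vanishing of
a vector over `R` can be checked in the fraction field. Hence a point over `R` is determined by its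
generic fibre. -/
theorem Gr.contract_extendSub {R K : Type u} [CommRing R] [Field K] [Algebra R K]
    [IsFractionRing R K] {n r : ℕ} (N : Gr R r n) :
    contractSub R (extendSub (algebraMap R K) N.sub) = N.sub := by
  apply le_antisymm
  · intro v hv
    obtain ⟨π, hπ⟩ := exists_projection N.sub
    let M : Matrix (Fin n) (Fin n) R := LinearMap.toMatrix' (LinearMap.id - N.sub.subtype ∘ₗ π)
    have hM : ∀ w ∈ N.sub, Matrix.toLin' M w = 0 := by
      intro w hw
      have := LinearMap.congr_fun hπ ⟨w, hw⟩
      simp only [LinearMap.comp_apply, Submodule.subtype_apply, LinearMap.id_apply] at this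
      simp [M, this]
    have hK : extendSub (algebraMap R K) N.sub ≤
        LinearMap.ker (Matrix.toLin' (M.map (algebraMap R K))) := by
      rw [extendSub_le_iff]
      intro w hw
      rw [LinearMap.mem_ker, toLin'_map_comp, hM w hw]
      ext i; simp
    have h0 := hK (mem_contractSub.1 hv)
    rw [LinearMap.mem_ker, toLin'_map_comp] at h0
    have h1 : Matrix.toLin' M v = 0 := by
      ext i
      exact (FaithfulSMul.algebraMap_eq_zero_iff R K).1 (congrFun h0 i)
    have h2 : v = (π v).1 := by
      simpa [M, sub_eq_zero] using h1
    rw [h2]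
    exact (π v).2
  · exact fun v hv => mem_extendSub _ hv

end Valuative

section Proper

variable (k : Type u) [Field k] (d₁ : ℕ) {d₂ d₃ r₁ m r₂ b c e : ℕ} (hd₂ : d₂ = r₂ + b)
  (hr₂ : r₂ = r₁ + m) (hd₃ : d₃ = c + e)

/-- The matrices are already defined over `R`; the three subspaces are contracted to `R`, and the
incidence conditions hold because they hold over `K`. -/
theorem existence_incToRep :
    ValuativeCriterion.Existence (incToRep k d₁ hd₂ hr₂ hd₃) := by
  rintro ⟨R, K, x, y, ⟨hsq⟩⟩
  obtain ⟨θ, hθ⟩ := exists_eq_specMap (A := MvPolynomial (Coord d₁ d₂ d₃) k) y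
  subst hθ
  obtain ⟨κ, W, rfl⟩ := RepSpace.exists_evalHom_eq θ
  have h1 := hsq
  rw [comp_incToRep] at h1
  change _ = specMap (algebraMap R K) ≫ specMap _ at h1
  rw [← specMap_comp, RepSpace.comp_evalHom] at h1
  obtain ⟨h2, h3⟩ := RepSpace.evalHom_injective (specMap_injective h1)
  set P := (incPoint hd₂ hr₂ hd₃ x).2
  have hWα : P.V.α = W.α.map (algebraMap R K) := congrArg (fun z => z.α) h3
  have hWβ : P.V.β = W.β.map (algebraMap R K) := congrArg (fun z => z.β) h3
  let Q : IncidencePoint R d₁ d₂ d₃ r₁ r₂ c :=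
    { V := W
      F := ⟨P.F.R₁.contract, P.F.R₂.contract, fun v hv => P.F.le hv⟩
      R := P.R.contract
      range_le := by
        rintro _ ⟨v, rfl⟩
        change (fun i => algebraMap R K _) ∈ P.F.R₁.sub
        rw [← toLin'_map_comp, ← hWα]
        exact P.range_le ⟨_, rfl⟩
      map_le := by
        rintro _ ⟨v, hv, rfl⟩
        change (fun i => algebraMap R K _) ∈ P.R.sub
        rw [← toLin'_map_comp, ← hWβ]
        exact P.map_le ⟨_, hv, rfl⟩ }
  obtain ⟨l, hl⟩ := exists_incPoint_eq hd₂ hr₂ hd₃ κ Q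
  refine ⟨⟨l, ?_, ?_⟩⟩
  · apply incPoint_injective hd₂ hr₂ hd₃
    change incPoint hd₂ hr₂ hd₃ (specMap (algebraMap R K) ≫ l) = _
    rw [incPoint_comp, hl]
    refine Prod.ext h2.symm (IncidencePoint.ext_of_eq hWα.symm hWβ.symm ?_ ?_ ?_)
    · exact extendSub_contractSub P.F.R₁.sub
    · exact extendSub_contractSub P.F.R₂.sub
    · exact extendSub_contractSub P.R.sub
  · rw [comp_incToRep, hl]

theorem uniqueness_incToRep :
    ValuativeCriterion.Uniqueness (incToRep k d₁ hd₂ hr₂ hd₃) := by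
  rintro ⟨R, K, x, y, hsq⟩
  constructor
  rintro ⟨l, h1, h2⟩ ⟨l', h1', h2'⟩
  have : l = l' := by
    apply incPoint_injective hd₂ hr₂ hd₃
    change specMap (algebraMap R K) ≫ l = x at h1
    change specMap (algebraMap R K) ≫ l' = x at h1'
    rw [comp_incToRep] at h2 h2'
    obtain ⟨e1, e2⟩ := RepSpace.evalHom_injective (specMap_injective (h2.trans h2'.symm))
    have h3 : incPoint hd₂ hr₂ hd₃ (specMap (algebraMap R K) ≫ l) =
        incPoint hd₂ hr₂ hd₃ (specMap (algebraMap R K) ≫ l') := by rw [h1, h1']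
    rw [incPoint_comp, incPoint_comp] at h3
    have key {r n : ℕ} (N M : Gr R r n) (h : extendSub (algebraMap R K) N.sub =
        extendSub (algebraMap R K) M.sub) : N.sub = M.sub := by
      rw [← N.contract_extendSub (K := K), ← M.contract_extendSub (K := K), h]
    refine Prod.ext e1 (IncidencePoint.ext_of_eq (congrArg (fun z => z.α) e2)
      (congrArg (fun z => z.β) e2) (key _ _ ?_) (key _ _ ?_) (key _ _ ?_))
    · exact congrArg (fun z => z.2.F.R₁.sub) h3
    · exact congrArg (fun z => z.2.F.R₂.sub) h3
    · exact congrArg (fun z => z.2.R.sub) h3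
  subst this
  rfl

/-- The valuative criterion applies because the scheme is compact and of finite type over a field,
hence locally Noetherian. -/
instance isProper_incToRep : IsProper (incToRep k d₁ hd₂ hr₂ hd₃) := by
  have h1 : LocallyOfFiniteType (incToRep k d₁ hd₂ hr₂ hd₃ ≫ specMap MvPolynomial.C) :=
    inferInstanceAs (LocallyOfFiniteType (incStr k d₁ hd₂ hr₂ hd₃))
  have h2 : LocallyOfFiniteType (incToRep k d₁ hd₂ hr₂ hd₃) :=
    locallyOfFiniteType_of_comp _ (specMap MvPolynomial.C)
  have h3 : IsLocallyNoetherian (Spec (CommRingCat.of k)) := inferInstance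
  have h4 : IsLocallyNoetherian (incScheme k d₁ hd₂ hr₂ hd₃) :=
    LocallyOfFiniteType.isLocallyNoetherian (incStr k d₁ hd₂ hr₂ hd₃)
  have h5 : QuasiSeparatedSpace (repScheme k d₁ d₂ d₃) :=
    inferInstanceAs (QuasiSeparatedSpace (Spec _))
  have h6 : QuasiCompact (incToRep k d₁ hd₂ hr₂ hd₃) := inferInstance
  exact IsProper.of_valuativeCriterion _ (ValuativeCriterion.iff.2
    ⟨existence_incToRep k d₁ hd₂ hr₂ hd₃, uniqueness_incToRep k d₁ hd₂ hr₂ hd₃⟩)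

end Proper

end EquiA3

end

noncomputable section

namespace EquiA3

/-! ### Orbits and ranks -/

section LinearAlgebra

variable {k E F : Type*} [Field k] [AddCommGroup E] [Module k E] [AddCommGroup F] [Module k F]

theorem finrank_map_add_finrank_inf_ker [FiniteDimensional k E] (f : E →ₗ[k] F)
    (p : Submodule k E) : Module.finrank k (p.map f) + Module.finrank k ↥(p ⊓ LinearMap.ker f) =
      Module.finrank k p := by
  rw [← LinearMap.finrank_range_add_finrank_ker (f.domRestrict p)]
  congr 1
  · rw [LinearMap.range_domRestrict]
  · rw [LinearMap.ker_domRestrict, ← Submodule.finrank_map_subtype_eq p,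
      Submodule.map_comap_subtype]

/-- A complement of the kernel of `f` in `p`, with coordinates. -/
theorem exists_injective_comp [FiniteDimensional k E] (f : E →ₗ[k] F) (p : Submodule k E) {ρ : ℕ}
    (h : Module.finrank k p = Module.finrank k ↥(p ⊓ LinearMap.ker f) + ρ) :
    ∃ y : (Fin ρ → k) →ₗ[k] E, (∀ v, y v ∈ p) ∧ ∀ v, f (y v) = 0 → v = 0 := by
  have h1 := finrank_map_add_finrank_inf_ker f p
  have h2 : Module.finrank k (Fin ρ → k) = Module.finrank k (LinearMap.range (f.domRestrict p)) := by
    rw [LinearMap.range_domRestrict, Module.finrank_fin_fun]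
    omega
  let e := LinearEquiv.ofFinrankEq _ _ h2
  obtain ⟨g, hg⟩ := (f.domRestrict p).rangeRestrict.exists_rightInverse_of_surjective
    (f.domRestrict p).range_rangeRestrict
  refine ⟨p.subtype ∘ₗ g ∘ₗ e.toLinearMap, fun v => (g (e v)).2, fun v hv => ?_⟩
  have h3 : ((f.domRestrict p).rangeRestrict (g (e v))).1 = 0 := hv
  rw [show (f.domRestrict p).rangeRestrict (g (e v)) = e v from LinearMap.congr_fun hg (e v)] at h3
  exact e.map_eq_zero_iff.1 (Subtype.ext h3)

end LinearAlgebra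

/-- Coordinates bringing a representation to the normal form
`S₁^a₁ ⊕ S₂^a₂ ⊕ S₃^a₃ ⊕ I₂^b₁ ⊕ P₂^b₂ ⊕ I₃^c`. -/
structure NormalForm {k : Type u} [Field k] {d₁ d₂ d₃ : ℕ} (a₁ a₂ a₃ b₁ b₂ c : ℕ)
    (V : RepSpace k d₁ d₂ d₃) where
  e₁ : ((Fin a₁ → k) × (Fin b₁ → k) × (Fin c → k)) ≃ₗ[k] (Fin d₁ → k)
  e₂ : ((Fin a₂ → k) × (Fin b₁ → k) × (Fin b₂ → k) × (Fin c → k)) ≃ₗ[k] (Fin d₂ → k)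
  e₃ : ((Fin a₃ → k) × (Fin b₂ → k) × (Fin c → k)) ≃ₗ[k] (Fin d₃ → k)
  α_e₁ : ∀ u x y, Matrix.toLin' V.α (e₁ (u, x, y)) = e₂ (0, x, 0, y)
  β_e₂ : ∀ s x t y, Matrix.toLin' V.β (e₂ (s, x, t, y)) = e₃ (0, t, y)

/-- The conditions on dimensions and ranks that characterise the representations isomorphic to
`S₁^a₁ ⊕ S₂^a₂ ⊕ S₃^a₃ ⊕ I₂^b₁ ⊕ P₂^b₂ ⊕ I₃^c`. -/
structure HasRanks {k : Type u} [Field k] {d₁ d₂ d₃ : ℕ} (b₁ b₂ c : ℕ)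
    (V : RepSpace k d₁ d₂ d₃) : Prop where
  α : V.α.rank = b₁ + c
  β : V.β.rank = b₂ + c
  βα : (V.β * V.α).rank = c

section Normal

variable {k : Type u} [Field k] {d₁ d₂ d₃ a₁ a₂ a₃ b₁ b₂ c : ℕ} {V W : RepSpace k d₁ d₂ d₃}

/-- The direct sum carries powers of the zero module wherever a summand is not supported; deleting
these factors leaves the coordinates of the normal form. -/
theorem nonempty_normalForm
    (hV : V.toQRep.Isomorphic (QRep.ofMultiplicities k a₁ a₂ a₃ b₁ b₂ c)) :
    Nonempty (NormalForm a₁ a₂ a₃ b₁ b₂ c V) := by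
  obtain ⟨E₁, E₂, E₃, h₁, h₂⟩ := hV
  let T₁ := (Fin a₁ → k) × (Fin a₂ → PUnit.{u + 1}) × (Fin a₃ → PUnit.{u + 1}) ×
    (Fin b₁ → k) × (Fin b₂ → PUnit.{u + 1}) × (Fin c → k)
  let T₂ := (Fin a₁ → PUnit.{u + 1}) × (Fin a₂ → k) × (Fin a₃ → PUnit.{u + 1}) ×
    (Fin b₁ → k) × (Fin b₂ → k) × (Fin c → k)
  let T₃ := (Fin a₁ → PUnit.{u + 1}) × (Fin a₂ → PUnit.{u + 1}) × (Fin a₃ → k) ×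
    (Fin b₁ → PUnit.{u + 1}) × (Fin b₂ → k) × (Fin c → k)
  let G₁ : ((Fin a₁ → k) × (Fin b₁ → k) × (Fin c → k)) ≃ₗ[k] T₁ :=
    { toFun := fun z => (z.1, 0, 0, z.2.1, 0, z.2.2)
      invFun := fun z => (z.1, z.2.2.2.1, z.2.2.2.2.2)
      left_inv := fun z => rfl
      right_inv := fun z => rfl
      map_add' := fun z w => rfl
      map_smul' := fun a z => rfl }
  let G₂ : ((Fin a₂ → k) × (Fin b₁ → k) × (Fin b₂ → k) × (Fin c → k)) ≃ₗ[k] T₂ :=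
    { toFun := fun z => (0, z.1, 0, z.2.1, z.2.2.1, z.2.2.2)
      invFun := fun z => (z.2.1, z.2.2.2.1, z.2.2.2.2.1, z.2.2.2.2.2)
      left_inv := fun z => rfl
      right_inv := fun z => rfl
      map_add' := fun z w => rfl
      map_smul' := fun a z => rfl }
  let G₃ : ((Fin a₃ → k) × (Fin b₂ → k) × (Fin c → k)) ≃ₗ[k] T₃ :=
    { toFun := fun z => (0, 0, z.1, 0, z.2.1, z.2.2)
      invFun := fun z => (z.2.2.1, z.2.2.2.2.1, z.2.2.2.2.2)
      left_inv := fun z => rfl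
      right_inv := fun z => rfl
      map_add' := fun z w => rfl
      map_smul' := fun a z => rfl }
  let E₁' : (Fin d₁ → k) ≃ₗ[k] T₁ := E₁
  let E₂' : (Fin d₂ → k) ≃ₗ[k] T₂ := E₂
  let E₃' : (Fin d₃ → k) ≃ₗ[k] T₃ := E₃
  refine ⟨⟨G₁.trans E₁'.symm, G₂.trans E₂'.symm, G₃.trans E₃'.symm, fun u x y => ?_,
    fun s x t y => ?_⟩⟩
  · apply E₂'.injective
    refine (h₁ _).trans ?_
    have : E₁ ((G₁.trans E₁'.symm) (u, x, y)) = G₁ (u, x, y) := E₁'.apply_symm_apply _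
    rw [this]
    exact (E₂'.apply_symm_apply (G₂ (0, x, 0, y))).symm
  · apply E₃'.injective
    refine (h₂ _).trans ?_
    have : E₂ ((G₂.trans E₂'.symm) (s, x, t, y)) = G₂ (s, x, t, y) := E₂'.apply_symm_apply _
    rw [this]
    exact (E₃'.apply_symm_apply (G₃ (0, t, y))).symm

namespace NormalForm

theorem dim₁ (N : NormalForm a₁ a₂ a₃ b₁ b₂ c V) : d₁ = a₁ + b₁ + c := by
  have := N.e₁.finrank_eq
  simp only [Module.finrank_prod, Module.finrank_fin_fun] at this
  omega

theorem dim₂ (N : NormalForm a₁ a₂ a₃ b₁ b₂ c V) : d₂ = a₂ + b₁ + b₂ + c := by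
  have := N.e₂.finrank_eq
  simp only [Module.finrank_prod, Module.finrank_fin_fun] at this
  omega

theorem dim₃ (N : NormalForm a₁ a₂ a₃ b₁ b₂ c V) : d₃ = a₃ + b₂ + c := by
  have := N.e₃.finrank_eq
  simp only [Module.finrank_prod, Module.finrank_fin_fun] at this
  omega

theorem hasRanks (N : NormalForm a₁ a₂ a₃ b₁ b₂ c V) : HasRanks b₁ b₂ c V where
  α := by
    let g : ((Fin b₁ → k) × (Fin c → k)) →ₗ[k] (Fin d₂ → k) :=
      N.e₂.toLinearMap ∘ₗ LinearMap.prod 0 (LinearMap.prod (LinearMap.fst k _ _)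
        (LinearMap.prod 0 (LinearMap.snd k _ _)))
    have hg : Function.Injective g := by
      rintro ⟨x, y⟩ ⟨x', y'⟩ h
      have := N.e₂.injective h
      simp_all
    have hr : LinearMap.range (Matrix.toLin' V.α) = LinearMap.range g := by
      apply le_antisymm
      · rintro _ ⟨v, rfl⟩
        obtain ⟨⟨u, x, y⟩, rfl⟩ := N.e₁.surjective v
        exact ⟨(x, y), (N.α_e₁ u x y).symm⟩
      · rintro _ ⟨⟨x, y⟩, rfl⟩
        exact ⟨N.e₁ (0, x, y), N.α_e₁ 0 x y⟩
    have := LinearMap.finrank_range_of_inj hg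
    rw [← hr] at this
    exact this.trans (by simp)
  β := by
    let g : ((Fin b₂ → k) × (Fin c → k)) →ₗ[k] (Fin d₃ → k) :=
      N.e₃.toLinearMap ∘ₗ LinearMap.inr k _ _
    have hg : Function.Injective g := N.e₃.injective.comp LinearMap.inr_injective
    have hr : LinearMap.range (Matrix.toLin' V.β) = LinearMap.range g := by
      apply le_antisymm
      · rintro _ ⟨v, rfl⟩
        obtain ⟨⟨s, x, t, y⟩, rfl⟩ := N.e₂.surjective v
        exact ⟨(t, y), (N.β_e₂ s x t y).symm⟩
      · rintro _ ⟨⟨t, y⟩, rfl⟩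
        exact ⟨N.e₂ (0, 0, t, y), N.β_e₂ 0 0 t y⟩
    have := LinearMap.finrank_range_of_inj hg
    rw [← hr] at this
    exact this.trans (by simp)
  βα := by
    let g : (Fin c → k) →ₗ[k] (Fin d₃ → k) :=
      N.e₃.toLinearMap ∘ₗ LinearMap.inr k _ _ ∘ₗ LinearMap.inr k _ _
    have hg : Function.Injective g :=
      N.e₃.injective.comp (LinearMap.inr_injective.comp LinearMap.inr_injective)
    have hr : LinearMap.range (Matrix.toLin' (V.β * V.α)) = LinearMap.range g := by
      rw [Matrix.toLin'_mul]
      apply le_antisymm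
      · rintro _ ⟨v, rfl⟩
        obtain ⟨⟨u, x, y⟩, rfl⟩ := N.e₁.surjective v
        exact ⟨y, by rw [LinearMap.comp_apply (Matrix.toLin' V.β), N.α_e₁, N.β_e₂]; rfl⟩
      · rintro _ ⟨y, rfl⟩
        exact ⟨N.e₁ (0, 0, y), by rw [LinearMap.comp_apply, N.α_e₁, N.β_e₂]; rfl⟩
    have := LinearMap.finrank_range_of_inj hg
    rw [← hr] at this
    exact this.trans (by simp)

end NormalForm

/-- The invertible matrix of an automorphism. -/
theorem exists_GL_eq {n : ℕ} (e : (Fin n → k) ≃ₗ[k] (Fin n → k)) :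
    ∃ g : GL (Fin n) k, Matrix.toLin' g.val = e.toLinearMap ∧
      Matrix.toLin' (g⁻¹).val = e.symm.toLinearMap := by
  refine ⟨⟨LinearMap.toMatrix' e.toLinearMap, LinearMap.toMatrix' e.symm.toLinearMap, ?_, ?_⟩,
    ?_, ?_⟩
  · rw [← LinearMap.toMatrix'_comp]; simp
  · rw [← LinearMap.toMatrix'_comp]; simp
  · simp
  · change Matrix.toLin' (LinearMap.toMatrix' e.symm.toLinearMap) = _
    simp

/-- Passing from the coordinates of one normal form to those of the other at each vertex gives the
required group element. -/
theorem NormalForm.mem_orbit (N : NormalForm a₁ a₂ a₃ b₁ b₂ c V)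
    (M : NormalForm a₁ a₂ a₃ b₁ b₂ c W) : W ∈ V.orbit := by
  obtain ⟨g₁, h₁, h₁'⟩ := exists_GL_eq (N.e₁.symm.trans M.e₁)
  obtain ⟨g₂, h₂, h₂'⟩ := exists_GL_eq (N.e₂.symm.trans M.e₂)
  obtain ⟨g₃, h₃, h₃'⟩ := exists_GL_eq (N.e₃.symm.trans M.e₃)
  refine ⟨g₁, g₂, g₃, RepSpace.ext ?_ ?_⟩
  · apply Matrix.toLin'.injective
    refine LinearMap.ext fun v => ?_
    obtain ⟨⟨u, x, y⟩, rfl⟩ := M.e₁.surjective v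
    rw [RepSpace.act, Matrix.toLin'_mul, Matrix.toLin'_mul, h₂, h₁', M.α_e₁]
    simp [-Matrix.toLin'_apply, N.α_e₁]
  · apply Matrix.toLin'.injective
    refine LinearMap.ext fun v => ?_
    obtain ⟨⟨s, x, t, y⟩, rfl⟩ := M.e₂.surjective v
    rw [RepSpace.act, Matrix.toLin'_mul, Matrix.toLin'_mul, h₃, h₂', M.β_e₂]
    simp [-Matrix.toLin'_apply, N.β_e₂]

theorem HasRanks.of_mem_orbit (h : HasRanks b₁ b₂ c V) (hW : W ∈ V.orbit) :
    HasRanks b₁ b₂ c W := by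
  obtain ⟨g₁, g₂, g₃, rfl⟩ := hW
  have hu {n : ℕ} (g : GL (Fin n) k) : IsUnit g.val.det :=
    (Matrix.isUnit_iff_isUnit_det _).1 g.isUnit
  refine ⟨?_, ?_, ?_⟩
  · rw [RepSpace.act, Matrix.rank_mul_eq_left_of_isUnit_det _ _ (hu _),
      Matrix.rank_mul_eq_right_of_isUnit_det _ _ (hu _), h.α]
  · rw [RepSpace.act, Matrix.rank_mul_eq_left_of_isUnit_det _ _ (hu _),
      Matrix.rank_mul_eq_right_of_isUnit_det _ _ (hu _), h.β]
  · have : (RepSpace.act g₁ g₂ g₃ V).β * (RepSpace.act g₁ g₂ g₃ V).α =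
        g₃.val * (V.β * V.α) * (g₁⁻¹).val := by
      have h2 : (g₂⁻¹).val * g₂.val = 1 := g₂.inv_mul
      calc g₃.val * V.β * (g₂⁻¹).val * (g₂.val * V.α * (g₁⁻¹).val) =
          g₃.val * V.β * ((g₂⁻¹).val * g₂.val) * V.α * (g₁⁻¹).val := by
            simp only [Matrix.mul_assoc]
        _ = _ := by rw [h2, Matrix.mul_one]; simp only [Matrix.mul_assoc]
    rw [this, Matrix.rank_mul_eq_left_of_isUnit_det _ _ (hu _),
      Matrix.rank_mul_eq_right_of_isUnit_det _ _ (hu _), h.βα]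

namespace HasRanks

theorem finrank_range_α (h : HasRanks b₁ b₂ c V) :
    Module.finrank k (LinearMap.range (Matrix.toLin' V.α)) = b₁ + c := h.α

theorem finrank_range_β (h : HasRanks b₁ b₂ c V) :
    Module.finrank k (LinearMap.range (Matrix.toLin' V.β)) = b₂ + c := h.β

theorem finrank_range_βα (h : HasRanks b₁ b₂ c V) :
    Module.finrank k (LinearMap.range (Matrix.toLin' V.β ∘ₗ Matrix.toLin' V.α)) = c := by
  rw [← Matrix.toLin'_mul]; exact h.βα

/-- The preimage of $\operatorname{Im}\beta\alpha$ contains $\ker\beta$, of dimension $d_2-b_2-c$,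
and maps onto $\operatorname{Im}\beta\alpha$, of dimension $c$. This is why $R_2$ has dimension
$d_2-b_2$. -/
theorem finrank_comap (h : HasRanks b₁ b₂ c V) :
    Module.finrank k ((LinearMap.range (Matrix.toLin' V.β ∘ₗ Matrix.toLin' V.α)).comap
      (Matrix.toLin' V.β)) + b₂ = d₂ := by
  have h1 := finrank_map_add_finrank_inf_ker (Matrix.toLin' V.β)
    ((LinearMap.range (Matrix.toLin' V.β ∘ₗ Matrix.toLin' V.α)).comap (Matrix.toLin' V.β))
  rw [Submodule.map_comap_eq, inf_eq_right.2 (LinearMap.range_comp_le_range _ _),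
    h.finrank_range_βα, inf_eq_right.2 (LinearMap.ker_le_comap _)] at h1
  have h2 := LinearMap.finrank_range_add_finrank_ker (Matrix.toLin' V.β)
  rw [h.finrank_range_β, Module.finrank_fin_fun] at h2
  omega

/-- Complements of the natural subspaces have dimensions fixed by the three ranks, and assembling
them at each vertex splits the representation into indecomposables. -/
theorem nonempty_normalForm (h : HasRanks b₁ b₂ c V) (hd₁ : d₁ = a₁ + b₁ + c)
    (hd₂ : d₂ = a₂ + b₁ + b₂ + c) (hd₃ : d₃ = a₃ + b₂ + c) :
    Nonempty (NormalForm a₁ a₂ a₃ b₁ b₂ c V) := by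
  have hα := h.finrank_range_α
  have hβ := h.finrank_range_β
  have hβα := h.finrank_range_βα
  have hcomap := h.finrank_comap
  set α := Matrix.toLin' V.α
  set β := Matrix.toLin' V.β
  have kα := LinearMap.finrank_range_add_finrank_ker α
  have kβ := LinearMap.finrank_range_add_finrank_ker β
  have kβα := LinearMap.finrank_range_add_finrank_ker (β ∘ₗ α)
  rw [Module.finrank_fin_fun] at kα kβ kβα
  have kαβ := finrank_map_add_finrank_inf_ker β (LinearMap.range α)
  rw [← LinearMap.range_comp] at kαβ
  -- `Y` is a complement of $\ker\beta\alpha$, `X` one of $\ker\alpha$ in $\ker\beta\alpha$, `U` is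
  -- $\ker\alpha$, `S` a complement of $\ker\beta\cap\operatorname{Im}\alpha$ in $\ker\beta$, `T`
  -- one of $\beta^{-1}(\operatorname{Im}\beta\alpha)$, and `Z` one of $\operatorname{Im}\beta$.
  -- They generate the copies of $I_3,I_2,S_1,S_2,P_2,S_3$ respectively.
  obtain ⟨Y, -, hY⟩ := exists_injective_comp (ρ := c) (β ∘ₗ α) ⊤ (by
    rw [top_inf_eq, finrank_top, Module.finrank_fin_fun]; omega)
  obtain ⟨X, hXp, hX⟩ := exists_injective_comp (ρ := b₁) α (LinearMap.ker (β ∘ₗ α)) (by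
    rw [inf_eq_right.2 (LinearMap.ker_le_ker_comp _ _)]; omega)
  obtain ⟨U, hUp, hU⟩ := exists_injective_comp (ρ := a₁) LinearMap.id (LinearMap.ker α) (by
    rw [LinearMap.ker_id, inf_bot_eq, finrank_bot]; omega)
  obtain ⟨S, hSp, hS⟩ := exists_injective_comp (ρ := a₂) (LinearMap.range α).mkQ
    (LinearMap.ker β) (by
      rw [Submodule.ker_mkQ, inf_comm]; omega)
  obtain ⟨T, -, hT⟩ := exists_injective_comp (ρ := b₂) ((LinearMap.range (β ∘ₗ α)).mkQ ∘ₗ β) ⊤ (by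
    rw [top_inf_eq, finrank_top, Module.finrank_fin_fun, LinearMap.ker_comp, Submodule.ker_mkQ]
    omega)
  obtain ⟨Z, -, hZ⟩ := exists_injective_comp (ρ := a₃) (LinearMap.range β).mkQ ⊤ (by
    rw [top_inf_eq, finrank_top, Module.finrank_fin_fun, Submodule.ker_mkQ]; omega)
  simp only [LinearMap.mem_ker, LinearMap.comp_apply, Submodule.mkQ_apply,
    Submodule.Quotient.mk_eq_zero, LinearMap.id_apply] at hY hXp hX hUp hU hSp hS hT hZ
  let E₁ : ((Fin a₁ → k) × (Fin b₁ → k) × (Fin c → k)) →ₗ[k] (Fin d₁ → k) :=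
    LinearMap.coprod U (LinearMap.coprod X Y)
  let E₂ : ((Fin a₂ → k) × (Fin b₁ → k) × (Fin b₂ → k) × (Fin c → k)) →ₗ[k] (Fin d₂ → k) :=
    LinearMap.coprod S (LinearMap.coprod (α ∘ₗ X) (LinearMap.coprod T (α ∘ₗ Y)))
  let E₃ : ((Fin a₃ → k) × (Fin b₂ → k) × (Fin c → k)) →ₗ[k] (Fin d₃ → k) :=
    LinearMap.coprod Z (LinearMap.coprod (β ∘ₗ T) (β ∘ₗ α ∘ₗ Y))
  have hE₁ : Function.Injective E₁ := by
    rw [injective_iff_map_eq_zero]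
    rintro ⟨u, x, y⟩ hz
    change U u + (X x + Y y) = 0 at hz
    have h1 := congrArg (fun z => β (α z)) hz
    simp only [map_add, hUp, map_zero, hXp, zero_add] at h1
    obtain rfl := hY _ h1
    have h2 := congrArg α hz
    simp only [map_add, hUp, map_zero, zero_add, add_zero] at h2
    obtain rfl := hX _ h2
    simp only [map_zero, add_zero] at hz
    obtain rfl := hU _ hz
    rfl
  have hβTY (t : Fin b₂ → k) (y : Fin c → k) (hz : β (T t) + β (α (Y y)) = 0) :
      t = 0 ∧ y = 0 := by
    obtain rfl := hT t ⟨-Y y, by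
      rw [map_neg, LinearMap.comp_apply]; exact (eq_neg_of_add_eq_zero_left hz).symm⟩
    simp only [map_zero, zero_add] at hz
    exact ⟨rfl, hY _ hz⟩
  have hE₂ : Function.Injective E₂ := by
    rw [injective_iff_map_eq_zero]
    rintro ⟨s, x, t, y⟩ hz
    change S s + (α (X x) + (T t + α (Y y))) = 0 at hz
    have h1 := congrArg β hz
    simp only [map_add, hSp, map_zero, hXp, zero_add] at h1
    obtain ⟨rfl, rfl⟩ := hβTY t y h1
    simp only [map_zero, add_zero] at hz
    obtain rfl := hS s ⟨-X x, by
      rw [map_neg]; exact (eq_neg_of_add_eq_zero_left hz).symm⟩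
    simp only [map_zero, zero_add] at hz
    obtain rfl := hX _ hz
    rfl
  have hE₃ : Function.Injective E₃ := by
    rw [injective_iff_map_eq_zero]
    rintro ⟨z, t, y⟩ hz
    change Z z + (β (T t) + β (α (Y y))) = 0 at hz
    obtain rfl := hZ z ⟨-(T t + α (Y y)), by
      rw [map_neg, map_add]; exact (eq_neg_of_add_eq_zero_left hz).symm⟩
    simp only [map_zero, zero_add] at hz
    obtain ⟨rfl, rfl⟩ := hβTY t y hz
    rfl
  refine ⟨⟨LinearEquiv.ofInjectiveOfFinrankEq E₁ hE₁ (by simp; omega),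
    LinearEquiv.ofInjectiveOfFinrankEq E₂ hE₂ (by simp; omega),
    LinearEquiv.ofInjectiveOfFinrankEq E₃ hE₃ (by simp; omega), fun u x y => ?_,
    fun s x t y => ?_⟩⟩
  · change α (U u + (X x + Y y)) = S 0 + (α (X x) + (T 0 + α (Y y)))
    simp only [map_add, hUp, map_zero, zero_add]
  · change β (S s + (α (X x) + (T t + α (Y y)))) = Z 0 + (β (T t) + β (α (Y y)))
    simp only [map_add, hSp, hXp, map_zero, zero_add]

end HasRanks

/-- Ranks are invariant under the group, and together with the dimension vector they produce a
normal form with the same multiplicities. -/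
theorem NormalForm.mem_orbit_iff (N : NormalForm a₁ a₂ a₃ b₁ b₂ c V) :
    W ∈ V.orbit ↔ HasRanks b₁ b₂ c W := by
  refine ⟨N.hasRanks.of_mem_orbit, fun h => ?_⟩
  obtain ⟨M⟩ := h.nonempty_normalForm N.dim₁ N.dim₂ N.dim₃
  exact N.mem_orbit M

/-- A subspace as a point of the Grassmannian. -/
def Gr.ofFinrank {n r : ℕ} (N : Submodule k (Fin n → k)) (h : Module.finrank k N = r) :
    Gr k r n where
  sub := N
  projective_quotient := inferInstance
  rank_eq p := by
    rw [Module.rankAtStalk_eq_finrank_of_free, ← h]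
    rfl

/-- The points of the orbit lie under incidence points. -/
theorem HasRanks.exists_incidencePoint (h : HasRanks b₁ b₂ c V) :
    ∃ P : IncidencePoint k d₁ d₂ d₃ (b₁ + c) (d₂ - b₂) c, P.V = V := by
  have h1 := h.finrank_comap
  -- Take $R_1=\operatorname{Im}\alpha$, $R_2=\beta^{-1}(\operatorname{Im}\beta\alpha)$ and
  -- $R=\operatorname{Im}\beta\alpha$.
  refine ⟨⟨V, ⟨Gr.ofFinrank _ h.finrank_range_α, Gr.ofFinrank
    ((LinearMap.range (Matrix.toLin' V.β ∘ₗ Matrix.toLin' V.α)).comap (Matrix.toLin' V.β))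
      (by omega), ?_⟩,
    Gr.ofFinrank _ h.finrank_range_βα, le_rfl, Submodule.map_comap_le _ _⟩, rfl⟩
  rintro _ ⟨v, rfl⟩
  exact ⟨v, rfl⟩

end Normal

end EquiA3

end

noncomputable section

namespace EquiA3

/-! ### The locus where the flags are determined by the representation -/

theorem rankAtStalk_fin_fun {A : Type u} [CommRing A] (n : ℕ) (p : PrimeSpectrum A) :
    Module.rankAtStalk (Fin n → A) p = n := by
  have := p.nontrivial
  rw [Module.rankAtStalk_eq_finrank_of_free]
  simp

/-- A direct summand of rank `r` in `A ^ (r + b)` is the kernel of any surjection to `A ^ b`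
vanishing on it. -/
theorem Gr.eq_ker {A : Type u} [CommRing A] {r b n : ℕ} (N : Gr A r n) (hn : n = r + b)
    (g : (Fin n → A) →ₗ[A] (Fin b → A)) (hN : N.sub ≤ LinearMap.ker g)
    (hg : Function.Surjective g) : N.sub = LinearMap.ker g := by
  obtain ⟨π, hπ⟩ := exists_projection N.sub
  have hπ' (v : N.sub) : π v = v := LinearMap.congr_fun hπ v
  -- The pair `(π, g)` is a surjection between projective modules of the same rank, hence injective;
  -- a vector killed by `g` thus coincides with its projection to `N`.
  have hs : Function.Surjective (π.prod g) := by
    rintro ⟨w, t⟩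
    obtain ⟨v, rfl⟩ := hg t
    refine ⟨v - π v + w, Prod.ext ?_ ?_⟩
    · simp [hπ']
    · have h1 : g (π v).1 = 0 := hN (π v).2
      have h2 : g w.1 = 0 := hN w.2
      simp [h1, h2]
  have hi := injective_of_surjective_of_rankAtStalk_eq (by
    ext p
    rw [Module.rankAtStalk_prod, Pi.add_apply, N.rank_eq, rankAtStalk_fin_fun,
      rankAtStalk_fin_fun, hn]) (π.prod g) hs
  refine le_antisymm hN fun v hv => ?_
  have h1 : g v = 0 := hv
  have h2 : g (π v).1 = 0 := hN (π v).2
  have : v = π v := hi (Prod.ext (by simp [hπ']) (by simp [h1, h2]))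
  rw [this]
  exact (π v).2

/-- Base change of a pair of matrices. -/
def RepSpace.map {A B : Type u} [CommRing A] [CommRing B] {d₁ d₂ d₃ : ℕ} (f : A →+* B)
    (W : RepSpace A d₁ d₂ d₃) : RepSpace B d₁ d₂ d₃ :=
  ⟨W.α.map f, W.β.map f⟩

/-- Matrices selecting a minor of each of the maps `α`, `β ∘ α` and `coker α → coker (β ∘ α)`. -/
structure MinorChoice (A : Type u) (d₁ d₂ d₃ r₁ b c : ℕ) where
  P₁ : Matrix (Fin r₁) (Fin d₂) A
  Q₁ : Matrix (Fin d₁) (Fin r₁) A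
  P₂ : Matrix (Fin b) (Fin d₃) A
  Q₂ : Matrix (Fin d₂) (Fin b) A
  P₃ : Matrix (Fin c) (Fin d₃) A
  Q₃ : Matrix (Fin d₁) (Fin c) A

namespace MinorChoice

variable {A B : Type u} [CommRing A] [CommRing B] {d₁ d₂ d₃ r₁ b c : ℕ}
  (D : MinorChoice A d₁ d₂ d₃ r₁ b c) (W : RepSpace A d₁ d₂ d₃)

/-- Base change of a choice of minors. -/
def map (f : A →+* B) : MinorChoice B d₁ d₂ d₃ r₁ b c :=
  ⟨D.P₁.map f, D.Q₁.map f, D.P₂.map f, D.Q₂.map f, D.P₃.map f, D.Q₃.map f⟩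

/-- The selected part of `β ∘ α`. -/
def mid : Matrix (Fin c) (Fin c) A := D.P₃ * (W.β * W.α * D.Q₃)

/-- A map that factors through `β` and kills the preimage of the range of `β ∘ α`, whenever the
minor of `β ∘ α` is invertible. -/
def cokerMap : Matrix (Fin b) (Fin d₂) A :=
  ((D.mid W).det • D.P₂ - D.P₂ * (W.β * W.α * D.Q₃) * ((D.mid W).adjugate * D.P₃)) * W.β

/-- The product of the three minors. -/
def discr : A :=
  (D.P₁ * (W.α * D.Q₁)).det * ((D.mid W).det * (D.cokerMap W * D.Q₂).det)

theorem mid_map (f : A →+* B) : (D.mid W).map f = (D.map f).mid (W.map f) := by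
  simp only [mid, Matrix.map_mul, map, RepSpace.map]

theorem cokerMap_map (f : A →+* B) : (D.cokerMap W).map f = (D.map f).cokerMap (W.map f) := by
  have h1 : ((D.mid W).det • D.P₂).map f = ((D.map f).mid (W.map f)).det • D.P₂.map f := by
    rw [← mid_map, det_map_ringHom]
    ext i j
    simp
  have h2 : (D.mid W).adjugate.map f = ((D.map f).mid (W.map f)).adjugate := by
    rw [← mid_map]
    exact f.map_adjugate _
  rw [cokerMap, Matrix.map_mul, Matrix.map_sub _ (map_sub f), h1, Matrix.map_mul, Matrix.map_mul,
    Matrix.map_mul, Matrix.map_mul, Matrix.map_mul, h2]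
  rfl

theorem discr_map (f : A →+* B) : f (D.discr W) = (D.map f).discr (W.map f) := by
  rw [discr, map_mul, map_mul, ← det_map_ringHom, ← det_map_ringHom, ← det_map_ringHom, mid_map,
    Matrix.map_mul, Matrix.map_mul, Matrix.map_mul, cokerMap_map]
  rfl

variable {D} {r₂ : ℕ} {P : IncidencePoint A d₁ d₂ d₃ r₁ r₂ c}

/-- An invertible minor makes the range of $\alpha$ map onto a free module whose rank is that of
$R_1$, so the range fills $R_1$. -/
theorem R₁_eq (h : IsUnit (D.discr P.V)) :
    P.F.R₁.sub = LinearMap.range (Matrix.toLin' P.V.α) := by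
  have h1 := ((onto_range_iff _ _).2 (isUnit_of_mul_isUnit_left h)).mono (range_mul_le _ _)
  exact P.F.R₁.eq_of_le_of_map_eq_top _ P.range_le h1

theorem range_βα_le (P : IncidencePoint A d₁ d₂ d₃ r₁ r₂ c) :
    LinearMap.range (Matrix.toLin' (P.V.β * P.V.α)) ≤ P.R.sub := by
  rw [Matrix.toLin'_mul, LinearMap.range_comp]
  exact (Submodule.map_mono (P.range_le.trans P.F.le)).trans P.map_le

theorem R_eq_range_mul (h : IsUnit (D.discr P.V)) :
    P.R.sub = LinearMap.range (Matrix.toLin' (P.V.β * P.V.α * D.Q₃)) := by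
  have h1 := (onto_range_iff _ _).2 (isUnit_of_mul_isUnit_left (isUnit_of_mul_isUnit_right h))
  exact P.R.eq_of_le_of_map_eq_top _ ((range_mul_le _ _).trans (range_βα_le P)) h1

theorem R_eq (h : IsUnit (D.discr P.V)) :
    P.R.sub = LinearMap.range (Matrix.toLin' (P.V.β * P.V.α)) :=
  le_antisymm ((R_eq_range_mul h).le.trans (range_mul_le _ _)) (range_βα_le P)

/-- `cokerMap` is $\beta$ followed by a matrix killing $R$, so it kills $R_2$; its own minor is
invertible, so it is onto. A summand of complementary rank contained in its kernel must be the
kernel. -/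
theorem R₂_eq (h : IsUnit (D.discr P.V)) (hd₂ : d₂ = r₂ + b) :
    P.F.R₂.sub = LinearMap.ker (Matrix.toLin' (D.cokerMap P.V)) := by
  refine P.F.R₂.eq_ker hd₂ _ (fun v hv => ?_) ?_
  · obtain ⟨w, hw⟩ := R_eq_range_mul h ▸ P.map_le ⟨v, hv, rfl⟩
    -- With `M` for the columns spanning $R$ and `m = P₃ * M`, the identity `adjugate m * m = det m`
    -- makes the correction term cancel. The adjugate replaces an inverse so that the expression is
    -- polynomial.
    have key : (D.mid P.V).det • D.P₂ * (P.V.β * P.V.α * D.Q₃) -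
        D.P₂ * (P.V.β * P.V.α * D.Q₃) * ((D.mid P.V).adjugate * D.P₃) *
          (P.V.β * P.V.α * D.Q₃) = 0 := by
      rw [Matrix.mul_assoc (D.P₂ * _), Matrix.mul_assoc _ D.P₃,
        show D.P₃ * (P.V.β * P.V.α * D.Q₃) = D.mid P.V from rfl, Matrix.adjugate_mul,
        Matrix.mul_smul, Matrix.mul_one, Matrix.smul_mul, sub_self]
    rw [LinearMap.mem_ker, cokerMap, Matrix.toLin'_mul, LinearMap.comp_apply, ← hw,
      ← LinearMap.comp_apply, ← Matrix.toLin'_mul, Matrix.sub_mul, key, map_zero,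
      LinearMap.zero_apply]
  · have h1 := (range_eq_top_iff_isUnit_det _).2
      (isUnit_of_mul_isUnit_right (isUnit_of_mul_isUnit_right h))
    rw [← LinearMap.range_eq_top]
    exact top_le_iff.1 (h1.ge.trans (range_mul_le _ _))

/-- On the locus where the minors are invertible, an incidence point is determined by the
underlying representation. -/
theorem incidencePoint_ext {P' : IncidencePoint A d₁ d₂ d₃ r₁ r₂ c} (h : IsUnit (D.discr P.V))
    (hd₂ : d₂ = r₂ + b) (hV : P.V = P'.V) : P = P' := by
  have h' : IsUnit (D.discr P'.V) := hV ▸ h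
  exact IncidencePoint.ext_of_eq (by rw [hV]) (by rw [hV]) (by rw [R₁_eq h, R₁_eq h', hV])
    (by rw [R₂_eq h hd₂, R₂_eq h' hd₂, hV]) (by rw [R_eq h, R_eq h', hV])

end MinorChoice

/-! ### The minors over a field: ranks and existence -/

section Field

variable {k : Type u} [Field k] {d₁ d₂ d₃ b₁ b c r₂ : ℕ}

/-- Over a field, the invertibility of the minors at an incidence point determines the ranks. -/
theorem MinorChoice.hasRanks {D : MinorChoice k d₁ d₂ d₃ (b₁ + c) b c}
    {P : IncidencePoint k d₁ d₂ d₃ (b₁ + c) r₂ c} (h : D.discr P.V ≠ 0) (hd₂ : d₂ = r₂ + b) :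
    HasRanks b₁ b c P.V := by
  have hu : IsUnit (D.discr P.V) := h.isUnit
  have hα := P.F.R₁.finrank_sub
  have hR := P.R.finrank_sub
  have hR₂ := P.F.R₂.finrank_sub
  -- The rank of $\beta$ comes from $R_2$: it contains $\ker\beta$ and maps onto $R$, so
  -- $\dim\ker\beta=r_2-c$.
  have hmap : P.F.R₂.sub.map (Matrix.toLin' P.V.β) = P.R.sub := by
    refine le_antisymm P.map_le ?_
    rw [R_eq hu, Matrix.toLin'_mul, LinearMap.range_comp]
    exact Submodule.map_mono (P.range_le.trans P.F.le)
  have hker : LinearMap.ker (Matrix.toLin' P.V.β) ≤ P.F.R₂.sub := by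
    rw [R₂_eq hu hd₂, cokerMap, Matrix.toLin'_mul]
    exact LinearMap.ker_le_ker_comp _ _
  have h1 := finrank_map_add_finrank_inf_ker (Matrix.toLin' P.V.β) P.F.R₂.sub
  rw [hmap, hR, hR₂, inf_eq_right.2 hker] at h1
  have h2 := LinearMap.finrank_range_add_finrank_ker (Matrix.toLin' P.V.β)
  rw [Module.finrank_fin_fun] at h2
  refine ⟨?_, ?_, ?_⟩
  · rw [R₁_eq hu] at hα
    exact hα
  · change Module.finrank k (LinearMap.range (Matrix.toLin' P.V.β)) = _
    omega
  · rw [R_eq hu] at hR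
    exact hR

/-- The columns of `Q` span a complement of the kernel of `g ∘ M`, and `P` is a left inverse of the
resulting injective map. This selects a minor equal to the identity. -/
theorem exists_mul_mul_eq_one {m n ρ : ℕ} (M : Matrix (Fin m) (Fin n) k)
    {F : Type*} [AddCommGroup F] [Module k F] (g : (Fin m → k) →ₗ[k] F)
    (h : n = Module.finrank k (LinearMap.ker (g ∘ₗ Matrix.toLin' M)) + ρ) :
    ∃ (P : F →ₗ[k] (Fin ρ → k)) (Q : Matrix (Fin n) (Fin ρ) k),
      LinearMap.toMatrix' (P ∘ₗ g) * (M * Q) = 1 := by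
  obtain ⟨y, -, hy⟩ := exists_injective_comp (g ∘ₗ Matrix.toLin' M) ⊤ (ρ := ρ) (by
    rw [top_inf_eq, finrank_top, Module.finrank_fin_fun]; exact h)
  obtain ⟨P, hP⟩ := (g ∘ₗ Matrix.toLin' M ∘ₗ y).exists_leftInverse_of_injective
    (LinearMap.ker_eq_bot'.2 hy)
  refine ⟨P, LinearMap.toMatrix' y, ?_⟩
  apply Matrix.toLin'.injective
  rw [Matrix.toLin'_mul, Matrix.toLin'_mul, Matrix.toLin'_toMatrix', Matrix.toLin'_toMatrix',
    Matrix.toLin'_one]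
  exact hP

theorem HasRanks.exists_minorChoice {V : RepSpace k d₁ d₂ d₃} (h : HasRanks b₁ b c V) :
    ∃ D : MinorChoice k d₁ d₂ d₃ (b₁ + c) b c, D.discr V ≠ 0 := by
  have kα := LinearMap.finrank_range_add_finrank_ker (Matrix.toLin' V.α)
  have kβα := LinearMap.finrank_range_add_finrank_ker (Matrix.toLin' V.β ∘ₗ Matrix.toLin' V.α)
  rw [Module.finrank_fin_fun, h.finrank_range_α] at kα
  rw [Module.finrank_fin_fun, h.finrank_range_βα] at kβα
  have hcomap := h.finrank_comap
  obtain ⟨p₁, Q₁, h₁⟩ := exists_mul_mul_eq_one (ρ := b₁ + c) V.α LinearMap.id (by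
    rw [LinearMap.id_comp]; omega)
  obtain ⟨p₃, Q₃, h₃⟩ := exists_mul_mul_eq_one (ρ := c) (V.β * V.α) LinearMap.id (by
    rw [LinearMap.id_comp, Matrix.toLin'_mul]; omega)
  obtain ⟨p₂, Q₂, h₂⟩ := exists_mul_mul_eq_one (ρ := b) V.β
    (LinearMap.range (Matrix.toLin' V.β ∘ₗ Matrix.toLin' V.α)).mkQ (by
      rw [LinearMap.ker_comp, Submodule.ker_mkQ]; omega)
  -- The second row selection factors through the cokernel of $\beta\alpha$, so the correction term
  -- in `cokerMap` vanishes at `V` and all three minors become identity matrices.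
  have h0 : LinearMap.toMatrix' (p₂ ∘ₗ
      (LinearMap.range (Matrix.toLin' V.β ∘ₗ Matrix.toLin' V.α)).mkQ) * (V.β * V.α) = 0 := by
    apply Matrix.toLin'.injective
    rw [Matrix.toLin'_mul, Matrix.toLin'_mul, Matrix.toLin'_toMatrix', LinearMap.comp_assoc,
      LinearMap.range_mkQ_comp, LinearMap.comp_zero, map_zero]
  refine ⟨⟨LinearMap.toMatrix' (p₁ ∘ₗ LinearMap.id), Q₁, LinearMap.toMatrix' (p₂ ∘ₗ
    (LinearMap.range (Matrix.toLin' V.β ∘ₗ Matrix.toLin' V.α)).mkQ), Q₂,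
    LinearMap.toMatrix' (p₃ ∘ₗ LinearMap.id), Q₃⟩, ?_⟩
  rw [MinorChoice.discr, MinorChoice.cokerMap, MinorChoice.mid]
  dsimp only
  rw [h₁, h₃, ← Matrix.mul_assoc _ (V.β * V.α), h0, Matrix.zero_mul, Matrix.zero_mul, sub_zero,
    Matrix.det_one, Matrix.det_one, one_smul, Matrix.mul_assoc, h₂]
  simp

end Field

end EquiA3

end

noncomputable section

namespace EquiA3

/-! ### The resolution -/

section Generic

variable {k : Type u} [Field k] {d₁ d₂ d₃ : ℕ}

variable (k d₁ d₂ d₃) in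
/-- The generic pair of matrices. -/
def RepSpace.generic : RepSpace (MvPolynomial (Coord d₁ d₂ d₃) k) d₁ d₂ d₃ :=
  ⟨Matrix.of fun i j => MvPolynomial.X (.inl (i, j)),
    Matrix.of fun i j => MvPolynomial.X (.inr (i, j))⟩

theorem RepSpace.generic_map {A : Type u} [CommRing A] (κ : k →+* A) (W : RepSpace A d₁ d₂ d₃) :
    (RepSpace.generic k d₁ d₂ d₃).map (W.evalHom κ) = W := by
  apply RepSpace.ext
  · ext i j
    simp [RepSpace.map, RepSpace.generic, RepSpace.evalHom, RepSpace.coords]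
  · ext i j
    simp [RepSpace.map, RepSpace.generic, RepSpace.evalHom, RepSpace.coords]

/-- The product of the minors, as a polynomial function on the representation space. -/
def MinorChoice.poly {r₁ b c : ℕ} (D : MinorChoice k d₁ d₂ d₃ r₁ b c) :
    MvPolynomial (Coord d₁ d₂ d₃) k :=
  (D.map MvPolynomial.C).discr (RepSpace.generic k d₁ d₂ d₃)

theorem MinorChoice.evalHom_poly {r₁ b c : ℕ} (D : MinorChoice k d₁ d₂ d₃ r₁ b c)
    {A : Type u} [CommRing A] (κ : k →+* A) (W : RepSpace A d₁ d₂ d₃) :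
    W.evalHom κ D.poly = (D.map κ).discr W := by
  rw [poly, discr_map, RepSpace.generic_map]
  congr 1
  have h : (W.evalHom κ) ∘ MvPolynomial.C = κ := by
    ext a
    simp [RepSpace.evalHom]
  simp only [MinorChoice.map, Matrix.map_map, h]

theorem mem_orbitIdeal_iff {V : RepSpace k d₁ d₂ d₃} {f : MvPolynomial (Coord d₁ d₂ d₃) k} :
    f ∈ orbitIdeal V ↔ ∀ W ∈ V.orbit, W.evalHom (RingHom.id k) f = 0 := by
  rw [orbitIdeal, MvPolynomial.mem_vanishingIdeal_iff]
  exact Set.forall_mem_image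

theorem isReduced_orbitClosure (V : RepSpace k d₁ d₂ d₃) : IsReduced (orbitClosure V) := by
  have h : (orbitIdeal V).IsRadical := by
    rintro f ⟨n, hn⟩
    rw [mem_orbitIdeal_iff] at hn ⊢
    intro W hW
    have := hn W hW
    rw [map_pow] at this
    exact eq_zero_of_pow_eq_zero this
  have h2 : _root_.IsReduced (MvPolynomial (Coord d₁ d₂ d₃) k ⧸ orbitIdeal V) :=
    (Ideal.isRadical_iff_quotient_reduced _).1 h
  exact inferInstanceAs (IsReduced (Spec (CommRingCat.of
    (MvPolynomial (Coord d₁ d₂ d₃) k ⧸ orbitIdeal V))))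

end Generic

/-- A function on an integral scheme that vanishes on a nonempty open subscheme is zero. -/
theorem eq_zero_of_appTop_eq_zero {X Y : Scheme.{u}} [IsIntegral Y] [Nonempty X] (j : X ⟶ Y)
    [IsOpenImmersion j] {s : Γ(Y, ⊤)} (h : j.appTop s = 0) : s = 0 := by
  rw [← AlgebraicGeometry.basicOpen_eq_bot_iff]
  by_contra hne
  obtain ⟨y, hy⟩ : (Y.basicOpen s : Set Y).Nonempty := by
    rw [Set.nonempty_iff_ne_empty]
    exact fun h0 => hne (TopologicalSpace.Opens.ext h0)
  obtain ⟨z, hz, x, rfl⟩ := nonempty_preirreducible_inter (Y.basicOpen s).2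
    j.isOpenEmbedding.isOpen_range ⟨y, hy⟩ (Set.range_nonempty j)
  have h1 : x ∈ j ⁻¹ᵁ Y.basicOpen s := hz
  rw [Scheme.preimage_basicOpen_top, h, Scheme.basicOpen_zero] at h1
  exact h1

/-- The point of the orbit closure given by a homomorphism from its coordinate ring. -/
def orbitClosurePoint {k : Type u} [Field k] {d₁ d₂ d₃ : ℕ} (V : RepSpace k d₁ d₂ d₃) {A : Type u}
    [CommRing A] (θ : MvPolynomial (Coord d₁ d₂ d₃) k ⧸ orbitIdeal V →+* A) :
    Spec (CommRingCat.of A) ⟶ orbitClosure V :=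
  specMap θ

theorem comp_ι_comp {X Y T : Scheme.{u}} (q : X ⟶ Y) (U : Y.Opens) (a : T ⟶ q ⁻¹ᵁ U) :
    (a ≫ (q ⁻¹ᵁ U).ι) ≫ q = (a ≫ q ∣_ U) ≫ U.ι := by
  rw [Category.assoc, Category.assoc, morphismRestrict_ι]

/-! ### The projection to the orbit closure -/

section Main

variable {k : Type u} [Field k] {d₁ d₂ d₃ a₁ a₂ a₃ b₁ b₂ c r₂ : ℕ}
  {V : RepSpace k d₁ d₂ d₃} (N : NormalForm a₁ a₂ a₃ b₁ b₂ c V)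
  (hd₂ : d₂ = r₂ + b₂) (hr₂ : r₂ = (b₁ + c) + a₂) (hd₃ : d₃ = c + (a₃ + b₂))

include N in
theorem exists_incidencePoint_of_mem_orbit {W : RepSpace k d₁ d₂ d₃} (hd₂ : d₂ = r₂ + b₂)
    (hW : W ∈ V.orbit) : ∃ P : IncidencePoint k d₁ d₂ d₃ (b₁ + c) r₂ c, P.V = W := by
  obtain rfl : r₂ = d₂ - b₂ := by omega
  exact (N.mem_orbit_iff.1 hW).exists_incidencePoint

include N in
-- This is why $q$ lands in the orbit closure. Multiplying by the discriminant removes all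
-- $k$-points of a chart that do not lie over the orbit, and the discriminant is then cancelled in a
-- polynomial ring.
theorem globalHom_incToRep_eq_zero [CharZero k] {f : MvPolynomial (Coord d₁ d₂ d₃) k}
    (hf : f ∈ orbitIdeal V) :
    ChartCover.globalHom (A := MvPolynomial (Coord d₁ d₂ d₃) k)
      (incToRep k d₁ hd₂ hr₂ hd₃) f = 0 := by
  obtain ⟨D, hD⟩ := N.hasRanks.exists_minorChoice
  obtain ⟨P, hP⟩ := exists_incidencePoint_of_mem_orbit N hd₂ (N.mem_orbit N)
  -- The only prime of `k` is `⊥` and `f₀` is a unit, so the incidence point over `V` itself has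
  -- coordinates `x₀` on the chart `w`.
  obtain ⟨f₀, hf₀, w, hw⟩ := exists_chartIndex hd₂ hr₂ hd₃ P ⊥
  obtain ⟨x₀, hx₀⟩ := hw k (RingHom.id k) (isUnit_iff_ne_zero.2 hf₀)
  rw [IncidencePoint.map_id] at hx₀
  let S := MvPolynomial (ChartCoord d₁ d₃ (b₁ + c) a₂ r₂ b₂ c (a₃ + b₂)) k
  let ev : MvPolynomial (Coord d₁ d₂ d₃) k →+* S :=
    (w.incidencePoint MvPolynomial.X).V.evalHom MvPolynomial.C
  have hev (x : ChartCoord d₁ d₃ (b₁ + c) a₂ r₂ b₂ c (a₃ + b₂) → k) :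
      (MvPolynomial.eval x).comp ev = (w.incidencePoint x).V.evalHom (RingHom.id k) := by
    have h1 := w.incidencePoint_map (MvPolynomial.eval x) (MvPolynomial.X (R := k))
    have h2 : (MvPolynomial.eval x) ∘ MvPolynomial.X = x := by ext; simp
    rw [h2] at h1
    rw [RepSpace.comp_evalHom, ← h1]
    congr 1
    ext a
    simp
  have hid : D.map (RingHom.id k) = D := rfl
  have hzero : ev (f * D.poly) = 0 := by
    -- As `k` is infinite, values at $k$-points suffice. At such a point either the discriminant
    -- vanishes, or the ranks are those of `V` and `f` vanishes.
    apply MvPolynomial.funext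
    intro x
    have hx := RingHom.congr_fun (hev x) (f * D.poly)
    rw [RingHom.comp_apply] at hx
    rw [hx, map_zero, map_mul]
    by_cases h0 : D.discr (w.incidencePoint x).V = 0
    · rw [D.evalHom_poly, hid, h0, mul_zero]
    · rw [mem_orbitIdeal_iff.1 hf _ (N.mem_orbit_iff.2 (MinorChoice.hasRanks h0 hd₂)), zero_mul]
  have hne : ev D.poly ≠ 0 := by
    intro h0
    have := RingHom.congr_fun (hev x₀) D.poly
    rw [RingHom.comp_apply, h0, map_zero, D.evalHom_poly, hid, hx₀, hP] at this
    exact hD this.symm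
  have hevf : ev f = 0 := by
    rw [map_mul] at hzero
    exact (mul_eq_zero.1 hzero).resolve_right hne
  -- The incidence variety is integral, so vanishing on the single chart `w` is enough.
  refine eq_zero_of_appTop_eq_zero (incChart hd₂ hr₂ hd₃ w) ?_
  have h1 := ChartCover.globalHom_comp (A := MvPolynomial (Coord d₁ d₂ d₃) k)
    (incChart hd₂ hr₂ hd₃ w) (incToRep k d₁ hd₂ hr₂ hd₃)
  refine (RingHom.congr_fun h1 f).symm.trans ?_
  have h2 := comp_incToRep hd₂ hr₂ hd₃ (incChart (k := k) (d₁ := d₁) hd₂ hr₂ hd₃ w)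
  rw [incPoint_incChart] at h2
  have h3 : ChartCover.globalHom (A := MvPolynomial (Coord d₁ d₂ d₃) k)
      (incChart hd₂ hr₂ hd₃ w ≫ incToRep k d₁ hd₂ hr₂ hd₃) =
      (ChartCover.globalHom (𝟙 (Spec (CommRingCat.of S)))).comp ev := by
    rw [← ChartCover.globalHom_comp_specMap, Category.id_comp]
    exact congrArg _ h2
  rw [h3, RingHom.comp_apply, hevf, map_zero]

include N in
theorem exists_incToOrbitClosure [CharZero k] :
    ∃ q : incScheme k d₁ hd₂ hr₂ hd₃ ⟶ orbitClosure V,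
      q ≫ orbitClosureι V = incToRep k d₁ hd₂ hr₂ hd₃ := by
  obtain ⟨q, hq⟩ := ChartCover.exists_globalHom_eq (Ideal.Quotient.lift (orbitIdeal V)
    (ChartCover.globalHom (A := MvPolynomial (Coord d₁ d₂ d₃) k)
      (incToRep k d₁ hd₂ hr₂ hd₃)) fun f hf => globalHom_incToRep_eq_zero N hd₂ hr₂ hd₃ hf)
  refine ⟨q, ChartCover.globalHom_injective (A := MvPolynomial (Coord d₁ d₂ d₃) k) ?_⟩
  refine (ChartCover.globalHom_comp_specMap q (Ideal.Quotient.mk (orbitIdeal V))).trans ?_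
  rw [hq, Ideal.Quotient.lift_comp_mk]

variable {hd₂ hr₂ hd₃} {q : incScheme k d₁ hd₂ hr₂ hd₃ ⟶ orbitClosure V}
  (hq : q ≫ orbitClosureι V = incToRep k d₁ hd₂ hr₂ hd₃)

include hq

/-- The ring homomorphism underlying the composite of an affine point of the incidence variety
with the projection. -/
theorem exists_comp_eq_specMap {A : Type u} [CommRing A]
    (x : Spec (CommRingCat.of A) ⟶ incScheme k d₁ hd₂ hr₂ hd₃) :
    ∃ θ : MvPolynomial (Coord d₁ d₂ d₃) k ⧸ orbitIdeal V →+* A, x ≫ q = orbitClosurePoint V θ ∧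
      θ.comp (Ideal.Quotient.mk (orbitIdeal V)) =
        (incPoint hd₂ hr₂ hd₃ x).2.V.evalHom (incPoint hd₂ hr₂ hd₃ x).1 := by
  obtain ⟨θ, hθ⟩ := exists_eq_specMap
    (A := MvPolynomial (Coord d₁ d₂ d₃) k ⧸ orbitIdeal V) (x ≫ q)
  refine ⟨θ, hθ, specMap_injective ?_⟩
  have h : x ≫ incToRep k d₁ hd₂ hr₂ hd₃ = orbitClosurePoint V θ ≫ orbitClosureι V := by
    rw [← hq, show orbitClosurePoint V θ = x ≫ q from hθ.symm, Category.assoc]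
  rw [comp_incToRep] at h
  exact (specMap_comp _ _).trans h.symm

theorem isProper_of_comp_eq : IsProper q := by
  have h1 : IsProper (q ≫ orbitClosureι V) := by
    rw [hq]; infer_instance
  have h2 : IsSeparated (orbitClosureι V) :=
    inferInstanceAs (IsSeparated (Spec.map _))
  exact IsProper.of_comp q (orbitClosureι V)

include N in
-- The image is closed by properness and contains the $k$-points of the orbit. Functions defining it
-- therefore vanish on the orbit, and these are zero in the coordinate ring of the closure.
theorem surjective_of_comp_eq : Surjective q := by
  have := isProper_of_comp_eq hq
  have hcl : IsClosed (Set.range q) := q.isClosedMap.isClosed_range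
  obtain ⟨J, hJ⟩ := (PrimeSpectrum.isClosed_iff_zeroLocus _).1 hcl
  have hJ0 : ∀ g ∈ J, g = 0 := by
    intro g hg
    obtain ⟨f, rfl⟩ := Ideal.Quotient.mk_surjective g
    rw [Ideal.Quotient.eq_zero_iff_mem, mem_orbitIdeal_iff]
    intro W hW
    obtain ⟨P, rfl⟩ := exists_incidencePoint_of_mem_orbit N hd₂ hW
    obtain ⟨x, hx⟩ := exists_incPoint_eq hd₂ hr₂ hd₃ (RingHom.id k) P
    obtain ⟨θ, h1, h2⟩ := exists_comp_eq_specMap hq x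
    rw [hx] at h2
    let pt : Spec (CommRingCat.of k) := (⊥ : PrimeSpectrum k)
    have h3 : (x ≫ q) pt ∈ Set.range q := ⟨x pt, by simp⟩
    rw [hJ, h1] at h3
    have h4 : θ (Ideal.Quotient.mk (orbitIdeal V) f) = 0 := h3 hg
    rw [← h2]
    exact h4
  refine ⟨fun y => ?_⟩
  change y ∈ Set.range q
  rw [hJ]
  intro g hg
  rw [hJ0 g hg]
  exact Submodule.zero_mem _

omit hq

/-- The open subset of the orbit closure where a polynomial does not vanish. -/
def nonvanishing (V : RepSpace k d₁ d₂ d₃) (h : MvPolynomial (Coord d₁ d₂ d₃) k) :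
    (orbitClosure V).Opens :=
  (PrimeSpectrum.basicOpen (Ideal.Quotient.mk (orbitIdeal V) h) :
    TopologicalSpace.Opens (PrimeSpectrum (MvPolynomial (Coord d₁ d₂ d₃) k ⧸ orbitIdeal V)))

theorem orbitClosurePoint_mem_nonvanishing_iff {A : Type u} [CommRing A]
    (θ : MvPolynomial (Coord d₁ d₂ d₃) k ⧸ orbitIdeal V →+* A)
    (h : MvPolynomial (Coord d₁ d₂ d₃) k) (p : Spec (CommRingCat.of A)) :
    orbitClosurePoint V θ p ∈ nonvanishing V h ↔
      θ (Ideal.Quotient.mk (orbitIdeal V) h) ∉ p.asIdeal :=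
  Iff.rfl

theorem isUnit_of_forall_mem_nonvanishing {A : Type u} [CommRing A]
    (θ : MvPolynomial (Coord d₁ d₂ d₃) k ⧸ orbitIdeal V →+* A)
    (h : MvPolynomial (Coord d₁ d₂ d₃) k)
    (H : ∀ p : Spec (CommRingCat.of A), orbitClosurePoint V θ p ∈ nonvanishing V h) :
    IsUnit (θ (Ideal.Quotient.mk (orbitIdeal V) h)) := by
  by_contra hu
  obtain ⟨M, hM, hmem⟩ := exists_max_ideal_of_mem_nonunits hu
  exact (orbitClosurePoint_mem_nonvanishing_iff θ h ⟨M, hM.isPrime⟩).1 (H _) hmem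

include hq in
/-- The projection is a monomorphism over the locus where the minors do not vanish. -/
theorem mono_morphismRestrict (D : MinorChoice k d₁ d₂ d₃ (b₁ + c) b₂ c) :
    Mono (q ∣_ nonvanishing V D.poly) := by
  constructor
  intro T f g hfg
  refine hom_ext_of_affine_points f g fun A _ x => ?_
  have hxfg : (x ≫ f) ≫ q ∣_ nonvanishing V D.poly = (x ≫ g) ≫ q ∣_ nonvanishing V D.poly := by
    rw [Category.assoc, Category.assoc, hfg]
  rw [← cancel_mono (q ⁻¹ᵁ nonvanishing V D.poly).ι]
  have hf := comp_ι_comp q _ (x ≫ f)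
  have hg := comp_ι_comp q _ (x ≫ g)
  rw [← hxfg] at hg
  have hrange (p : Spec (CommRingCat.of A)) :
      ((x ≫ f) ≫ (q ⁻¹ᵁ nonvanishing V D.poly).ι ≫ q) p ∈ nonvanishing V D.poly := by
    rw [← Category.assoc, hf, Scheme.Hom.comp_apply]
    exact (((x ≫ f) ≫ q ∣_ nonvanishing V D.poly) p).2
  rw [← Category.assoc] at hrange
  generalize (x ≫ f) ≫ (q ⁻¹ᵁ nonvanishing V D.poly).ι = y at *
  generalize (x ≫ g) ≫ (q ⁻¹ᵁ nonvanishing V D.poly).ι = z at *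
  obtain ⟨θ, h1, h2⟩ := exists_comp_eq_specMap hq y
  obtain ⟨θ', h1', h2'⟩ := exists_comp_eq_specMap hq z
  -- Both points have the same composite with $q$, hence the same matrices and structure
  -- homomorphism; the invertible minors then force equal flags.
  obtain rfl : θ = θ' := specMap_injective (h1.symm.trans ((hf.trans hg.symm).trans h1'))
  obtain ⟨hκ, hV⟩ := RepSpace.evalHom_injective (h2.symm.trans h2')
  rw [h1] at hrange
  have hu := isUnit_of_forall_mem_nonvanishing θ D.poly hrange
  rw [← RingHom.comp_apply, h2, D.evalHom_poly] at hu
  exact incPoint_injective hd₂ hr₂ hd₃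
    (Prod.ext hκ (MinorChoice.incidencePoint_ext hu hd₂ hV))

include hq N in
-- A proper monomorphism is a closed immersion, and a surjective one onto a reduced scheme is an
-- isomorphism.
theorem isIso_morphismRestrict (D : MinorChoice k d₁ d₂ d₃ (b₁ + c) b₂ c) :
    IsIso (q ∣_ nonvanishing V D.poly) := by
  have h1 := isProper_of_comp_eq hq
  have h2 := surjective_of_comp_eq N hq
  have h3 := isReduced_orbitClosure V
  have h4 := mono_morphismRestrict hq D
  have h5 : IsProper (q ∣_ nonvanishing V D.poly) := inferInstance
  have h6 : IsClosedImmersion (q ∣_ nonvanishing V D.poly) :=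
    (IsClosedImmersion.iff_isProper_and_mono _).2 ⟨h5, h4⟩
  have h7 : Surjective (q ∣_ nonvanishing V D.poly) :=
    IsZariskiLocalAtTarget.restrict h2 _
  exact isIso_of_isClosedImmersion_of_surjective _

include hq N in
theorem isResolutionOfSingularities_of_comp_eq [CharZero k] :
    IsResolutionOfSingularities (incStr k d₁ hd₂ hr₂ hd₃) (orbitClosureStr V) q where
  comp_eq := by
    have h : orbitClosureStr V = orbitClosureι V ≫ specMap MvPolynomial.C := specMap_comp _ _
    rw [h]
    refine (Category.assoc _ _ _).symm.trans ?_
    exact congrArg (fun z => z ≫ specMap MvPolynomial.C) hq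
  integral := inferInstance
  smooth := inferInstance
  proper := isProper_of_comp_eq hq
  birational := by
    obtain ⟨D, hD⟩ := N.hasRanks.exists_minorChoice
    obtain ⟨P, hP⟩ := exists_incidencePoint_of_mem_orbit N hd₂ (N.mem_orbit N)
    obtain ⟨x, hx⟩ := exists_incPoint_eq hd₂ hr₂ hd₃ (RingHom.id k) P
    obtain ⟨θ, h1, h2⟩ := exists_comp_eq_specMap hq x
    let pt : Spec (CommRingCat.of k) := (⊥ : PrimeSpectrum k)
    have hsurj := surjective_of_comp_eq N hq
    -- Irreducibility passes to the orbit closure along the surjection from $Z$.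
    have hirr : IrreducibleSpace (orbitClosure V) := by
      refine @IrreducibleSpace.mk _ _ ⟨?_⟩ ⟨q (x pt)⟩
      rw [← Set.image_univ_of_surjective q.surjective]
      exact (PreirreducibleSpace.isPreirreducible_univ).image _ q.continuous.continuousOn
    -- The point `x` lies over `V`, where the minors do not vanish; so the open set and its preimage
    -- are nonempty, hence dense in irreducible spaces.
    have hmem : (x ≫ q) pt ∈ nonvanishing V D.poly := by
      rw [h1, orbitClosurePoint_mem_nonvanishing_iff, ← RingHom.comp_apply, h2, D.evalHom_poly,
        hx]
      intro h0
      have h3 : D.discr P.V = 0 := h0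
      rw [hP] at h3
      exact hD h3
    rw [Scheme.Hom.comp_apply] at hmem
    exact ⟨nonvanishing V D.poly, (nonvanishing V D.poly).2.dense ⟨_, hmem⟩,
      (q ⁻¹ᵁ nonvanishing V D.poly).2.dense ⟨_, hmem⟩, isIso_morphismRestrict N hq D⟩

include hq in
theorem isFirstProjection_of_comp_eq :
    IsFirstProjection (incidenceVarietyStr k d₁ hd₂ hr₂ hd₃) q := by
  intro A _ _ x
  rw [hq, comp_incToRep, incPoint_fst]
  rfl

end Main

end EquiA3

end

theorem mainTheorem5 {k : Type u} [Field k] [CharZero k]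
    (d₁ d₂ d₃ a₁ a₂ a₃ b₁ b₂ c : ℕ) (V : EquiA3.RepSpace k d₁ d₂ d₃)
    (hV : V.toQRep.Isomorphic (EquiA3.QRep.ofMultiplicities k a₁ a₂ a₃ b₁ b₂ c)) :
    ∃ (Z : Scheme.{u}) (s : Z ⟶ Spec (CommRingCat.of k))
      (e : EquiA3.IncidenceVarietyStr s d₁ d₂ d₃ (b₁ + c) (d₂ - b₂) c)
      (q : Z ⟶ EquiA3.orbitClosure V),
      EquiA3.IsFirstProjection e q ∧
        EquiA3.IsResolutionOfSingularities s (EquiA3.orbitClosureStr V) q := by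
  obtain ⟨N⟩ := EquiA3.nonempty_normalForm hV
  have h₁ := N.dim₂
  have h₂ := N.dim₃
  -- The truncated difference is the true one, since the multiplicities give $b_2\le d_2$; then
  -- $a_2$ is the codimension of $R_1$ in $R_2$ and $a_3+b_2$ that of $R$.
  have hd₂ : d₂ = (d₂ - b₂) + b₂ := by omega
  have hr₂ : d₂ - b₂ = (b₁ + c) + a₂ := by omega
  have hd₃ : d₃ = c + (a₃ + b₂) := by omega
  obtain ⟨q, hq⟩ := EquiA3.exists_incToOrbitClosure N hd₂ hr₂ hd₃
  exact ⟨_, _, EquiA3.incidenceVarietyStr k d₁ hd₂ hr₂ hd₃, q,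
    EquiA3.isFirstProjection_of_comp_eq hq, EquiA3.isResolutionOfSingularities_of_comp_eq N hq⟩
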